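/- For integers $n,N\ge 1$ let $M_N$ be the space of complex $N\times N$ matrices, $U(N)\subset M_N$ the unitary group, $\tau_N=N^{-1}\mathrm{tr}$ and $\|\xi\|_{L_2(\tau_N)}=\tau_N(\xi^*\xi)^{1/2}$. For $x=(x_j),y=(y_j)\in M_N^n$ let $\|\sum_j x_j\otimes\bar y_j\|$ be the operator norm on $\ell_2^N\otimes\ell_2^N$, where $\bar y_j$ is the entrywise complex conjugate of $y_j$. For $\delta>0$, $x$ and $y$ are called $\delta$-separated if $$\Big\|\sum_j x_j\otimes\bar y_j\Big\|\le(1-\delta)\Big\|\sum_j x_j\otimes\bar x_j\Big\|^{1/2}\Big\|\sum_j y_j\otimes\bar y_j\Big\|^{1/2},$$ and a subset of $M_N^n$ is $\delta$-separated if any two distinct members are. For $0<\varepsilon<1$ let $S_\varepsilon=S_\varepsilon(n,N)$ be the set of all $u=(u_j)\in U(N)^n$ such that $$\Big\|\sum_j u_j\xi u_j^*\Big\|_{L_2(\tau_N)}\le\varepsilon n\,\|\xi\|_{L_2(\tau_N)}\quad\text{for all }\xi\in M_N\text{ with }\mathrm{tr}\,\xi=0$$ (quantum expanders with spectral gap $1-\varepsilon$).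 **Theorem.** (i) For every $0<\delta<1$ there is a constant $\beta_\delta>0$ such that for every $0<\varepsilon<1$ there is $n_0=n_0(\varepsilon,\delta)$ such that for all $n\ge n_0$ and all $N\ge1$ there is a finite $\delta$-separated subset $T\subset S_\varepsilon(n,N)$ with $$|T|\ge\exp(\beta_\delta nN^2).$$ (ii) This is optimal up to the constant in the exponent: for all $0<\delta<1$ and $n,N\ge1$, every $\delta$-separated subset $T\subset U(N)^n$ is finite, and $$|T|\le\big(1+\sqrt{2/\delta}\big)^{2nN^2}\le\exp\big(2\sqrt{2/\delta}\;nN^2\big).$$ -/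

import Mathlib

open scoped Kronecker Matrix

noncomputable section

namespace QExp

/-- `n`-tuples of complex `N × N` matrices. -/
abbrev Tuple (n N : ℕ) : Type := Fin n → Matrix (Fin N) (Fin N) ℂ

/-- The set `U(N)^n` of `n`-tuples of unitary `N × N` matrices. -/
def unitaryTuples (n N : ℕ) : Set (Tuple n N) :=
  {u | ∀ j, u j ∈ Matrix.unitaryGroup (Fin N) ℂ}

/-- The operator norm of `∑ j, x j ⊗ conj (y j)` on the Hilbert space `ℓ₂^N ⊗ ℓ₂^N`, where
`conj` is the entrywise complex conjugate. -/
def tensorNorm {n N : ℕ} (x y : Tuple n N) : ℝ :=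
  ‖Matrix.toEuclideanCLM (n := Fin N × Fin N) (𝕜 := ℂ) (∑ j, x j ⊗ₖ (y j).map star)‖

/-- `x` and `y` are `δ`-separated. -/
def Separated {n N : ℕ} (δ : ℝ) (x y : Tuple n N) : Prop :=
  tensorNorm x y ≤ (1 - δ) * (Real.sqrt (tensorNorm x x) * Real.sqrt (tensorNorm y y))

/-- A set of tuples is `δ`-separated if any two distinct members are `δ`-separated. -/
def SeparatedFamily {n N : ℕ} (δ : ℝ) (T : Set (Tuple n N)) : Prop :=
  T.Pairwise (Separated δ)

/-- The norm of `L₂(τ_N)`: `‖ξ‖ = (N⁻¹ tr (ξ* ξ))^{1/2}`. -/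
def hNorm {N : ℕ} (ξ : Matrix (Fin N) (Fin N) ℂ) : ℝ :=
  Real.sqrt ((N : ℝ)⁻¹ * (ξᴴ * ξ).trace.re)

/-- The set `S_ε(n, N)` of all `u ∈ U(N)^n` such that `ξ ↦ ∑ j, u j * ξ * (u j)*` has norm at
most `ε n` on the orthogonal complement (the matrices of trace zero) of the identity. -/
def expanders (ε : ℝ) (n N : ℕ) : Set (Tuple n N) :=
  {u | u ∈ unitaryTuples n N ∧ ∀ ξ : Matrix (Fin N) (Fin N) ℂ, ξ.trace = 0 →
    hNorm (∑ j, u j * ξ * (u j)ᴴ) ≤ ε * n * hNorm ξ}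

end QExp

end

/-! Lower bound. Put σ = 1 - δ; for unitary tuples, δ-separation says ‖∑ u_j ⊗ conj v_j‖ ≤ σ n. Draw
u from Haar measure on U(N)^n. Two estimates suffice: u is an expander with probability at least 1/2
(`half_le_measure_expanders`), and for a fixed expander v the expanders not separated from v have
probability at most exp(-c n N²). A maximal separated family T of expanders then yields |T| such
sets covering all expanders, so |T| ≥ exp(c n N²) / 2.

Second estimate. On matrices, ∑ u_j ⊗ conj v_j is the map ξ ↦ ∑ u_j ξ v_j*, so failure of separation
gives ξ, η in the Hilbert–Schmidt unit ball with Re ∑ tr(u_j ξ v_j* η) > σ n. Nets for ξ and η cost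
exp(C N²), which is harmless for large n. For a fixed pair this is a linear functional of u,
subgaussian with variance of order N⁻¹ ∑ ‖ξ v_j* η‖₂²; for arbitrary ξ, η that gives only exp(-c n
N). The expander property supplies the missing factor N: the part of ξ above the spectral level κ =
1/(σ√N) has trace norm O(√N), and expanders u, v make its contribution at most σ n / 2
(`norm_sum_trace_le_of_posSemidef`). What remains has operator norm at most κ, which lowers the
variance by a factor of order N (`tensorNorm_le_of_not_correlated`, `measure_correlated_le`).

First estimate. For independent Gaussian tuples Y, Y', the moments of ∑ Y_j ⊗ conj Y'_j are sums
over words w of |E tr w(Y)|². Each E tr w(Y) is nonnegative and at most the same moment of one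
Gaussian matrix Z, while the sum over w is the moment of ∑ Y_j, distributed as √n Z. Hence the
expected norm is O(N√n) (`integral_tensorNorm_le`). Decoupling carries this to ξ ↦ ∑ Y_j ξ Y_j* on
matrices of trace zero, where the mean vanishes.

From Gaussian to Haar. If u is Haar and independent of Y, then u|Y| has the law of Y. Averaging over
|Y| alone, E|Z| is a scalar c ≥ √(N/2), and ξ ↦ E |Z| ξ |Z| is a scalar β ≥ N/3 on trace zero, by
unitary invariance. Jensen's inequality then transfers both the norm bound and the subgaussian bound
to u.

Upper bound. Unitary tuples have Euclidean norm √(nN) in real dimension 2nN². Testing separation at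
ξ = 1 puts them at distance at least √(2δnN), and volume comparison of balls bounds their number. -/

noncomputable section

namespace QExp

open MeasureTheory Complex ComplexConjugate

/-! ### The standard complex Gaussian measure -/

/-- The density of the standard complex Gaussian measure. -/
def gaussDensity (z : ℂ) : ℝ := Real.pi⁻¹ * Real.exp (-‖z‖ ^ 2)

lemma gaussDensity_nonneg (z : ℂ) : 0 ≤ gaussDensity z := by
  unfold gaussDensity; positivity

lemma continuous_gaussDensity : Continuous gaussDensity := by
  unfold gaussDensity; fun_prop

/-- The standard complex Gaussian measure, with `E |z|² = 1`. -/
def gaussC : Measure ℂ := volume.withDensity fun z => ENNReal.ofReal (gaussDensity z)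

lemma integral_gaussC {E : Type*} [NormedAddCommGroup E] [NormedSpace ℝ E] (f : ℂ → E) :
    ∫ z, f z ∂gaussC = ∫ z, gaussDensity z • f z := by
  unfold gaussC
  rw [integral_withDensity_eq_integral_toReal_smul
    (continuous_gaussDensity.measurable.ennreal_ofReal) (by simp)]
  simp [ENNReal.toReal_ofReal, gaussDensity_nonneg]

lemma integrable_gaussC {E : Type*} [NormedAddCommGroup E] [NormedSpace ℝ E] {f : ℂ → E} :
    Integrable f gaussC ↔ Integrable fun z => gaussDensity z • f z := by
  unfold gaussC
  rw [integrable_withDensity_iff_integrable_smul'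
    (continuous_gaussDensity.measurable.ennreal_ofReal) (by simp)]
  simp [ENNReal.toReal_ofReal, gaussDensity_nonneg]

lemma integral_gaussC_cexp (c w : ℂ) :
    ∫ z, cexp (c * (inner ℝ w z : ℝ)) ∂gaussC = cexp (c ^ 2 * ‖w‖ ^ 2 / 4) := by
  rw [integral_gaussC]
  have h := GaussianFourier.integral_cexp_neg_mul_sq_norm_add (b := 1) (by simp) c w
  have h2 : ∀ z : ℂ, gaussDensity z • cexp (c * (inner ℝ w z : ℝ))
      = (Real.pi : ℂ)⁻¹ * cexp (-1 * ‖z‖ ^ 2 + c * (inner ℝ w z : ℝ)) := by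
    intro z
    rw [real_smul, gaussDensity, Complex.exp_add]
    push_cast
    ring_nf
  simp_rw [h2]
  rw [integral_const_mul, h, Complex.finrank_real_complex]
  have hpi : (Real.pi : ℂ) ≠ 0 := by exact_mod_cast Real.pi_ne_zero
  norm_num

lemma integrable_exp_neg_mul_sq_norm {b : ℝ} (hb : 0 < b) :
    Integrable fun z : ℂ => Real.exp (-b * ‖z‖ ^ 2) := by
  have h := (GaussianFourier.integrable_cexp_neg_mul_sq_norm_add (V := ℂ) (b := (b : ℂ))
    (by simpa using hb) 0 0).norm
  refine h.congr (Filter.Eventually.of_forall fun z => ?_)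
  simp only [Complex.norm_exp]
  congr 1
  simp only [zero_mul, add_zero]
  norm_cast

lemma integrable_gaussC_exp_mul_sq {b : ℝ} (hb : b < 1) :
    Integrable (fun z : ℂ => Real.exp (b * ‖z‖ ^ 2)) gaussC := by
  rw [integrable_gaussC]
  refine ((integrable_exp_neg_mul_sq_norm (sub_pos.2 hb)).const_mul Real.pi⁻¹).congr
    (Filter.Eventually.of_forall fun z => ?_)
  simp only [gaussDensity, smul_eq_mul]
  rw [mul_assoc, ← Real.exp_add]
  ring_nf

lemma integral_gaussC_exp_half_sq :
    ∫ z, Real.exp (‖z‖ ^ 2 / 2) ∂gaussC = 2 := by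
  rw [integral_gaussC]
  have h := GaussianFourier.integral_rexp_neg_mul_sq_norm (V := ℂ) (b := 1 / 2) (by norm_num)
  have h2 : ∀ z : ℂ, gaussDensity z • Real.exp (‖z‖ ^ 2 / 2)
      = Real.pi⁻¹ * Real.exp (-(1 / 2) * ‖z‖ ^ 2) := by
    intro z
    simp only [gaussDensity, smul_eq_mul]
    rw [mul_assoc, ← Real.exp_add]
    ring_nf
  simp_rw [h2]
  rw [integral_const_mul, h, Complex.finrank_real_complex]
  have := Real.pi_ne_zero
  norm_num
  field_simp

instance : IsProbabilityMeasure gaussC := by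
  have h : Integrable (fun _ : ℂ => (1 : ℝ)) gaussC := by
    simpa using integrable_gaussC_exp_mul_sq (b := 0) (by norm_num)
  have hfin : IsFiniteMeasure gaussC := by
    have := (integrable_const_iff (μ := gaussC) (c := (1 : ℝ))).1 h
    simpa using this
  have h1 := integral_gaussC_cexp 0 0
  simp only [zero_mul, Complex.exp_zero, integral_const] at h1
  norm_num at h1
  constructor
  have h2 : gaussC.real Set.univ = 1 := by exact_mod_cast h1
  rw [measureReal_def] at h2
  rw [← ENNReal.ofReal_toReal (measure_ne_top gaussC Set.univ), h2, ENNReal.ofReal_one]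

lemma integrable_gaussC_exp_mul_norm (a : ℝ) :
    Integrable (fun z : ℂ => Real.exp (a * ‖z‖)) gaussC := by
  refine ((integrable_gaussC_exp_mul_sq (b := 1 / 4) (by norm_num)).const_mul
    (Real.exp (a ^ 2))).mono' (by fun_prop) (Filter.Eventually.of_forall fun z => ?_)
  rw [Real.norm_of_nonneg (Real.exp_pos _).le, ← Real.exp_add, Real.exp_le_exp]
  nlinarith [sq_nonneg (a - ‖z‖ / 2)]

lemma measurePreserving_gaussC_rotation (w : Circle) :
    MeasurePreserving (fun z : ℂ => (w : ℂ) * z) gaussC gaussC := by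
  have h := (rotation w).measurePreserving
  have hr : (rotation w : ℂ → ℂ) = fun z => (w : ℂ) * z := by ext z; simp [rotation_apply]
  rw [hr] at h
  refine ⟨by fun_prop, ?_⟩
  ext s hs
  rw [Measure.map_apply (by fun_prop) hs]
  unfold gaussC
  rw [withDensity_apply _ hs, withDensity_apply _
    (by exact (by fun_prop : Measurable fun z : ℂ => (w : ℂ) * z) hs)]
  rw [← h.setLIntegral_comp_preimage hs (continuous_gaussDensity.measurable.ennreal_ofReal)]
  simp [gaussDensity, Circle.norm_coe]

lemma integral_gaussC_moment_diag (a : ℕ) :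
    ∫ z, z ^ a * conj z ^ a ∂gaussC = (a.factorial : ℂ) := by
  have h := Complex.integral_rpow_mul_exp_neg_rpow (p := 2) (q := 2 * a) (by norm_num)
    (by have : (0 : ℝ) ≤ a := a.cast_nonneg
        linarith)
  rw [integral_gaussC]
  have h2 : ∀ z : ℂ, gaussDensity z • (z ^ a * conj z ^ a)
      = ((Real.pi⁻¹ * (‖z‖ ^ (2 * a : ℝ) * Real.exp (-‖z‖ ^ (2 : ℝ))) : ℝ) : ℂ) := by
    intro z
    rw [← mul_pow, mul_conj, normSq_eq_norm_sq, real_smul, gaussDensity]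
    have : (‖z‖ ^ (2 * a : ℝ) : ℝ) = (‖z‖ ^ 2) ^ a := by
      rw [← pow_mul, ← Real.rpow_natCast]; push_cast; rfl
    rw [this]
    push_cast
    norm_num
    ring
  simp_rw [h2]
  rw [integral_complex_ofReal, integral_const_mul, h]
  have h3 : ((2 * a + 2 : ℝ) / 2) = (a : ℝ) + 1 := by ring
  rw [h3, Real.Gamma_nat_eq_factorial]
  have := Real.pi_ne_zero
  rw [show Real.pi⁻¹ * (2 * Real.pi / 2 * (a.factorial : ℝ)) = a.factorial by field_simp]
  simp

lemma integral_gaussC_moment (a b : ℕ) :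
    ∫ z, z ^ a * conj z ^ b ∂gaussC = if a = b then (a.factorial : ℂ) else 0 := by
  split_ifs with hab
  · subst hab; exact integral_gaussC_moment_diag a
  · have hne : (a : ℝ) - b ≠ 0 := by
      rw [sub_ne_zero]; exact_mod_cast hab
    -- Rotation by θ preserves the measure and multiplies the integrand by exp(i(a - b)θ) = -1.
    set θ : ℝ := Real.pi / (a - b) with hθ
    have h := (measurePreserving_gaussC_rotation (Circle.exp θ))
    have hemb : MeasurableEmbedding fun z : ℂ => (Circle.exp θ : ℂ) * z :=
      (Homeomorph.mulLeft₀ (Circle.exp θ : ℂ) (Circle.coe_ne_zero _)).measurableEmbedding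
    have h1 := h.integral_comp hemb (fun z => z ^ a * conj z ^ b)
    have h2 : ∀ z : ℂ, ((Circle.exp θ : ℂ) * z) ^ a * conj ((Circle.exp θ : ℂ) * z) ^ b
        = -(z ^ a * conj z ^ b) := by
      intro z
      have : (Circle.exp θ : ℂ) ^ a * conj (Circle.exp θ : ℂ) ^ b = -1 := by
        rw [Circle.coe_exp, ← Complex.exp_conj, ← Complex.exp_nat_mul, ← Complex.exp_nat_mul,
          ← Complex.exp_add, ← Complex.exp_pi_mul_I]
        congr 1
        simp only [map_mul, conj_ofReal, conj_I]
        rw [hθ]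
        have hne' : (a : ℂ) - b ≠ 0 := by exact_mod_cast hne
        push_cast
        field_simp
        ring
      rw [map_mul, mul_pow, mul_pow]
      linear_combination (z ^ a * conj z ^ b) * this
    simp_rw [h2, integral_neg] at h1
    have h3 := neg_eq_iff_add_eq_zero.1 h1
    rw [← two_mul] at h3
    simpa using h3

/-! ### Standard Gaussian vectors -/

variable {ι κ : Type*} [Fintype ι] [Fintype κ]

/-- The law of a vector of independent standard complex Gaussian variables. -/
def gauss (ι : Type*) [Fintype ι] : Measure (ι → ℂ) := Measure.pi fun _ => gaussC

instance : IsProbabilityMeasure (gauss ι) := by unfold gauss; infer_instance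

lemma integrable_gauss_exp (a : ℝ) :
    Integrable (fun y : ι → ℂ => Real.exp (a * ∑ i, ‖y i‖)) (gauss ι) := by
  have := Integrable.fintype_prod (μ := fun _ : ι => gaussC)
    (f := fun _ z => Real.exp (a * ‖z‖)) fun _ => integrable_gaussC_exp_mul_norm a
  refine this.congr (Filter.Eventually.of_forall fun y => ?_)
  simp [Finset.mul_sum, Real.exp_sum]

/-- A continuous function of at most exponential growth is integrable. -/
lemma integrable_gauss_of_le {E : Type*} [NormedAddCommGroup E] {f : (ι → ℂ) → E}
    (hf : AEStronglyMeasurable f (gauss ι)) (C a : ℝ)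
    (h : ∀ y, ‖f y‖ ≤ C * Real.exp (a * ∑ i, ‖y i‖)) : Integrable f (gauss ι) :=
  ((integrable_gauss_exp a).const_mul C).mono' hf (Filter.Eventually.of_forall h)

lemma integral_gauss_cexp (c : ℂ) (w : ι → ℂ) :
    ∫ y, cexp (c * ((∑ i, inner ℝ (w i) (y i) : ℝ) : ℂ)) ∂gauss ι
      = cexp (c ^ 2 * (∑ i, ‖w i‖ ^ 2 : ℝ) / 4) := by
  have h := integral_fintype_prod_eq_prod (𝕜 := ℂ) (μ := fun _ : ι => gaussC)
    (fun i z => cexp (c * (inner ℝ (w i) z : ℝ)))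
  simp_rw [integral_gaussC_cexp, ← Complex.exp_sum] at h
  unfold gauss
  simp_rw [Complex.ofReal_sum, Finset.mul_sum, Finset.sum_div]
  simpa using h

lemma integral_gauss_exp (w : ι → ℂ) :
    ∫ y, Real.exp (∑ i, inner ℝ (w i) (y i)) ∂gauss ι = Real.exp ((∑ i, ‖w i‖ ^ 2) / 4) := by
  have h := integral_gauss_cexp 1 w
  have h2 : ∀ y : ι → ℂ, cexp (1 * ((∑ i, inner ℝ (w i) (y i) : ℝ) : ℂ))
      = ((Real.exp (∑ i, inner ℝ (w i) (y i)) : ℝ) : ℂ) := by intro y; simp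
  simp_rw [h2] at h
  rw [integral_complex_ofReal] at h
  have h3 : cexp (1 ^ 2 * (∑ i, ‖w i‖ ^ 2 : ℝ) / 4) = (Real.exp ((∑ i, ‖w i‖ ^ 2) / 4) : ℝ) := by
    push_cast; simp
  rw [h3] at h
  exact_mod_cast h

/-- A map whose adjoint is isometric pushes a standard Gaussian vector to a standard Gaussian
vector. -/
lemma measurePreserving_gauss {L : (ι → ℂ) → (κ → ℂ)} (L' : (κ → ℂ) → (ι → ℂ))
    (hL : Measurable L)
    (hadj : ∀ t y, ∑ k, inner ℝ (t k) (L y k) = ∑ i, inner ℝ (L' t i) (y i))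
    (hiso : ∀ t, ∑ i, ‖L' t i‖ ^ 2 = ∑ k, ‖t k‖ ^ 2) :
    MeasurePreserving L (gauss ι) (gauss κ) := by
  refine ⟨hL, ?_⟩
  have hprob : IsProbabilityMeasure ((gauss ι).map L) := Measure.isProbabilityMeasure_map hL.aemeasurable
  -- Characteristic functions need an inner product, hence the detour through the Euclidean norm. At
  -- t they agree because ⟨t, Ly⟩ = ⟨L't, y⟩ and a Gaussian transform depends only on ‖L't‖ = ‖t‖.
  have key : ((gauss ι).map L).map (WithLp.toLp 2) = (gauss κ).map (WithLp.toLp 2) := by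
    have hm : Measurable (WithLp.toLp 2 : (κ → ℂ) → PiLp 2 fun _ => ℂ) := by fun_prop
    have := Measure.isProbabilityMeasure_map (μ := (gauss ι).map L) hm.aemeasurable
    have := Measure.isProbabilityMeasure_map (μ := gauss κ) hm.aemeasurable
    apply Measure.ext_of_charFun (E := PiLp 2 fun _ : κ => ℂ)
    ext t
    have e1 : ∀ w : ι → ℂ, ∫ y, cexp (((∑ i, inner ℝ (w i) (y i) : ℝ) : ℂ) * I) ∂gauss ι
      = cexp (I ^ 2 * (∑ i, ‖w i‖ ^ 2 : ℝ) / 4) := by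
      intro w; rw [← integral_gauss_cexp]; simp_rw [mul_comm]
    have e2 : ∀ w : κ → ℂ, ∫ y, cexp (((∑ i, inner ℝ (w i) (y i) : ℝ) : ℂ) * I) ∂gauss κ
      = cexp (I ^ 2 * (∑ i, ‖w i‖ ^ 2 : ℝ) / 4) := by
      intro w; rw [← integral_gauss_cexp]; simp_rw [mul_comm]
    rw [charFun_apply, charFun_apply]
    simp_rw [real_inner_comm t]
    rw [integral_map hm.aemeasurable (by fun_prop), integral_map hm.aemeasurable (by fun_prop),
      integral_map hL.aemeasurable (by fun_prop)]
    simp only [PiLp.inner_apply]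
    rw [e2]
    simp_rw [hadj]
    rw [e1, hiso]
  have := congrArg (Measure.map (WithLp.ofLp : (PiLp 2 fun _ : κ => ℂ) → (κ → ℂ))) key
  have hid : (WithLp.ofLp : (PiLp 2 fun _ : κ => ℂ) → (κ → ℂ)) ∘ WithLp.toLp 2 = id := rfl
  rwa [Measure.map_map (μ := (gauss ι).map L) (by fun_prop) (by fun_prop),
    Measure.map_map (μ := gauss κ) (by fun_prop) (by fun_prop), hid, Measure.map_id,
    Measure.map_id] at this

lemma integral_gauss_comp {E : Type*} [NormedAddCommGroup E] [NormedSpace ℝ E]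
    {L : (ι → ℂ) → (κ → ℂ)} (hL : MeasurePreserving L (gauss ι) (gauss κ))
    {f : (κ → ℂ) → E} (hf : AEStronglyMeasurable f (gauss κ)) :
    ∫ y, f (L y) ∂gauss ι = ∫ z, f z ∂gauss κ := by
  rw [← hL.map_eq] at hf ⊢
  rw [integral_map hL.aemeasurable hf]

end QExp
end

/-! ### Volumetric packing, the operator picture of the tensor norm, and the upper bound. -/

noncomputable section

namespace QExp

open MeasureTheory Complex ComplexConjugate Module Metric

/-! ### Separated sets and nets -/

section Packing

variable {E : Type*} [NormedAddCommGroup E] [NormedSpace ℝ E] [FiniteDimensional ℝ E]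

/-- A `θ`-separated subset of a ball of radius `R` has at most `(1 + 2R/θ) ^ dim` elements. -/
lemma card_le_of_separated_ball (s : Finset E) {R θ : ℝ} (hR : 0 ≤ R) (hθ : 0 < θ)
    (hs : ∀ c ∈ s, ‖c‖ ≤ R) (h : ∀ c ∈ s, ∀ d ∈ s, c ≠ d → θ ≤ ‖c - d‖) :
    (s.card : ℝ) ≤ (1 + 2 * R / θ) ^ finrank ℝ E := by
  borelize E
  let μ : Measure E := Measure.addHaar
  set r : ℝ := θ / 2 with hr
  have hr0 : 0 < r := by positivity
  have hρ : 0 < R + r := by positivity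
  have D : Set.Pairwise (s : Set E) (Function.onFun Disjoint fun c => ball (c : E) r) := by
    rintro c hc d hd hcd
    apply ball_disjoint_ball
    rw [dist_eq_norm]
    have := h c hc d hd hcd
    linarith
  have A_subset : (⋃ c ∈ s, ball (c : E) r) ⊆ ball (0 : E) (R + r) := by
    refine Set.iUnion₂_subset fun x hx => ball_subset_ball' ?_
    rw [dist_zero_right]
    linarith [hs x hx]
  have I : (s.card : ENNReal) * ENNReal.ofReal (r ^ finrank ℝ E) * μ (ball 0 1) ≤
      ENNReal.ofReal ((R + r) ^ finrank ℝ E) * μ (ball 0 1) :=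
    calc
      (s.card : ENNReal) * ENNReal.ofReal (r ^ finrank ℝ E) * μ (ball 0 1)
          = μ (⋃ c ∈ s, ball (c : E) r) := by
        rw [measure_biUnion_finset D fun c _ => measurableSet_ball]
        simp only [μ.addHaar_ball_of_pos _ hr0]
        simp only [Finset.sum_const, nsmul_eq_mul, mul_assoc]
      _ ≤ μ (ball (0 : E) (R + r)) := measure_mono A_subset
      _ = ENNReal.ofReal ((R + r) ^ finrank ℝ E) * μ (ball 0 1) := by
        simp only [μ.addHaar_ball_of_pos _ hρ]
  have J : (s.card : ENNReal) * ENNReal.ofReal (r ^ finrank ℝ E)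
      ≤ ENNReal.ofReal ((R + r) ^ finrank ℝ E) :=
    (ENNReal.mul_le_mul_iff_left (measure_ball_pos _ _ zero_lt_one).ne' measure_ball_lt_top.ne).1 I
  have K := ENNReal.toReal_le_of_le_ofReal (pow_nonneg hρ.le _) J
  rw [ENNReal.toReal_mul, ENNReal.toReal_natCast, ENNReal.toReal_ofReal (by positivity),
    ← le_div_iff₀ (by positivity), ← div_pow] at K
  have e : (R + r) / r = 1 + 2 * R / θ := by
    rw [hr]
    field_simp
    ring
  rwa [e] at K

/-- A uniform bound on cardinalities lets one take a family of greatest size, so no choice principle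
is involved. Symmetry of `r` is not assumed, so maximality says only that one of the two orders
fails. This serves both for nets and for the final separated family. -/
lemma exists_maximal_pairwise {α : Type*} (r : α → α → Prop) (A : Set α) (B : ℕ)
    (hB : ∀ t : Finset α, (t : Set α) ⊆ A → (t : Set α).Pairwise r → t.card ≤ B) :
    ∃ t : Finset α, (t : Set α) ⊆ A ∧ (t : Set α).Pairwise r ∧
      ∀ x ∈ A, x ∉ t → ∃ y ∈ t, ¬(r x y ∧ r y x) := by
  classical
  let P : ℕ → Prop := fun k => ∃ t : Finset α, (t : Set α) ⊆ A ∧ (t : Set α).Pairwise r ∧ t.card = k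
  have h0 : P 0 := ⟨∅, by simp, by simp, by simp⟩
  obtain ⟨t, htA, htr, htc⟩ := Nat.findGreatest_spec (P := P) (Nat.zero_le B) h0
  refine ⟨t, htA, htr, fun x hx hxt => ?_⟩
  by_contra! hcon
  have hins : (insert x t : Finset α).card = t.card + 1 := Finset.card_insert_of_notMem hxt
  have hP : P (t.card + 1) := by
    refine ⟨insert x t, ?_, ?_, hins⟩
    · rw [Finset.coe_insert]; exact Set.insert_subset hx htA
    · rw [Finset.coe_insert, Set.pairwise_insert]
      exact ⟨htr, fun y hy _ => hcon y hy⟩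
  have hle : t.card + 1 ≤ B := by
    obtain ⟨t', h1, h2, h3⟩ := hP
    rw [← h3]; exact hB t' h1 h2
  have := Nat.le_findGreatest hle hP
  omega

lemma exists_net (A : Set E) {R θ : ℝ} (hR : 0 ≤ R) (hθ : 0 < θ) (hA : ∀ x ∈ A, ‖x‖ ≤ R) :
    ∃ t : Finset E, (t : Set E) ⊆ A ∧ (t.card : ℝ) ≤ (1 + 2 * R / θ) ^ finrank ℝ E ∧
      ∀ x ∈ A, ∃ y ∈ t, ‖x - y‖ < θ := by
  have hbound : ∀ t : Finset E, (t : Set E) ⊆ A → (t : Set E).Pairwise (fun x y => θ ≤ ‖x - y‖) →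
      (t.card : ℝ) ≤ (1 + 2 * R / θ) ^ finrank ℝ E := fun t ht hp =>
    card_le_of_separated_ball t hR hθ (fun c hc => hA c (ht hc))
      (fun c hc d hd hcd => hp hc hd hcd)
  obtain ⟨t, h1, h2, h3⟩ := exists_maximal_pairwise (fun x y : E => θ ≤ ‖x - y‖) A
    ⌊(1 + 2 * R / θ) ^ finrank ℝ E⌋₊ (fun t ht hp => Nat.le_floor (hbound t ht hp))
  refine ⟨t, h1, hbound t h1 h2, fun x hx => ?_⟩
  by_cases hxt : x ∈ t
  · exact ⟨x, hxt, by simpa using hθ⟩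
  · obtain ⟨y, hy, hxy⟩ := h3 x hx hxt
    refine ⟨y, hy, ?_⟩
    by_contra! hcon
    exact hxy ⟨hcon, by rwa [norm_sub_rev]⟩

end Packing

/-! ### The Hilbert–Schmidt norm -/

variable {n N : ℕ}

/-- Complex matrices of size `N`. -/
abbrev Mat (N : ℕ) : Type := Matrix (Fin N) (Fin N) ℂ

/-- The vector of entries of a matrix. -/
def vecE : Mat N →ₗ[ℂ] EuclideanSpace ℂ (Fin N × Fin N) where
  toFun ξ := WithLp.toLp 2 fun p => ξ p.1 p.2
  map_add' _ _ := rfl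
  map_smul' _ _ := rfl

/-- The matrix with a given vector of entries. -/
def unvecE (v : EuclideanSpace ℂ (Fin N × Fin N)) : Mat N := Matrix.of fun a b => v (a, b)

@[simp] lemma vecE_apply (ξ : Mat N) (p : Fin N × Fin N) : vecE ξ p = ξ p.1 p.2 := rfl

@[simp] lemma vecE_unvecE (v : EuclideanSpace ℂ (Fin N × Fin N)) : vecE (unvecE v) = v := rfl

/-- The Hilbert–Schmidt norm. -/
def frob (ξ : Mat N) : ℝ := ‖vecE ξ‖

lemma frob_nonneg (ξ : Mat N) : 0 ≤ frob ξ := norm_nonneg _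

lemma inner_vecE (η ξ : Mat N) : inner ℂ (vecE η) (vecE ξ) = (ηᴴ * ξ).trace := by
  simp only [PiLp.inner_apply, vecE_apply, RCLike.inner_apply, Matrix.trace, Matrix.diag,
    Matrix.mul_apply, Matrix.conjTranspose_apply, Fintype.sum_prod_type]
  rw [Finset.sum_comm]
  simp [mul_comm]

lemma frob_sq_eq_trace (ξ : Mat N) : ((frob ξ ^ 2 : ℝ) : ℂ) = (ξᴴ * ξ).trace := by
  rw [← inner_vecE, inner_self_eq_norm_sq_to_K]; simp [frob]

lemma frob_sq (ξ : Mat N) : frob ξ ^ 2 = (ξᴴ * ξ).trace.re := by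
  rw [← frob_sq_eq_trace, Complex.ofReal_re]

lemma frob_sq_eq_sum (ξ : Mat N) : frob ξ ^ 2 = ∑ a, ∑ b, ‖ξ a b‖ ^ 2 := by
  rw [frob, EuclideanSpace.norm_sq_eq, Fintype.sum_prod_type]; rfl

lemma frob_eq_of_sq {ξ η : Mat N} (h : (ξᴴ * ξ).trace = (ηᴴ * η).trace) : frob ξ = frob η := by
  rw [← frob_sq_eq_trace, ← frob_sq_eq_trace] at h
  have h' : frob ξ ^ 2 = frob η ^ 2 := by exact_mod_cast h
  exact (pow_left_inj₀ (frob_nonneg _) (frob_nonneg _) two_ne_zero).1 h'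

@[simp] lemma frob_conjTranspose (ξ : Mat N) : frob ξᴴ = frob ξ :=
  frob_eq_of_sq (by rw [Matrix.conjTranspose_conjTranspose, Matrix.trace_mul_comm])

lemma frob_smul (c : ℂ) (ξ : Mat N) : frob (c • ξ) = ‖c‖ * frob ξ := by
  simp only [frob, map_smul, norm_smul]

lemma frob_sum_le {α : Type*} (s : Finset α) (f : α → Mat N) :
    frob (∑ j ∈ s, f j) ≤ ∑ j ∈ s, frob (f j) := by
  simp only [frob, map_sum]; exact norm_sum_le _ _

lemma norm_trace_mul_le (A B : Mat N) : ‖(A * B).trace‖ ≤ frob A * frob B := by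
  have := norm_inner_le_norm (𝕜 := ℂ) (vecE Aᴴ) (vecE B)
  rwa [inner_vecE, Matrix.conjTranspose_conjTranspose, ← frob, ← frob, frob_conjTranspose] at this

lemma frob_one_sq : frob (1 : Mat N) ^ 2 = N := by
  rw [frob_sq]; simp

lemma frob_one : frob (1 : Mat N) = Real.sqrt N := by
  rw [← frob_one_sq, Real.sqrt_sq (frob_nonneg _)]

lemma norm_trace_le (A : Mat N) : ‖A.trace‖ ≤ Real.sqrt N * frob A := by
  have := norm_trace_mul_le (1 : Mat N) A
  rwa [one_mul, frob_one] at this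

lemma frob_unitary_mul {U : Mat N} (hU : U ∈ Matrix.unitaryGroup (Fin N) ℂ) (A : Mat N) :
    frob (U * A) = frob A := by
  apply frob_eq_of_sq
  rw [Matrix.conjTranspose_mul, Matrix.mul_assoc, ← Matrix.mul_assoc Uᴴ,
    ← Matrix.star_eq_conjTranspose U, Matrix.mem_unitaryGroup_iff'.1 hU, Matrix.one_mul]

lemma conjTranspose_mem_unitaryGroup {U : Mat N} (hU : U ∈ Matrix.unitaryGroup (Fin N) ℂ) :
    Uᴴ ∈ Matrix.unitaryGroup (Fin N) ℂ := Unitary.star_mem hU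

lemma frob_mul_unitary {U : Mat N} (hU : U ∈ Matrix.unitaryGroup (Fin N) ℂ) (A : Mat N) :
    frob (A * U) = frob A := by
  rw [← frob_conjTranspose, Matrix.conjTranspose_mul,
    frob_unitary_mul (conjTranspose_mem_unitaryGroup hU), frob_conjTranspose]

lemma frob_unitary {U : Mat N} (hU : U ∈ Matrix.unitaryGroup (Fin N) ℂ) :
    frob U = Real.sqrt N := by
  have := frob_unitary_mul hU 1
  rwa [mul_one, frob_one] at this

lemma hNorm_eq (ξ : Mat N) : hNorm ξ = Real.sqrt ((N : ℝ)⁻¹) * frob ξ := by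
  rw [hNorm, ← frob_sq, Real.sqrt_mul (by positivity), Real.sqrt_sq (frob_nonneg _)]

/-! ### The norm of `∑ x j ⊗ conj (y j)` -/

/-- The operator `∑ x j ⊗ conj (y j)`. -/
def tensorOp (x y : Tuple n N) :
    EuclideanSpace ℂ (Fin N × Fin N) →L[ℂ] EuclideanSpace ℂ (Fin N × Fin N) :=
  Matrix.toEuclideanCLM (n := Fin N × Fin N) (𝕜 := ℂ) (∑ j, x j ⊗ₖ (y j).map star)

lemma tensorNorm_eq (x y : Tuple n N) : tensorNorm x y = ‖tensorOp x y‖ := rfl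

/-- The identification on which everything rests: ℓ₂ ⊗ ℓ₂ is the Hilbert–Schmidt space, and A ⊗ conj
B acts there as ξ ↦ A ξ B*. -/
lemma tensorOp_vecE (x y : Tuple n N) (ξ : Mat N) :
    tensorOp x y (vecE ξ) = vecE (∑ j, x j * ξ * (y j)ᴴ) := by
  ext p
  simp only [tensorOp, map_sum, _root_.sum_apply, WithLp.ofLp_sum, Finset.sum_apply]
  refine Finset.sum_congr rfl fun j _ => ?_
  rw [Matrix.ofLp_toEuclideanCLM]
  simp only [Matrix.mulVec, dotProduct, Matrix.kroneckerMap_apply, Matrix.map_apply, vecE_apply,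
    Fintype.sum_prod_type, Matrix.mul_apply, Matrix.conjTranspose_apply, Finset.sum_mul]
  rw [Finset.sum_comm]
  refine Finset.sum_congr rfl fun a _ => Finset.sum_congr rfl fun b _ => by ring

lemma frob_sum_le_tensorNorm (x y : Tuple n N) (ξ : Mat N) :
    frob (∑ j, x j * ξ * (y j)ᴴ) ≤ tensorNorm x y * frob ξ := by
  rw [frob, ← tensorOp_vecE, tensorNorm_eq]
  exact (tensorOp x y).le_opNorm _

lemma tensorNorm_le {x y : Tuple n N} {C : ℝ} (hC : 0 ≤ C)
    (h : ∀ ξ, frob (∑ j, x j * ξ * (y j)ᴴ) ≤ C * frob ξ) : tensorNorm x y ≤ C := by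
  rw [tensorNorm_eq]
  refine ContinuousLinearMap.opNorm_le_bound _ hC fun v => ?_
  have := h (unvecE v)
  rwa [frob, ← tensorOp_vecE, frob, vecE_unvecE] at this

lemma tensorNorm_nonneg (x y : Tuple n N) : 0 ≤ tensorNorm x y := norm_nonneg _

lemma tensorNorm_unitary_le {x y : Tuple n N} (hx : x ∈ unitaryTuples n N)
    (hy : y ∈ unitaryTuples n N) : tensorNorm x y ≤ n := by
  refine tensorNorm_le (by positivity) fun ξ => (frob_sum_le _ _).trans (le_of_eq ?_)
  simp [frob_mul_unitary (conjTranspose_mem_unitaryGroup (hy _)), frob_unitary_mul (hx _)]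

/-- The triangle inequality gives n as an upper bound, and the identity matrix is an eigenvector
with eigenvalue n. Separation of unitary tuples thus becomes a bound by (1 - δ) n. -/
lemma tensorNorm_self_of_unitary (hN : 1 ≤ N) {u : Tuple n N} (hu : u ∈ unitaryTuples n N) :
    tensorNorm u u = n := by
  refine le_antisymm (tensorNorm_unitary_le hu hu) ?_
  have h := frob_sum_le_tensorNorm u u 1
  have h1 : ∀ j, u j * 1 * (u j)ᴴ = 1 := fun j => by
    rw [mul_one]; exact Matrix.mem_unitaryGroup_iff.1 (hu j)
  simp_rw [h1] at h
  rw [Finset.sum_const, Finset.card_univ, Fintype.card_fin, ← Nat.cast_smul_eq_nsmul ℂ,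
    frob_smul, Complex.norm_natCast] at h
  refine le_of_mul_le_mul_right h ?_
  rw [frob_one]
  exact Real.sqrt_pos.2 (by exact_mod_cast hN)

lemma separated_iff_of_unitary (hN : 1 ≤ N) {δ : ℝ} {x y : Tuple n N}
    (hx : x ∈ unitaryTuples n N) (hy : y ∈ unitaryTuples n N) :
    Separated δ x y ↔ tensorNorm x y ≤ (1 - δ) * n := by
  rw [Separated, tensorNorm_self_of_unitary hN hx, tensorNorm_self_of_unitary hN hy,
    Real.mul_self_sqrt (by positivity)]

/-! ### The upper bound -/

/-- The vector of all entries of a tuple of matrices. -/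
def tupE (x : Tuple n N) : EuclideanSpace ℂ (Fin n × Fin N × Fin N) :=
  WithLp.toLp 2 fun p => x p.1 p.2.1 p.2.2

lemma tupE_injective : Function.Injective (tupE (n := n) (N := N)) := by
  intro x y h
  ext j a b
  exact congrArg (fun v => v (j, a, b)) h

lemma norm_tupE_sq (x : Tuple n N) : ‖tupE x‖ ^ 2 = ∑ j, frob (x j) ^ 2 := by
  rw [EuclideanSpace.norm_sq_eq, Fintype.sum_prod_type]
  refine Finset.sum_congr rfl fun j _ => ?_
  rw [frob_sq_eq_sum, Fintype.sum_prod_type]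
  rfl

lemma norm_tupE_of_unitary {x : Tuple n N} (hx : x ∈ unitaryTuples n N) :
    ‖tupE x‖ = Real.sqrt (n * N) := by
  rw [← Real.sqrt_sq (norm_nonneg (tupE x)), norm_tupE_sq]
  simp [frob_unitary (hx _)]

/-- Testing the operator at ξ = 1 gives Re ∑ tr(x_j y_j*) ≤ (1 - δ) n N; now expand the square of
the distance between two vectors of squared length nN. -/
lemma norm_tupE_sub_of_separated {δ : ℝ} (hN : 1 ≤ N) {x y : Tuple n N}
    (hx : x ∈ unitaryTuples n N) (hy : y ∈ unitaryTuples n N) (h : Separated δ x y) :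
    Real.sqrt (2 * δ * (n * N)) ≤ ‖tupE x - tupE y‖ := by
  apply Real.sqrt_le_iff.2 ⟨norm_nonneg _, ?_⟩
  rw [separated_iff_of_unitary hN hx hy] at h
  have h1 : tupE x - tupE y = tupE (x - y) := rfl
  have h2 : ∀ j, frob ((x - y) j) ^ 2 = 2 * N - 2 * (x j * (y j)ᴴ).trace.re := by
    intro j
    rw [Pi.sub_apply, frob, map_sub, @norm_sub_sq ℂ, inner_vecE, ← frob, ← frob,
      frob_unitary (hx j), frob_unitary (hy j), Real.sq_sqrt (by positivity)]
    have : ((x j)ᴴ * y j).trace.re = (x j * (y j)ᴴ).trace.re := by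
      rw [← Complex.conj_re, starRingEnd_apply, ← Matrix.trace_conjTranspose, Matrix.conjTranspose_mul,
        Matrix.conjTranspose_conjTranspose, Matrix.trace_mul_comm]
    rw [RCLike.re_eq_complex_re, this]
    ring
  have h3 : ∑ j, (x j * (y j)ᴴ).trace.re ≤ (1 - δ) * n * N := by
    have e1 : ∑ j, (x j * (y j)ᴴ).trace.re = (∑ j, x j * 1 * (y j)ᴴ).trace.re := by
      simp [Matrix.trace_sum]
    rw [e1]
    calc (∑ j, x j * 1 * (y j)ᴴ).trace.re ≤ ‖(∑ j, x j * 1 * (y j)ᴴ).trace‖ := Complex.re_le_norm _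
      _ ≤ Real.sqrt N * frob (∑ j, x j * 1 * (y j)ᴴ) := norm_trace_le _
      _ ≤ Real.sqrt N * (tensorNorm x y * frob 1) := by gcongr; exact frob_sum_le_tensorNorm _ _ _
      _ ≤ Real.sqrt N * ((1 - δ) * n * frob 1) := by gcongr; exact frob_nonneg _
      _ = (1 - δ) * n * N := by
        rw [frob_one]; rw [mul_left_comm, Real.mul_self_sqrt (by positivity)]
  rw [h1, norm_tupE_sq]
  simp_rw [h2]
  rw [Finset.sum_sub_distrib, ← Finset.mul_sum (a := (2 : ℝ)) (f := fun j => (x j * (y j)ᴴ).trace.re)]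
  simp only [Finset.sum_const, Finset.card_univ, Fintype.card_fin, nsmul_eq_mul]
  nlinarith

lemma card_le_of_separatedFamily {δ : ℝ} (hδ : 0 < δ) (hn : 1 ≤ n) (hN : 1 ≤ N)
    (t : Finset (Tuple n N)) (ht : (t : Set (Tuple n N)) ⊆ unitaryTuples n N)
    (hs : SeparatedFamily δ (t : Set (Tuple n N))) :
    (t.card : ℝ) ≤ (1 + Real.sqrt (2 / δ)) ^ (2 * n * N ^ 2) := by
  classical
  have hnN : (0 : ℝ) < n * N := by positivity
  have h := card_le_of_separated_ball (t.image tupE) (R := Real.sqrt (n * N))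
    (θ := Real.sqrt (2 * δ * (n * N))) (by positivity) (by positivity)
    (by
      intro c hc
      obtain ⟨x, hx, rfl⟩ := Finset.mem_image.1 hc
      exact (norm_tupE_of_unitary (ht hx)).le)
    (by
      intro c hc d hd hcd
      obtain ⟨x, hx, rfl⟩ := Finset.mem_image.1 hc
      obtain ⟨y, hy, rfl⟩ := Finset.mem_image.1 hd
      exact norm_tupE_sub_of_separated hN (ht hx) (ht hy) (hs hx hy (fun h => hcd (by rw [h]))))
  rw [Finset.card_image_of_injective _ tupE_injective] at h
  have hfr : finrank ℝ (EuclideanSpace ℂ (Fin n × Fin N × Fin N)) = 2 * n * N ^ 2 := by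
    rw [← finrank_mul_finrank ℝ ℂ (EuclideanSpace ℂ (Fin n × Fin N × Fin N)),
      Complex.finrank_real_complex, finrank_euclideanSpace]
    simp
    ring
  rw [hfr] at h
  convert h using 3
  rw [Real.sqrt_mul (x := 2 * δ) (by positivity)]
  have e1 : Real.sqrt (n * N) ≠ 0 := (Real.sqrt_pos.2 hnN).ne'
  rw [Real.sqrt_div (by norm_num), Real.sqrt_mul (by norm_num)]
  have e2 : Real.sqrt δ ≠ 0 := (Real.sqrt_pos.2 hδ).ne'
  have e3 : Real.sqrt 2 ≠ 0 := by positivity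
  have e4 : Real.sqrt 2 * Real.sqrt 2 = 2 := Real.mul_self_sqrt (by norm_num)
  field_simp
  rw [Real.sqrt_mul (by norm_num)]
  linear_combination Real.sqrt δ * e4

theorem separated_upper_bound {δ : ℝ} (hδ : 0 < δ) (hn : 1 ≤ n) (hN : 1 ≤ N)
    (T : Set (Tuple n N)) (hT : T ⊆ unitaryTuples n N) (hs : SeparatedFamily δ T) :
    T.Finite ∧ (T.ncard : ℝ) ≤ (1 + Real.sqrt (2 / δ)) ^ (2 * n * N ^ 2) ∧
      (T.ncard : ℝ) ≤ Real.exp (2 * Real.sqrt (2 / δ) * n * (N : ℝ) ^ 2) := by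
  have hb : ∀ t : Finset (Tuple n N), (t : Set (Tuple n N)) ⊆ T →
      (t.card : ℝ) ≤ (1 + Real.sqrt (2 / δ)) ^ (2 * n * N ^ 2) := fun t ht =>
    card_le_of_separatedFamily hδ hn hN t (ht.trans hT) (hs.mono ht)
  have hfin : T.Finite := by
    by_contra hinf
    obtain ⟨t, ht, hc⟩ := Set.Infinite.exists_subset_card_eq hinf
      (⌊(1 + Real.sqrt (2 / δ)) ^ (2 * n * N ^ 2)⌋₊ + 1)
    have h1 := Nat.le_floor (hb t ht)
    omega
  have h1 : (T.ncard : ℝ) ≤ (1 + Real.sqrt (2 / δ)) ^ (2 * n * N ^ 2) := by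
    rw [Set.ncard_eq_toFinset_card T hfin]
    exact hb _ (by simp)
  refine ⟨hfin, h1, h1.trans ?_⟩
  calc (1 + Real.sqrt (2 / δ)) ^ (2 * n * N ^ 2)
      ≤ Real.exp (Real.sqrt (2 / δ)) ^ (2 * n * N ^ 2) := by
        gcongr
        rw [add_comm]; exact Real.add_one_le_exp _
    _ = _ := by
      rw [← Real.exp_nat_mul]; congr 1; push_cast; ring

end QExp
end

/-! ### Positivity and monotonicity of Gaussian word moments. -/

noncomputable section

namespace QExp

open MeasureTheory Complex ComplexConjugate
open scoped ComplexOrder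

/-! ### Gaussian moments of polynomials with nonnegative coefficients -/

section Moments

variable {ι κ : Type*} [Fintype ι] [Fintype κ]

lemma integrable_gaussC_monomial (a b : ℕ) :
    Integrable (fun z : ℂ => z ^ a * conj z ^ b) gaussC := by
  refine ((integrable_gaussC_exp_mul_norm 1).const_mul ((a + b).factorial : ℝ)).mono'
    (by fun_prop) (Filter.Eventually.of_forall fun z => ?_)
  have h := Real.pow_div_factorial_le_exp ‖z‖ (norm_nonneg z) (a + b)
  rw [div_le_iff₀ (by positivity)] at h
  simpa [pow_add, mul_comm] using h

lemma integrable_gauss_monomial (a b : ι → ℕ) :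
    Integrable (fun y : ι → ℂ => (∏ i, y i ^ a i) * ∏ i, conj (y i) ^ b i) (gauss ι) := by
  have := Integrable.fintype_prod (μ := fun _ : ι => gaussC)
    (f := fun i z => z ^ a i * conj z ^ b i) fun i => integrable_gaussC_monomial _ _
  simp only [Finset.prod_mul_distrib] at this
  exact this

lemma integral_gauss_monomial (a b : ι → ℕ) :
    ∫ y, (∏ i, y i ^ a i) * ∏ i, conj (y i) ^ b i ∂gauss ι
      = ((if a = b then ∏ i, (a i).factorial else 0 : ℕ) : ℂ) := by
  have h := integral_fintype_prod_eq_prod (𝕜 := ℂ) (μ := fun _ : ι => gaussC)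
    (fun i z => z ^ a i * conj z ^ b i)
  simp only [integral_gaussC_moment, Finset.prod_mul_distrib] at h
  rw [gauss, h]
  split_ifs with hab
  · subst hab; simp
  · obtain ⟨i, hi⟩ := Function.ne_iff.1 hab
    rw [Finset.prod_eq_zero (Finset.mem_univ i) (by simp [hi])]
    simp

/-- The value of a polynomial at a vector and its conjugate. -/
def evalConj (y : ι → ℂ) : MvPolynomial (ι ⊕ ι) ℕ →ₐ[ℕ] ℂ :=
  MvPolynomial.aeval (Sum.elim y fun i => conj (y i))

lemma evalConj_eq_sum (F : MvPolynomial (ι ⊕ ι) ℕ) (y : ι → ℂ) :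
    evalConj y F = ∑ m ∈ F.support, ((MvPolynomial.coeff m F : ℕ) : ℂ) *
      ((∏ i, y i ^ m (Sum.inl i)) * ∏ i, conj (y i) ^ m (Sum.inr i)) := by
  rw [evalConj, MvPolynomial.aeval_def, MvPolynomial.eval₂_eq']
  simp [Fintype.prod_sum_type]

lemma integrable_evalConj (F : MvPolynomial (ι ⊕ ι) ℕ) :
    Integrable (fun y => evalConj y F) (gauss ι) := by
  simp_rw [evalConj_eq_sum]
  exact integrable_finsetSum _ fun m _ => (integrable_gauss_monomial _ _).const_mul _

lemma integral_evalConj (F : MvPolynomial (ι ⊕ ι) ℕ) :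
    ∫ y, evalConj y F ∂gauss ι = ∑ m ∈ F.support, ((MvPolynomial.coeff m F : ℕ) : ℂ) *
      ((if (fun i => m (Sum.inl i)) = (fun i => m (Sum.inr i)) then
        ∏ i, (m (Sum.inl i)).factorial else 0 : ℕ) : ℂ) := by
  simp_rw [evalConj_eq_sum]
  rw [integral_finsetSum _ fun m _ => (integrable_gauss_monomial _ _).const_mul _]
  refine Finset.sum_congr rfl fun m _ => ?_
  rw [integral_const_mul, integral_gauss_monomial]

/-- Only monomials with equal exponents of y and conj y survive, and their moments are products of
factorials. Coefficients in ℕ turn this into positivity without any separate hypothesis. -/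
lemma integral_evalConj_nonneg (F : MvPolynomial (ι ⊕ ι) ℕ) :
    0 ≤ ∫ y, evalConj y F ∂gauss ι := by
  rw [integral_evalConj]
  exact Finset.sum_nonneg fun m _ => by positivity

lemma prod_comp_pow [DecidableEq κ] (π : ι → κ) (z : κ → ℂ) (a : ι → ℕ) :
    ∏ i, z (π i) ^ a i = ∏ k, z k ^ ∑ i with π i = k, a i := by
  rw [← Finset.prod_fiberwise Finset.univ π]
  refine Finset.prod_congr rfl fun k _ => ?_
  rw [← Finset.prod_pow_eq_pow_sum]
  refine Finset.prod_congr rfl fun i hi => ?_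
  rw [(Finset.mem_filter.1 hi).2]

/-- Identifying variables increases the moments of polynomials with nonnegative coefficients. -/
lemma integral_evalConj_le_comp (π : ι → κ) (F : MvPolynomial (ι ⊕ ι) ℕ) :
    ∫ y, evalConj y F ∂gauss ι ≤ ∫ z, evalConj (fun i => z (π i)) F ∂gauss κ := by
  classical
  rw [integral_evalConj]
  simp_rw [evalConj_eq_sum, prod_comp_pow π _ _, prod_comp_pow π (fun k => conj (_ : ℂ))]
  have hint : ∀ m : ι ⊕ ι →₀ ℕ, Integrable (fun z : κ → ℂ =>
      ((MvPolynomial.coeff m F : ℕ) : ℂ) * ((∏ k, z k ^ ∑ i with π i = k, m (Sum.inl i)) *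
      ∏ k, conj (z k) ^ ∑ i with π i = k, m (Sum.inr i))) (gauss κ) :=
    fun m => (integrable_gauss_monomial _ _).const_mul _
  rw [integral_finsetSum _ fun m _ => hint m]
  refine Finset.sum_le_sum fun m _ => ?_
  rw [integral_const_mul, integral_gauss_monomial]
  refine mul_le_mul_of_nonneg_left ?_ (by positivity)
  rw [Nat.cast_le]
  -- A balanced monomial stays balanced after identification, and ∏ aᵢ! ≤ (∑ aᵢ)! on each fibre. An
  -- unbalanced one had moment zero and can only gain.
  by_cases hm : (fun i => m (Sum.inl i)) = (fun i => m (Sum.inr i))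
  · rw [if_pos hm, if_pos]
    · rw [← Finset.prod_fiberwise Finset.univ π]
      exact Finset.prod_le_prod' fun k _ =>
        Nat.le_of_dvd (Nat.factorial_pos _) (Nat.prod_factorial_dvd_factorial_sum _ _)
    · ext k
      exact Finset.sum_congr rfl fun i _ => congrFun hm i
  · rw [if_neg hm]; exact Nat.zero_le _

end Moments

/-! ### Gaussian matrices and words -/

variable {n N : ℕ}

/-- The tuple of matrices with given entries. -/
def matT (y : Fin n × Fin N × Fin N → ℂ) : Tuple n N := fun j => Matrix.of fun a b => y (j, a, b)

/-- The matrix with given entries. -/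
def mat1 (z : Fin N × Fin N → ℂ) : Mat N := Matrix.of fun a b => z (a, b)

@[simp] lemma matT_apply (y : Fin n × Fin N × Fin N → ℂ) (j : Fin n) (a b : Fin N) :
    matT y j a b = y (j, a, b) := rfl

@[simp] lemma mat1_apply (z : Fin N × Fin N → ℂ) (a b : Fin N) : mat1 z a b = z (a, b) := rfl

lemma continuous_matT : Continuous (matT : (Fin n × Fin N × Fin N → ℂ) → Tuple n N) :=
  continuous_pi fun j => continuous_matrix fun a b => continuous_apply (j, a, b)

lemma continuous_mat1 : Continuous (mat1 : (Fin N × Fin N → ℂ) → Mat N) :=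
  continuous_matrix fun a b => continuous_apply (a, b)

/-- The trace of the word `∏ i, Y (w i).1 * (Y (w i).2)ᴴ`. -/
def wordTrace {k : ℕ} (w : Fin k → Fin n × Fin n) (Y : Tuple n N) : ℂ :=
  (List.ofFn fun i => Y (w i).1 * (Y (w i).2)ᴴ).prod.trace

/-- The polynomial whose value is `wordTrace`. -/
def wordPoly {k : ℕ} (N : ℕ) (w : Fin k → Fin n × Fin n) :
    MvPolynomial ((Fin n × Fin N × Fin N) ⊕ (Fin n × Fin N × Fin N)) ℕ :=
  (List.ofFn fun i =>
    (Matrix.of fun a b : Fin N => MvPolynomial.X (Sum.inl ((w i).1, a, b))) *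
    (Matrix.of fun a b : Fin N => MvPolynomial.X (Sum.inr ((w i).2, b, a)))).prod.trace

lemma evalConj_wordPoly {k : ℕ} (w : Fin k → Fin n × Fin n) (y : Fin n × Fin N × Fin N → ℂ) :
    evalConj y (wordPoly N w) = wordTrace w (matT y) := by
  rw [wordPoly, wordTrace, AddMonoidHom.map_trace (evalConj y)]
  have h := map_list_prod ((evalConj y : _ →ₐ[ℕ] ℂ) : _ →+* ℂ).mapMatrix (List.ofFn fun i =>
    (Matrix.of fun a b : Fin N => MvPolynomial.X (R := ℕ) (Sum.inl ((w i).1, a, b))) *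
    (Matrix.of fun a b : Fin N => MvPolynomial.X (Sum.inr ((w i).2, b, a))))
  rw [RingHom.mapMatrix_apply] at h
  refine congrArg Matrix.trace (h.trans ?_)
  rw [List.map_ofFn]
  congr 2
  ext i a b
  simp only [Function.comp_apply, map_mul, RingHom.mapMatrix_apply, Matrix.mul_apply,
    Matrix.map_apply, Matrix.of_apply, Matrix.conjTranspose_apply, matT_apply]
  simp [evalConj]

lemma integrable_wordTrace {k : ℕ} (w : Fin k → Fin n × Fin n) :
    Integrable (fun y => wordTrace w (matT y : Tuple n N)) (gauss _) := by
  simp_rw [← evalConj_wordPoly]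
  exact integrable_evalConj _

lemma wordTrace_const {k : ℕ} (w : Fin k → Fin n × Fin n) (Z : Mat N) :
    wordTrace w (fun _ => Z) = ((Z * Zᴴ) ^ k).trace := by
  simp [wordTrace]

lemma integral_wordTrace_nonneg {k : ℕ} (w : Fin k → Fin n × Fin n) :
    0 ≤ ∫ y, wordTrace w (matT y : Tuple n N) ∂gauss _ := by
  simp_rw [← evalConj_wordPoly]
  exact integral_evalConj_nonneg _

/-- Forgetting the index j identifies all n matrices with a single one, which can only increase the
moment. -/
lemma integral_wordTrace_le {k : ℕ} (w : Fin k → Fin n × Fin n) :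
    ∫ y, wordTrace w (matT y : Tuple n N) ∂gauss _
      ≤ ∫ z, ((mat1 z * (mat1 z)ᴴ) ^ k : Mat N).trace ∂gauss _ := by
  simp_rw [← evalConj_wordPoly]
  refine (integral_evalConj_le_comp (fun p : Fin n × Fin N × Fin N => p.2) _).trans (le_of_eq ?_)
  refine integral_congr_ae (Filter.Eventually.of_forall fun z => ?_)
  simp only [evalConj_wordPoly]
  exact wordTrace_const w (mat1 z)

lemma sum_pow_eq_sum_words {R α : Type*} [Ring R] [Fintype α] (M : α → R) (k : ℕ) :
    (∑ p, M p) ^ k = ∑ w : Fin k → α, (List.ofFn fun i => M (w i)).prod := by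
  classical
  have h := (MultilinearMap.mkPiAlgebraFin ℤ k R).map_sum (fun _ p => M p)
  simpa using h

lemma trace_sum_mul_pow (Y : Tuple n N) (k : ℕ) :
    (((∑ j, Y j) * (∑ j, Y j)ᴴ) ^ k).trace = ∑ w : Fin k → Fin n × Fin n, wordTrace w Y := by
  rw [Matrix.conjTranspose_sum, Finset.sum_mul_sum, ← Finset.sum_product', Finset.univ_product_univ,
    sum_pow_eq_sum_words, Matrix.trace_sum]
  rfl

lemma list_prod_kronecker (l : List (Mat N × Mat N)) :
    (l.map fun p => p.1 ⊗ₖ p.2.map star).prod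
      = (l.map Prod.fst).prod ⊗ₖ ((l.map Prod.snd).prod).map star := by
  induction l with
  | nil => simp
  | cons p l ih =>
    have h : ((p.2 * (l.map Prod.snd).prod).map star : Mat N)
        = p.2.map star * ((l.map Prod.snd).prod).map star :=
      Matrix.map_mul (f := starRingEnd ℂ)
    simp only [List.map_cons, List.prod_cons, ih, h, Matrix.mul_kronecker_mul]

lemma kronecker_mul_conjTranspose (A B C D : Mat N) :
    (A ⊗ₖ B.map star) * (C ⊗ₖ D.map star)ᴴ = (A * Cᴴ) ⊗ₖ (B * Dᴴ).map star := by
  rw [Matrix.conjTranspose_kronecker, ← Matrix.mul_kronecker_mul]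
  congr 1
  have h : ((B * Dᴴ).map star : Mat N) = B.map star * (Dᴴ).map star :=
    Matrix.map_mul (f := starRingEnd ℂ)
  rw [h]
  rfl

lemma trace_map_star (A : Mat N) : (A.map star).trace = star A.trace := by
  simp [Matrix.trace]

/-- The trace of a Kronecker product is the product of the traces, so each word contributes
separately in Y and in Z. For independent tuples the expectation then factors. -/
lemma trace_tensor_pow (Y Z : Tuple n N) (k : ℕ) :
    (((∑ j, Y j ⊗ₖ (Z j).map star) * (∑ j, Y j ⊗ₖ (Z j).map star)ᴴ) ^ k).trace
      = ∑ w : Fin k → Fin n × Fin n, wordTrace w Y * star (wordTrace w Z) := by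
  rw [Matrix.conjTranspose_sum, Finset.sum_mul_sum, ← Finset.sum_product', Finset.univ_product_univ,
    sum_pow_eq_sum_words, Matrix.trace_sum]
  refine Finset.sum_congr rfl fun w _ => ?_
  simp_rw [kronecker_mul_conjTranspose]
  have h := list_prod_kronecker (List.ofFn fun i =>
    (Y (w i).1 * (Y (w i).2)ᴴ, Z (w i).1 * (Z (w i).2)ᴴ))
  simp only [List.map_ofFn] at h
  refine (congrArg Matrix.trace h).trans ?_
  rw [Matrix.trace_kronecker, trace_map_star]
  rfl

/-! ### Laws of functions of Gaussian matrices -/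

lemma measurePreserving_sum (hn : 0 < n) :
    MeasurePreserving (fun (y : Fin n × Fin N × Fin N → ℂ) (p : Fin N × Fin N) =>
      ((Real.sqrt n)⁻¹ : ℂ) * ∑ j, y (j, p)) (gauss _) (gauss _) := by
  have hs : (Real.sqrt n) ^ 2 = (n : ℝ) := Real.sq_sqrt (by positivity)
  have hn' : (n : ℝ) ≠ 0 := by positivity
  refine measurePreserving_gauss (fun t q => ((Real.sqrt n)⁻¹ : ℂ) * t q.2) (by fun_prop) ?_ ?_
  · intro t y
    refine Eq.trans ?_ (Fintype.sum_prod_type_right _).symm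
    refine Finset.sum_congr rfl fun p _ => ?_
    rw [Finset.mul_sum, inner_sum]
    refine Finset.sum_congr rfl fun j _ => ?_
    simp only [Complex.inner, map_mul]
    rw [← Complex.ofReal_inv, Complex.conj_ofReal]
    congr 1
    ring
  · intro t
    rw [Fintype.sum_prod_type]
    simp only [norm_mul, mul_pow]
    simp only [← Finset.mul_sum, Finset.sum_const, Finset.card_univ, Fintype.card_fin]
    rw [nsmul_eq_mul, ← Complex.ofReal_inv, Complex.norm_real, Real.norm_eq_abs, sq_abs, inv_pow,
      hs, ← mul_assoc, inv_mul_cancel₀ hn', one_mul]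

/-- Stability of the Gaussian law: ∑ Y_j is distributed as √n Z. Together with the expansion into
words, this evaluates the sum of all word moments exactly. -/
lemma integral_trace_sum_mul_pow (hn : 0 < n) (k : ℕ) :
    ∫ y, (((∑ j, (matT y : Tuple n N) j) * (∑ j, (matT y : Tuple n N) j)ᴴ) ^ k).trace ∂gauss _
      = (n : ℂ) ^ k * ∫ z, ((mat1 z * (mat1 z)ᴴ) ^ k : Mat N).trace ∂gauss _ := by
  have hs : (Real.sqrt n) * (Real.sqrt n) = (n : ℝ) := Real.mul_self_sqrt (by positivity)
  have hs0 : (Real.sqrt n : ℂ) ≠ 0 := by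
    rw [Complex.ofReal_ne_zero]; positivity
  have hc : Continuous fun z : Fin N × Fin N → ℂ => ((mat1 z * (mat1 z)ᴴ) ^ k : Mat N).trace :=
    ((continuous_mat1.matrix_mul continuous_mat1.matrix_conjTranspose).pow k).matrix_trace
  rw [← integral_gauss_comp (measurePreserving_sum hn) hc.aestronglyMeasurable,
    ← integral_const_mul]
  refine integral_congr_ae (Filter.Eventually.of_forall fun y => ?_)
  have e : ∑ j, (matT y : Tuple n N) j = (Real.sqrt n : ℂ) •
      mat1 (fun p => ((Real.sqrt n)⁻¹ : ℂ) * ∑ j, y (j, p)) := by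
    ext a b
    simp only [Matrix.sum_apply, matT_apply, Matrix.smul_apply, mat1_apply, smul_eq_mul]
    rw [← mul_assoc, mul_inv_cancel₀ hs0, one_mul]
  simp only [e, Matrix.conjTranspose_smul, Matrix.smul_mul, Matrix.mul_smul, smul_smul]
  have e2 : star (Real.sqrt n : ℂ) * (Real.sqrt n : ℂ) = n := by
    rw [Complex.star_def, Complex.conj_ofReal, ← Complex.ofReal_mul, hs]; simp
  rw [e2, smul_pow, Matrix.trace_smul, smul_eq_mul]

/-- The moment `E tr (Z Z*)^k` of a Gaussian matrix. -/
def gaussMoment (N k : ℕ) : ℝ :=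
  ∫ z, ((mat1 z * (mat1 z)ᴴ) ^ k : Mat N).trace.re ∂gauss (Fin N × Fin N)

lemma integrable_trace_pow (k : ℕ) :
    Integrable (fun z => ((mat1 z * (mat1 z)ᴴ) ^ k : Mat N).trace) (gauss _) := by
  have h := integrable_wordTrace (n := 1) (N := N) (fun _ : Fin k => (0, 0))
  have hm : MeasurePreserving (fun (z : Fin N × Fin N → ℂ) (q : Fin 1 × Fin N × Fin N) => z q.2)
      (gauss _) (gauss _) := by
    refine measurePreserving_gauss (fun t p => t (0, p)) (by fun_prop) ?_ ?_
    · intro t y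
      rw [Fintype.sum_prod_type, Fin.sum_univ_one]
    · intro t
      rw [eq_comm, Fintype.sum_prod_type, Fin.sum_univ_one]
  rw [← hm.map_eq] at h
  refine (h.comp_measurable hm.measurable).congr (Filter.Eventually.of_forall fun z => ?_)
  exact wordTrace_const (fun _ : Fin k => ((0 : Fin 1), (0 : Fin 1))) (mat1 z)

lemma integral_trace_pow_eq (k : ℕ) :
    ∫ z, ((mat1 z * (mat1 z)ᴴ) ^ k : Mat N).trace ∂gauss _ = (gaussMoment N k : ℂ) := by
  have h0 : 0 ≤ ∫ z, ((mat1 z * (mat1 z)ᴴ) ^ k : Mat N).trace ∂gauss _ :=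
    (integral_wordTrace_nonneg (n := 1) (fun _ => (0, 0))).trans (integral_wordTrace_le _)
  have h1 := Complex.eq_re_of_ofReal_le (r := 0) (by simpa using h0)
  rw [h1]
  congr 1
  exact (integral_re (integrable_trace_pow k)).symm

lemma gaussMoment_nonneg (N k : ℕ) : 0 ≤ gaussMoment N k := by
  have h := (integral_wordTrace_nonneg (n := 1) (N := N) (fun _ : Fin k => (0, 0))).trans
    (integral_wordTrace_le _)
  rw [integral_trace_pow_eq] at h
  exact_mod_cast h

/-- The moments of `∑ Y j ⊗ conj (Y' j)` for independent Gaussian tuples. -/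
lemma integral_trace_tensor_pow_le (hn : 0 < n) (k : ℕ) :
    Integrable (fun p : (Fin n × Fin N × Fin N → ℂ) × (Fin n × Fin N × Fin N → ℂ) =>
      (((∑ j, matT p.1 j ⊗ₖ (matT p.2 j).map star) *
        (∑ j, matT p.1 j ⊗ₖ (matT p.2 j).map star)ᴴ) ^ k).trace.re)
        ((gauss _).prod (gauss _)) ∧
    ∫ p : (Fin n × Fin N × Fin N → ℂ) × (Fin n × Fin N × Fin N → ℂ),
      (((∑ j, matT p.1 j ⊗ₖ (matT p.2 j).map star) *
        (∑ j, matT p.1 j ⊗ₖ (matT p.2 j).map star)ᴴ) ^ k).trace.re ∂((gauss _).prod (gauss _))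
      ≤ n ^ k * gaussMoment N k ^ 2 := by
  simp_rw [trace_tensor_pow]
  have hi : ∀ w : Fin k → Fin n × Fin n, Integrable
      (fun p : (Fin n × Fin N × Fin N → ℂ) × (Fin n × Fin N × Fin N → ℂ) =>
        wordTrace w (matT p.1) * star (wordTrace w (matT p.2)))
        ((gauss _).prod (gauss _)) := fun w =>
    (integrable_wordTrace w).mul_prod
      ((Complex.conjCLE : ℂ →L[ℝ] ℂ).integrable_comp (integrable_wordTrace w))
  have hI := integrable_finsetSum Finset.univ fun w _ => hi w
  refine ⟨hI.re, ?_⟩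
  have e1 := integral_re hI
  refine e1.le.trans ?_
  rw [integral_finsetSum _ fun w _ => hi w]
  -- Of the two equal factors E tr w(Y), one is bounded by the moment of a single matrix; the other
  -- is kept, since its sum over words is known exactly.
  have e2 : ∀ w : Fin k → Fin n × Fin n,
      ∫ p : (Fin n × Fin N × Fin N → ℂ) × (Fin n × Fin N × Fin N → ℂ),
        wordTrace w (matT p.1) * star (wordTrace w (matT p.2)) ∂((gauss _).prod (gauss _))
      ≤ (∫ y, wordTrace w (matT y : Tuple n N) ∂gauss _) * gaussMoment N k := by
    intro w
    rw [integral_prod_mul (fun y => wordTrace w (matT y))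
      (fun y => star (wordTrace w (matT y)))]
    refine mul_le_mul_of_nonneg_left ?_ (integral_wordTrace_nonneg w)
    have e3 : ∫ y, star (wordTrace w (matT y : Tuple n N)) ∂gauss _
        = ∫ y, wordTrace w (matT y : Tuple n N) ∂gauss _ := by
      have : ∫ y, star (wordTrace w (matT y : Tuple n N)) ∂gauss _
        = conj (∫ y, wordTrace w (matT y : Tuple n N) ∂gauss _) := integral_conj
      rw [this]
      exact Complex.conj_eq_iff_im.2 (Complex.nonneg_iff.1 (integral_wordTrace_nonneg w)).2.symm
    rw [e3, ← integral_trace_pow_eq]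
    exact integral_wordTrace_le w
  have e4 : ∑ w : Fin k → Fin n × Fin n, ∫ y, wordTrace w (matT y : Tuple n N) ∂gauss _
      = (n : ℂ) ^ k * gaussMoment N k := by
    rw [← integral_finsetSum _ fun w _ => integrable_wordTrace w]
    simp_rw [← trace_sum_mul_pow]
    rw [integral_trace_sum_mul_pow hn, integral_trace_pow_eq]
  have e5 := Finset.sum_le_sum (s := Finset.univ) fun w _ => e2 w
  rw [← Finset.sum_mul, e4] at e5
  have e6 := (Complex.le_def.1 e5).1
  refine e6.trans (le_of_eq ?_)
  rw [show (n : ℂ) ^ k * (gaussMoment N k : ℂ) * (gaussMoment N k : ℂ)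
    = ((n ^ k * gaussMoment N k ^ 2 : ℝ) : ℂ) by push_cast; ring, Complex.ofReal_re]

end QExp
end

/-! ### From moments to norms: Gaussian matrices and decoupled Gaussian tensors. -/

noncomputable section

namespace QExp

open MeasureTheory Complex ComplexConjugate Module
open scoped Matrix.Norms.L2Operator

variable {n N : ℕ}

/-! ### The operator norm of a Gaussian matrix -/

lemma norm_entry_le {m : Type*} [Fintype m] [DecidableEq m] (M : Matrix m m ℂ) (a b : m) :
    ‖M a b‖ ≤ ‖M‖ := by
  have h := Matrix.l2_opNorm_mulVec M (EuclideanSpace.single b 1)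
  have h2 : M a b = (WithLp.toLp 2 (M *ᵥ (EuclideanSpace.single b (1 : ℂ)).ofLp)) a := by simp
  rw [h2]
  refine (PiLp.norm_apply_le _ a).trans (h.trans (by simp))

lemma norm_trace_le_card_mul {m : Type*} [Fintype m] [DecidableEq m] (M : Matrix m m ℂ) :
    ‖M.trace‖ ≤ Fintype.card m * ‖M‖ := by
  refine (norm_sum_le _ _).trans ?_
  refine (Finset.sum_le_sum fun a _ => norm_entry_le M a a).trans ?_
  simp

lemma norm_sq_le_trace {m : Type*} [Fintype m] [DecidableEq m] (M : Matrix m m ℂ) :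
    ‖M‖ ^ 2 ≤ (M * Mᴴ).trace.re := by
  have h0 : (M * Mᴴ).trace.re = ∑ a, ∑ b, ‖M a b‖ ^ 2 := by
    simp only [Matrix.trace, Matrix.diag, Matrix.mul_apply, Matrix.conjTranspose_apply,
      Complex.re_sum]
    refine Finset.sum_congr rfl fun a _ => Finset.sum_congr rfl fun b _ => ?_
    rw [Complex.star_def, Complex.mul_conj, Complex.normSq_eq_norm_sq, Complex.ofReal_re]
  have hnn : 0 ≤ ∑ a, ∑ b, ‖M a b‖ ^ 2 :=
    Finset.sum_nonneg fun a _ => Finset.sum_nonneg fun b _ => by positivity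
  have h1 : ‖M‖ ≤ Real.sqrt (∑ a, ∑ b, ‖M a b‖ ^ 2) := by
    rw [Matrix.cstar_norm_def]
    refine ContinuousLinearMap.opNorm_le_bound _ (Real.sqrt_nonneg _) fun x => ?_
    rw [← Real.sqrt_sq (norm_nonneg x), ← Real.sqrt_mul hnn]
    apply Real.le_sqrt_of_sq_le
    rw [EuclideanSpace.norm_sq_eq, Finset.sum_mul]
    refine Finset.sum_le_sum fun a _ => ?_
    rw [Matrix.ofLp_toEuclideanCLM, EuclideanSpace.norm_sq_eq]
    calc ‖(M *ᵥ x.ofLp) a‖ ^ 2 ≤ (∑ b, ‖M a b‖ * ‖x b‖) ^ 2 := by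
          gcongr
          refine (norm_sum_le _ _).trans (le_of_eq ?_)
          simp
      _ ≤ _ := Finset.sum_mul_sq_le_sq_mul_sq _ _ _
  rw [h0, ← Real.sq_sqrt hnn]
  gcongr

/-- The C*-identity gives ‖(S S*)^(2^r)‖ = ‖S‖^(2·2^r), and the squared operator norm is at most the
squared Hilbert–Schmidt norm, which doubles the exponent. Restricting to powers of two avoids
diagonalization. -/
lemma norm_pow_le_trace {m : Type*} [Fintype m] [DecidableEq m] (S : Matrix m m ℂ) (r : ℕ) :
    ‖S‖ ^ (2 * 2 ^ (r + 1)) ≤ ((S * Sᴴ) ^ 2 ^ (r + 1)).trace.re := by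
  have hsa : IsSelfAdjoint (S * Sᴴ) := Matrix.isHermitian_mul_conjTranspose_self S
  have h1 : ‖(S * Sᴴ) ^ 2 ^ r‖ = ‖S * Sᴴ‖ ^ 2 ^ r := hsa.norm_pow_two_pow r
  have h2 : ‖S * Sᴴ‖ = ‖S‖ ^ 2 := by
    rw [sq]; exact CStarRing.norm_self_mul_star
  have h3 := norm_sq_le_trace ((S * Sᴴ) ^ 2 ^ r)
  have h4 : ((S * Sᴴ) ^ 2 ^ r)ᴴ = (S * Sᴴ) ^ 2 ^ r := hsa.pow _
  rw [h4, ← pow_add, h1, h2, ← pow_mul, ← pow_mul] at h3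
  convert h3 using 2
  · ring
  · rw [pow_succ, mul_two]

lemma measurePreserving_mulVec (x : EuclideanSpace ℂ (Fin N)) (hx : ‖x‖ = 1) :
    MeasurePreserving (fun z : Fin N × Fin N → ℂ => mat1 z *ᵥ x.ofLp) (gauss _) (gauss _) := by
  refine measurePreserving_gauss (fun t p => t p.1 * conj (x p.2)) ?_ ?_ ?_
  · exact (continuous_mat1.matrix_mulVec continuous_const).measurable
  · intro t z
    rw [Fintype.sum_prod_type]
    refine Finset.sum_congr rfl fun a _ => ?_
    rw [Matrix.mulVec, dotProduct, inner_sum]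
    refine Finset.sum_congr rfl fun b _ => ?_
    simp only [Complex.inner, map_mul, mat1_apply, Complex.conj_conj]
    congr 1
    ring
  · intro t
    have h : ∑ b, ‖x b‖ ^ 2 = 1 := by rw [← EuclideanSpace.norm_sq_eq, hx, one_pow]
    rw [Fintype.sum_prod_type]
    refine Finset.sum_congr rfl fun a _ => ?_
    simp only [norm_mul, mul_pow, RCLike.norm_conj]
    rw [← Finset.mul_sum, h, mul_one]

lemma integrable_gauss_exp_half_sq {ι : Type*} [Fintype ι] :
    Integrable (fun y : ι → ℂ => Real.exp ((∑ i, ‖y i‖ ^ 2) / 2)) (gauss ι) := by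
  have := Integrable.fintype_prod (μ := fun _ : ι => gaussC)
    (f := fun _ z => Real.exp (1 / 2 * ‖z‖ ^ 2))
    fun i => integrable_gaussC_exp_mul_sq (b := 1 / 2) (by norm_num)
  refine this.congr (Filter.Eventually.of_forall fun y => ?_)
  simp only
  rw [← Real.exp_sum, ← Finset.mul_sum]
  ring_nf

lemma integral_gauss_exp_half_sq {ι : Type*} [Fintype ι] :
    ∫ y, Real.exp ((∑ i, ‖y i‖ ^ 2) / 2) ∂gauss ι = 2 ^ Fintype.card ι := by
  have h := integral_fintype_prod_eq_prod (𝕜 := ℝ) (μ := fun _ : ι => gaussC)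
    (fun _ z => Real.exp (‖z‖ ^ 2 / 2))
  simp only [integral_gaussC_exp_half_sq, ← Real.exp_sum, ← Finset.sum_div] at h
  rw [gauss, h]
  simp

/-- On a 1/2-net of the unit sphere the supremum of ‖Zx‖ is at least half the norm. The count is (1
+ 4)^(2N), the real dimension being 2N. -/
lemma exists_sphere_net (hN : 1 ≤ N) : ∃ t : Finset (EuclideanSpace ℂ (Fin N)),
    (∀ x ∈ t, ‖x‖ = 1) ∧ (t.card : ℝ) ≤ 25 ^ N ∧
    ∀ Z : Mat N, ∃ x ∈ t, ‖Z‖ ≤ 2 * ‖Matrix.toEuclideanCLM (𝕜 := ℂ) Z x‖ := by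
  obtain ⟨t, h1, h2, h3⟩ := exists_net (E := EuclideanSpace ℂ (Fin N)) {x | ‖x‖ = 1}
    (R := 1) (θ := 1 / 2) zero_le_one (by norm_num) (fun x hx => le_of_eq hx)
  have hfr : finrank ℝ (EuclideanSpace ℂ (Fin N)) = 2 * N := by
    rw [← finrank_mul_finrank ℝ ℂ (EuclideanSpace ℂ (Fin N)),
      Complex.finrank_real_complex, finrank_euclideanSpace]
    simp
  refine ⟨t, fun x hx => h1 hx, ?_, fun Z => ?_⟩
  · rw [hfr, pow_mul] at h2
    norm_num at h2
    exact h2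
  · have hne : t.Nonempty := by
      obtain ⟨y, hy, -⟩ := h3 (EuclideanSpace.single ⟨0, hN⟩ 1) (by simp)
      exact ⟨y, hy⟩
    set f := Matrix.toEuclideanCLM (n := Fin N) (𝕜 := ℂ) Z with hf
    obtain ⟨x, hx, hmax⟩ := t.exists_max_image (fun x => ‖f x‖) hne
    refine ⟨x, hx, ?_⟩
    have hb : ‖f‖ ≤ ‖f x‖ + ‖f‖ / 2 := by
      refine ContinuousLinearMap.opNorm_le_of_unit_norm (by positivity) fun v hv => ?_
      obtain ⟨y, hy, hvy⟩ := h3 v hv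
      calc ‖f v‖ = ‖f y + f (v - y)‖ := by rw [← map_add]; simp
        _ ≤ ‖f y‖ + ‖f (v - y)‖ := norm_add_le _ _
        _ ≤ ‖f x‖ + ‖f‖ * (1 / 2) := by
          gcongr
          · exact hmax y hy
          · exact (f.le_opNorm _).trans (by gcongr)
        _ = _ := by ring
    have : ‖Z‖ = ‖f‖ := rfl
    rw [this]
    linarith

/-- For a unit vector x, Zx is a standard Gaussian vector, so E exp(‖Zx‖²/2) = 2^N. Passing to the
net loses a factor 4 in ‖Z‖², hence the 8, and the union over 25^N points gives 50^N. -/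
lemma integral_exp_norm_sq_le (hN : 1 ≤ N) :
    Integrable (fun z => Real.exp (‖(mat1 z : Mat N)‖ ^ 2 / 8)) (gauss _) ∧
    ∫ z, Real.exp (‖(mat1 z : Mat N)‖ ^ 2 / 8) ∂gauss _ ≤ 50 ^ N := by
  obtain ⟨t, h1, h2, h3⟩ := exists_sphere_net hN
  have hle : ∀ z : Fin N × Fin N → ℂ, Real.exp (‖(mat1 z : Mat N)‖ ^ 2 / 8)
      ≤ ∑ x ∈ t, Real.exp ((∑ i, ‖(mat1 z *ᵥ x.ofLp) i‖ ^ 2) / 2) := by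
    intro z
    obtain ⟨x, hx, hxn⟩ := h3 (mat1 z)
    refine le_trans ?_ (Finset.single_le_sum (fun x _ => (Real.exp_pos _).le) hx)
    rw [Real.exp_le_exp]
    have e : ∑ i, ‖(mat1 z *ᵥ x.ofLp) i‖ ^ 2 = ‖Matrix.toEuclideanCLM (𝕜 := ℂ) (mat1 z) x‖ ^ 2 := by
      rw [EuclideanSpace.norm_sq_eq]; simp [Matrix.ofLp_toEuclideanCLM]
    rw [e]
    have := pow_le_pow_left₀ (norm_nonneg _) hxn 2
    rw [mul_pow] at this
    linarith
  have hint : ∀ x ∈ t, Integrable (fun z : Fin N × Fin N → ℂ =>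
      Real.exp ((∑ i, ‖(mat1 z *ᵥ x.ofLp) i‖ ^ 2) / 2)) (gauss _) := fun x hx =>
    (measurePreserving_mulVec x (h1 x hx)).integrable_comp_of_integrable integrable_gauss_exp_half_sq
  have hI := integrable_finsetSum t hint
  have hc : Continuous fun z => Real.exp (‖(mat1 z : Mat N)‖ ^ 2 / 8) :=
    Real.continuous_exp.comp (((continuous_mat1.norm).pow 2).div_const 8)
  have hI2 : Integrable (fun z => Real.exp (‖(mat1 z : Mat N)‖ ^ 2 / 8)) (gauss _) :=
    hI.mono' hc.aestronglyMeasurable (Filter.Eventually.of_forall fun z => by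
      rw [Real.norm_of_nonneg (Real.exp_pos _).le]; exact hle z)
  refine ⟨hI2, (integral_mono hI2 hI hle).trans ?_⟩
  rw [integral_finsetSum _ hint]
  have e : ∀ x ∈ t, ∫ z : Fin N × Fin N → ℂ,
      Real.exp ((∑ i, ‖(mat1 z *ᵥ x.ofLp) i‖ ^ 2) / 2) ∂gauss _ = 2 ^ N := by
    intro x hx
    rw [integral_gauss_comp (measurePreserving_mulVec x (h1 x hx))
      (f := fun y => Real.exp ((∑ i, ‖y i‖ ^ 2) / 2))
      integrable_gauss_exp_half_sq.aestronglyMeasurable, integral_gauss_exp_half_sq]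
    simp
  rw [Finset.sum_congr rfl e, Finset.sum_const, nsmul_eq_mul]
  calc (t.card : ℝ) * 2 ^ N ≤ 25 ^ N * 2 ^ N := by gcongr
    _ = 50 ^ N := by rw [← mul_pow]; norm_num

/-- Bound the trace by N‖Z‖^(2k) and the power by 8^k k! exp(‖Z‖²/8). With k comparable to N, the
factors N ≤ 2^k, k! ≤ (2N)^k and 50^N ≤ 50^k all take the form (constant or 2N)^k, and 2·8·2·50 =
1600. -/
lemma gaussMoment_le {k : ℕ} (hN : 1 ≤ N) (hk : N ≤ k) (hk2 : k ≤ 2 * N) :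
    gaussMoment N k ≤ (1600 * N) ^ k := by
  obtain ⟨hI, hle⟩ := integral_exp_norm_sq_le hN
  have hpt : ∀ z : Fin N × Fin N → ℂ, ((mat1 z * (mat1 z)ᴴ) ^ k : Mat N).trace.re
      ≤ N * (8 ^ k * k.factorial) * Real.exp (‖(mat1 z : Mat N)‖ ^ 2 / 8) := by
    intro z
    have h1 : ‖(mat1 z * (mat1 z)ᴴ : Mat N) ^ k‖ ≤ (‖(mat1 z : Mat N)‖ ^ 2) ^ k := by
      refine (norm_pow_le' _ (by omega)).trans ?_
      gcongr
      refine (norm_mul_le _ _).trans ?_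
      rw [Matrix.l2_opNorm_conjTranspose, sq]
    have h2 := Real.pow_div_factorial_le_exp (‖(mat1 z : Mat N)‖ ^ 2 / 8) (by positivity) k
    rw [div_pow, div_div, div_le_iff₀ (by positivity)] at h2
    calc ((mat1 z * (mat1 z)ᴴ) ^ k : Mat N).trace.re
        ≤ ‖((mat1 z * (mat1 z)ᴴ) ^ k : Mat N).trace‖ := Complex.re_le_norm _
      _ ≤ N * ‖(mat1 z * (mat1 z)ᴴ : Mat N) ^ k‖ := by
          simpa using norm_trace_le_card_mul ((mat1 z * (mat1 z)ᴴ : Mat N) ^ k)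
      _ ≤ N * (Real.exp (‖(mat1 z : Mat N)‖ ^ 2 / 8) * (8 ^ k * k.factorial)) := by
          gcongr
          exact h1.trans h2
      _ = _ := by ring
  have h := integral_mono (integrable_trace_pow (N := N) k).re (hI.const_mul _) hpt
  rw [integral_const_mul] at h
  have hN2 : (N : ℝ) ≤ 2 ^ k := by
    calc (N : ℝ) ≤ k := by exact_mod_cast hk
      _ ≤ 2 ^ k := by exact_mod_cast (Nat.lt_two_pow_self).le
  have hf : (k.factorial : ℝ) ≤ (2 * N) ^ k := by
    calc (k.factorial : ℝ) ≤ (k : ℝ) ^ k := by exact_mod_cast Nat.factorial_le_pow k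
      _ ≤ _ := by gcongr; exact_mod_cast hk2
  calc gaussMoment N k ≤ N * (8 ^ k * k.factorial) * _ := h
    _ ≤ 2 ^ k * (8 ^ k * (2 * N) ^ k) * 50 ^ k := by
      gcongr
      refine hle.trans ?_
      exact pow_le_pow_right₀ (by norm_num) hk
    _ = (1600 * N) ^ k := by
      rw [← mul_pow, ← mul_pow, ← mul_pow]; ring

/-- The expected norm of `∑ Y j ⊗ conj (Y' j)` for independent Gaussian tuples. -/
lemma integral_tensorNorm_le (hn : 0 < n) (hN : 1 ≤ N) :
    Integrable (fun p : (Fin n × Fin N × Fin N → ℂ) × (Fin n × Fin N × Fin N → ℂ) =>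
      tensorNorm (matT p.1) (matT p.2)) ((gauss _).prod (gauss _)) ∧
    ∫ p : (Fin n × Fin N × Fin N → ℂ) × (Fin n × Fin N × Fin N → ℂ),
      tensorNorm (matT p.1) (matT p.2) ∂((gauss _).prod (gauss _)) ≤ 3200 * N * Real.sqrt n := by
  set r := Nat.log 2 N with hr
  set k := 2 ^ (r + 1) with hkdef
  have hk1 : N ≤ k := (Nat.lt_pow_succ_log_self (by norm_num) N).le
  have hk2 : k ≤ 2 * N := by
    have := Nat.pow_log_le_self 2 (x := N) (by omega)
    rw [hkdef, pow_succ, mul_comm]; exact Nat.mul_le_mul_left 2 this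
  set a : ℝ := Real.sqrt n * (1600 * N) with ha
  have hN0 : (0 : ℝ) < N := by exact_mod_cast hN
  have hn0 : (0 : ℝ) < n := by exact_mod_cast hn
  have ha0 : 0 < a := by positivity
  obtain ⟨hI, hle⟩ := integral_trace_tensor_pow_le (N := N) hn k
  have hpt : ∀ p : (Fin n × Fin N × Fin N → ℂ) × (Fin n × Fin N × Fin N → ℂ),
      tensorNorm (matT p.1) (matT p.2) ≤ a + a * (a ^ (2 * k))⁻¹ *
      (((∑ j, matT p.1 j ⊗ₖ (matT p.2 j).map star) *
        (∑ j, matT p.1 j ⊗ₖ (matT p.2 j).map star)ᴴ) ^ k).trace.re := by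
    intro p
    have h1 := norm_pow_le_trace (∑ j, matT p.1 j ⊗ₖ (matT p.2 j).map star) r
    have h2 : ‖∑ j, matT p.1 j ⊗ₖ (matT p.2 j).map star‖ = tensorNorm (matT p.1) (matT p.2) := rfl
    rw [h2, ← hkdef] at h1
    set X := tensorNorm (matT p.1) (matT p.2)
    have hX : 0 ≤ X := tensorNorm_nonneg _ _
    -- This linearization replaces the extraction of a 2k-th root: since E X^(2k) ≤ a^(2k), the
    -- second term has expectation at most a, so E X ≤ 2a.
    have h3 : X ≤ a + a * (a ^ (2 * k))⁻¹ * X ^ (2 * k) := by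
      rcases le_total X a with h | h
      · have : 0 ≤ a * (a ^ (2 * k))⁻¹ * X ^ (2 * k) := by positivity
        linarith
      · have h4 : X / a ≤ (X / a) ^ (2 * k) :=
          le_self_pow₀ ((one_le_div ha0).2 h) (by positivity)
        rw [div_pow, div_le_iff₀ ha0] at h4
        calc X ≤ _ := h4
          _ = a * (a ^ (2 * k))⁻¹ * X ^ (2 * k) := by field_simp
          _ ≤ _ := by linarith
    refine h3.trans ?_
    gcongr
  have hI2 := (integrable_const a).add (hI.const_mul (a * (a ^ (2 * k))⁻¹))
  have hcT : Continuous fun p : (Fin n × Fin N × Fin N → ℂ) × (Fin n × Fin N × Fin N → ℂ) =>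
      tensorNorm (matT p.1) (matT p.2) := by
    have : Continuous fun p : (Fin n × Fin N × Fin N → ℂ) × (Fin n × Fin N × Fin N → ℂ) =>
      ∑ j, matT p.1 j ⊗ₖ (matT p.2 j).map star := by
      refine continuous_finsetSum _ fun j _ => continuous_matrix fun a b => ?_
      simp only [Matrix.kroneckerMap_apply, matT_apply, Matrix.map_apply]
      fun_prop
    exact this.norm
  have hI3 : Integrable (fun p : (Fin n × Fin N × Fin N → ℂ) × (Fin n × Fin N × Fin N → ℂ) =>
      tensorNorm (matT p.1) (matT p.2)) ((gauss _).prod (gauss _)) :=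
    hI2.mono' hcT.aestronglyMeasurable (Filter.Eventually.of_forall fun p => by
      rw [Real.norm_of_nonneg (tensorNorm_nonneg _ _)]; exact hpt p)
  refine ⟨hI3, (integral_mono hI3 hI2 hpt).trans ?_⟩
  rw [integral_add' (integrable_const a) (hI.const_mul _), integral_const, probReal_univ, one_smul,
    integral_const_mul]
  have hgm0 : 0 ≤ gaussMoment N k := gaussMoment_nonneg N k
  have hfin : a * (a ^ (2 * k))⁻¹ * (n ^ k * gaussMoment N k ^ 2) ≤ a := by
    have e : a ^ (2 * k) = n ^ k * ((1600 * N) ^ k) ^ 2 := by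
      rw [ha, mul_pow, pow_mul, Real.sq_sqrt hn0.le, ← pow_mul, mul_comm k 2]
    calc a * (a ^ (2 * k))⁻¹ * (n ^ k * gaussMoment N k ^ 2)
        ≤ a * (a ^ (2 * k))⁻¹ * (n ^ k * ((1600 * N) ^ k) ^ 2) := by
          gcongr; exact gaussMoment_le hN hk1 hk2
      _ = a := by rw [← e]; field_simp
  calc _ ≤ a + a * (a ^ (2 * k))⁻¹ * (n ^ k * gaussMoment N k ^ 2) := by gcongr
    _ ≤ a + a := by gcongr
    _ = _ := by rw [ha]; ring

end QExp
end

/-! ### Decoupling: the Gaussian operator on matrices of trace zero. -/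

noncomputable section

namespace QExp

open MeasureTheory Complex ComplexConjugate Module

variable {n N : ℕ}

/-! ### Second and fourth moments -/

section LowMoments

variable {ι : Type*} [Fintype ι] [DecidableEq ι]

lemma prod_pow_single (y : ι → ℂ) (i : ι) : ∏ m, y m ^ (Pi.single i 1 : ι → ℕ) m = y i := by
  rw [Finset.prod_eq_single i (fun m _ hm => by simp [hm]) (by simp)]
  simp

lemma integral_gauss_mul_conj (i k : ι) :
    ∫ y, y i * conj (y k) ∂gauss ι = if i = k then 1 else 0 := by
  have h := integral_gauss_monomial (Pi.single i 1 : ι → ℕ) (Pi.single k 1)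
  simp_rw [prod_pow_single] at h
  rw [h]
  by_cases hik : i = k
  · subst hik
    rw [if_pos rfl, if_pos rfl, Finset.prod_eq_one]
    · simp
    · intro m _
      by_cases hm : m = i
      · subst hm; simp
      · simp [hm]
  · rw [if_neg hik, if_neg]
    · simp
    · intro h'
      have := congrFun h' i
      simp [hik] at this

lemma integrable_gauss_mul_conj (i k : ι) :
    Integrable (fun y : ι → ℂ => y i * conj (y k)) (gauss ι) := by
  have h := integrable_gauss_monomial (Pi.single i 1 : ι → ℕ) (Pi.single k 1)
  simp_rw [prod_pow_single] at h
  exact h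

end LowMoments

/-! ### Growth of the norms -/

lemma frob_mul_le (A B : Mat N) : frob (A * B) ≤ frob A * frob B := by
  refine abs_le_of_sq_le_sq' ?_ (mul_nonneg (frob_nonneg _) (frob_nonneg _)) |>.2
  rw [mul_pow, frob_sq_eq_sum, frob_sq_eq_sum, ← frob_conjTranspose B, frob_sq_eq_sum,
    Finset.sum_mul_sum]
  refine Finset.sum_le_sum fun a _ => Finset.sum_le_sum fun c _ => ?_
  calc ‖(A * B) a c‖ ^ 2 ≤ (∑ b, ‖A a b‖ * ‖Bᴴ c b‖) ^ 2 := by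
        gcongr
        rw [Matrix.mul_apply]
        refine (norm_sum_le _ _).trans (le_of_eq ?_)
        simp
    _ ≤ _ := Finset.sum_mul_sq_le_sq_mul_sq _ _ _

lemma tensorNorm_le_sum (x y : Tuple n N) :
    tensorNorm x y ≤ ∑ j, frob (x j) * frob (y j) := by
  refine tensorNorm_le (Finset.sum_nonneg fun j _ => mul_nonneg (frob_nonneg _) (frob_nonneg _))
    fun ξ => (frob_sum_le _ _).trans ?_
  rw [Finset.sum_mul]
  refine Finset.sum_le_sum fun j _ => ?_
  calc frob (x j * ξ * (y j)ᴴ) ≤ frob (x j) * frob ξ * frob (y j)ᴴ :=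
        (frob_mul_le _ _).trans (mul_le_mul_of_nonneg_right (frob_mul_le _ _) (frob_nonneg _))
    _ = _ := by rw [frob_conjTranspose]; ring

lemma frob_le_sum (A : Mat N) : frob A ≤ ∑ a, ∑ b, ‖A a b‖ := by
  refine abs_le_of_sq_le_sq' ?_ (by positivity) |>.2
  rw [frob_sq_eq_sum, ← Fintype.sum_prod_type', ← Fintype.sum_prod_type']
  exact Finset.sum_sq_le_sq_sum_of_nonneg fun i _ => norm_nonneg _

lemma sum_frob_matT_le (y : Fin n × Fin N × Fin N → ℂ) :
    ∑ j, frob (matT y j) ≤ ∑ i, ‖y i‖ := by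
  rw [Fintype.sum_prod_type]
  refine Finset.sum_le_sum fun j _ => (frob_le_sum _).trans (le_of_eq ?_)
  rw [Fintype.sum_prod_type]
  rfl

lemma sum_frob_matT_sq_le (y : Fin n × Fin N × Fin N → ℂ) :
    ∑ j, frob (matT y j) * frob (matT y j) ≤ 2 * Real.exp (1 * ∑ i, ‖y i‖) := by
  have h0 : 0 ≤ ∑ i, ‖y i‖ := Finset.sum_nonneg fun i _ => norm_nonneg _
  have h := Real.pow_div_factorial_le_exp (∑ i, ‖y i‖) h0 2
  have h2 : ∑ j, frob (matT y j) ^ 2 ≤ (∑ j, frob (matT y j)) ^ 2 :=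
    Finset.sum_sq_le_sq_sum_of_nonneg fun j _ => frob_nonneg _
  have h3 : (∑ j, frob (matT y j)) ^ 2 ≤ (∑ i, ‖y i‖) ^ 2 :=
    pow_le_pow_left₀ (Finset.sum_nonneg fun j _ => frob_nonneg _) (sum_frob_matT_le y) 2
  simp only [sq] at h2 h3 h
  norm_num at h
  rw [one_mul]
  linarith

/-! ### Decoupling -/

/-- The orthogonal projection onto the matrices of trace zero. -/
def traceless (N : ℕ) :
    EuclideanSpace ℂ (Fin N × Fin N) →L[ℂ] EuclideanSpace ℂ (Fin N × Fin N) :=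
  (Submodule.span ℂ {vecE (1 : Mat N)})ᗮ.starProjection

lemma traceless_vecE {ξ : Mat N} (h : ξ.trace = 0) : traceless N (vecE ξ) = vecE ξ := by
  rw [traceless, Submodule.starProjection_eq_self_iff, Submodule.mem_orthogonal_singleton_iff_inner_right,
    inner_vecE]
  simpa using h

lemma trace_traceless (v : EuclideanSpace ℂ (Fin N × Fin N)) :
    (unvecE (traceless N v)).trace = 0 := by
  have h : traceless N v ∈ (Submodule.span ℂ {vecE (1 : Mat N)})ᗮ :=
    Submodule.starProjection_apply_mem _ _
  rw [Submodule.mem_orthogonal_singleton_iff_inner_right, ← vecE_unvecE (traceless N v),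
    inner_vecE] at h
  simpa using h

lemma norm_traceless_le : ‖traceless N‖ ≤ 1 := Submodule.starProjection_norm_le _

lemma continuous_tensorOp : Continuous fun p : Tuple n N × Tuple n N => tensorOp p.1 p.2 := by
  have h1 : Continuous fun p : Tuple n N × Tuple n N => ∑ j, p.1 j ⊗ₖ (p.2 j).map star := by
    refine continuous_finsetSum _ fun j _ => continuous_matrix fun a b => ?_
    simp only [Matrix.kroneckerMap_apply, Matrix.map_apply]
    have c1 : Continuous fun p : Tuple n N × Tuple n N => p.1 j a.1 b.1 :=
      ((continuous_apply j).comp continuous_fst).matrix_elem _ _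
    have c2 : Continuous fun p : Tuple n N × Tuple n N => p.2 j a.2 b.2 :=
      ((continuous_apply j).comp continuous_snd).matrix_elem _ _
    exact c1.mul c2.star
  exact ((Matrix.toEuclideanCLM (n := Fin N × Fin N) (𝕜 := ℂ)).toAlgEquiv.toLinearMap
    |>.continuous_of_finiteDimensional).comp h1

/-- The operator `ξ ↦ ∑ x j ξ (x j)*` on matrices of trace zero. -/
def tracelessOp (x : Tuple n N) :
    EuclideanSpace ℂ (Fin N × Fin N) →L[ℂ] EuclideanSpace ℂ (Fin N × Fin N) :=
  (tensorOp x x).comp (traceless N)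

lemma continuous_tracelessOp : Continuous (tracelessOp (n := n) (N := N)) :=
  (continuous_tensorOp.comp (continuous_id.prodMk continuous_id)).clm_comp continuous_const

lemma norm_tracelessOp_le (x : Tuple n N) : ‖tracelessOp x‖ ≤ ∑ j, frob (x j) * frob (x j) := by
  refine (ContinuousLinearMap.opNorm_comp_le _ _).trans ?_
  refine (mul_le_of_le_one_right (norm_nonneg _) norm_traceless_le).trans ?_
  exact tensorNorm_le_sum x x

lemma integrable_tracelessOp :
    Integrable (fun y => tracelessOp (matT y : Tuple n N)) (gauss _) :=
  integrable_gauss_of_le (continuous_tracelessOp.comp continuous_matT).aestronglyMeasurable 2 1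
    fun y => (norm_tracelessOp_le _).trans (sum_frob_matT_sq_le y)

lemma tracelessOp_apply (x : Tuple n N) (v : EuclideanSpace ℂ (Fin N × Fin N)) :
    tracelessOp x v = vecE (∑ j, x j * unvecE (traceless N v) * (x j)ᴴ) := by
  rw [tracelessOp, ContinuousLinearMap.comp_apply, ← tensorOp_vecE, vecE_unvecE]

/-- Since E Y_j ξ Y_j* = tr(ξ) 1, the projection onto trace zero removes the mean entirely. This is
what permits symmetrization. -/
lemma integral_tracelessOp : ∫ y, tracelessOp (matT y : Tuple n N) ∂gauss _ = 0 := by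
  ext v p
  rw [ContinuousLinearMap.integral_apply integrable_tracelessOp]
  have hi : Integrable (fun y => tracelessOp (matT y : Tuple n N) v) (gauss _) :=
    integrable_tracelessOp.apply_continuousLinearMap v
  have h := (EuclideanSpace.proj p : EuclideanSpace ℂ (Fin N × Fin N) →L[ℂ] ℂ).integral_comp_comm hi
  simp only [PiLp.proj_apply] at h
  rw [← h]
  set ξ := unvecE (traceless N v) with hξ
  have hξ0 : ξ.trace = 0 := trace_traceless v
  have e : ∀ y : Fin n × Fin N × Fin N → ℂ, (tracelessOp (matT y : Tuple n N) v) p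
      = ∑ j, ∑ d, ∑ c, ξ c d * (y (j, p.1, c) * conj (y (j, p.2, d))) := by
    intro y
    rw [tracelessOp_apply, vecE_apply, Matrix.sum_apply]
    refine Finset.sum_congr rfl fun j _ => ?_
    rw [Matrix.mul_apply]
    refine Finset.sum_congr rfl fun d _ => ?_
    rw [Matrix.mul_apply, Finset.sum_mul]
    refine Finset.sum_congr rfl fun c _ => ?_
    simp only [matT_apply, Matrix.conjTranspose_apply, Complex.star_def, hξ]
    ring
  simp_rw [e]
  rw [integral_finsetSum _ fun j _ => integrable_finsetSum _ fun d _ => integrable_finsetSum _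
    fun c _ => (integrable_gauss_mul_conj _ _).const_mul _]
  simp only [_root_.zero_apply, PiLp.zero_apply]
  refine Finset.sum_eq_zero fun j _ => ?_
  rw [integral_finsetSum _ fun d _ => integrable_finsetSum _
    fun c _ => (integrable_gauss_mul_conj _ _).const_mul _]
  have e2 : ∀ d, ∫ y : Fin n × Fin N × Fin N → ℂ,
      ∑ c, ξ c d * (y (j, p.1, c) * conj (y (j, p.2, d))) ∂gauss _
      = if p.1 = p.2 then ξ d d else 0 := by
    intro d
    rw [integral_finsetSum _ fun c _ => (integrable_gauss_mul_conj _ _).const_mul _]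
    simp_rw [integral_const_mul, integral_gauss_mul_conj]
    split_ifs with hp
    · simp [hp]
    · simp [hp]
  simp_rw [e2]
  split_ifs
  · exact hξ0
  · simp

/-- The matrix 2^(-1/2) (1 1; 1 -1) is symmetric and orthogonal, so the map is its own adjoint, and
isometric by the parallelogram law. -/
lemma measurePreserving_rotation (ι : Type*) [Fintype ι] :
    MeasurePreserving (fun p : (ι → ℂ) × (ι → ℂ) =>
      ((fun i => ((Real.sqrt 2)⁻¹ : ℂ) * (p.1 i + p.2 i)),
        fun i => ((Real.sqrt 2)⁻¹ : ℂ) * (p.1 i - p.2 i)))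
      ((gauss ι).prod (gauss ι)) ((gauss ι).prod (gauss ι)) := by
  have he : MeasurePreserving (MeasurableEquiv.sumPiEquivProdPi (fun _ : ι ⊕ ι => ℂ))
      (gauss (ι ⊕ ι)) ((gauss ι).prod (gauss ι)) :=
    measurePreserving_sumPiEquivProdPi (fun _ : ι ⊕ ι => gaussC)
  let R : (ι ⊕ ι → ℂ) → (ι ⊕ ι → ℂ) := fun y => Sum.elim
    (fun i => ((Real.sqrt 2)⁻¹ : ℂ) * (y (Sum.inl i) + y (Sum.inr i)))
    (fun i => ((Real.sqrt 2)⁻¹ : ℂ) * (y (Sum.inl i) - y (Sum.inr i)))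
  have hs : (Real.sqrt 2)⁻¹ * (Real.sqrt 2)⁻¹ = (1 / 2 : ℝ) := by
    rw [← mul_inv, Real.mul_self_sqrt (by norm_num)]; norm_num
  have hR : MeasurePreserving R (gauss _) (gauss _) := by
    refine measurePreserving_gauss R ?_ ?_ ?_
    · refine measurable_pi_iff.2 fun i => ?_
      rcases i with i | i <;> simp only [R, Sum.elim_inl, Sum.elim_inr] <;> fun_prop
    · intro t y
      simp only [Fintype.sum_sum_type, R, Sum.elim_inl, Sum.elim_inr]
      rw [← Finset.sum_add_distrib, ← Finset.sum_add_distrib]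
      refine Finset.sum_congr rfl fun i _ => ?_
      simp only [Complex.inner, map_mul, map_add, map_sub]
      rw [← Complex.ofReal_inv, Complex.conj_ofReal, ← Complex.add_re, ← Complex.add_re]
      congr 1
      ring
    · intro t
      simp only [Fintype.sum_sum_type, R, Sum.elim_inl, Sum.elim_inr]
      rw [← Finset.sum_add_distrib, ← Finset.sum_add_distrib]
      refine Finset.sum_congr rfl fun i _ => ?_
      rw [norm_mul, norm_mul, mul_pow, mul_pow, ← mul_add, ← Complex.ofReal_inv, Complex.norm_real,
        Real.norm_eq_abs, sq_abs, sq ((Real.sqrt 2)⁻¹), hs]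
      have := parallelogram_law_with_norm ℂ (t (Sum.inl i)) (t (Sum.inr i))
      simp only [sq]
      linarith
  exact (he.comp hR).comp (he.symm _)

/-- Subtracting an independent copy does not decrease the expected norm of a centred variable. In
the rotated pair, the difference of the two quadratic expressions is a sum of two decoupled bilinear
ones, each already estimated. -/
lemma integral_norm_tracelessOp_le (hn : 0 < n) (hN : 1 ≤ N) :
    ∫ y, ‖tracelessOp (matT y : Tuple n N)‖ ∂gauss _ ≤ 6400 * N * Real.sqrt n := by
  set γ := gauss (Fin n × Fin N × Fin N) with hγ
  set F : (Fin n × Fin N × Fin N → ℂ) → _ := fun y => tracelessOp (matT y : Tuple n N) with hF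
  have hFi : Integrable F γ := integrable_tracelessOp
  obtain ⟨hTi, hTle⟩ := integral_tensorNorm_le (N := N) hn hN
  have hdiff : Integrable (fun p : _ × _ => F p.1 - F p.2) (γ.prod γ) :=
    (hFi.comp_fst γ).sub (hFi.comp_snd γ)
  have h1 : ∀ y, ‖F y‖ ≤ ∫ y', ‖F y - F y'‖ ∂γ := by
    intro y
    have e : F y = ∫ y', (F y - F y') ∂γ := by
      rw [integral_sub (integrable_const _) hFi, integral_tracelessOp]; simp
    conv_lhs => rw [e]
    exact norm_integral_le_integral_norm _
  have h2 : ∫ y, ‖F y‖ ∂γ ≤ ∫ p, ‖F p.1 - F p.2‖ ∂(γ.prod γ) := by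
    rw [integral_prod _ hdiff.norm]
    exact integral_mono hFi.norm hdiff.norm.integral_prod_left h1
  set ρ : (Fin n × Fin N × Fin N → ℂ) × (Fin n × Fin N × Fin N → ℂ) → _ := fun p =>
      ((fun i => ((Real.sqrt 2)⁻¹ : ℂ) * (p.1 i + p.2 i)),
        fun i => ((Real.sqrt 2)⁻¹ : ℂ) * (p.1 i - p.2 i)) with hρ
  have hρm : MeasurePreserving ρ (γ.prod γ) (γ.prod γ) := measurePreserving_rotation _
  set τ : (Fin n × Fin N × Fin N → ℂ) × (Fin n × Fin N × Fin N → ℂ) → ℝ := fun p =>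
      tensorNorm (matT p.1) (matT p.2) with hτ
  have h3 : ∀ p, ‖F p.1 - F p.2‖ ≤ τ (ρ p) + τ (ρ p).swap := by
    intro p
    have e : F p.1 - F p.2 = (tensorOp (matT (ρ p).1) (matT (ρ p).2)
        + tensorOp (matT (ρ p).2) (matT (ρ p).1)).comp (traceless N) := by
      ext1 v
      rw [sub_apply, tracelessOp_apply, tracelessOp_apply, ContinuousLinearMap.comp_apply,
        add_apply, ← vecE_unvecE (traceless N v), tensorOp_vecE, tensorOp_vecE, ← map_sub,
        ← map_add, vecE_unvecE]
      congr 1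
      rw [← Finset.sum_sub_distrib, ← Finset.sum_add_distrib]
      refine Finset.sum_congr rfl fun j _ => ?_
      have e1 : (matT (ρ p).1 : Tuple n N) j = ((Real.sqrt 2)⁻¹ : ℂ) • (matT p.1 j + matT p.2 j) := by
        ext a b; simp [hρ]
      have e2 : (matT (ρ p).2 : Tuple n N) j = ((Real.sqrt 2)⁻¹ : ℂ) • (matT p.1 j - matT p.2 j) := by
        ext a b; simp [hρ]
      have hs : (Real.sqrt 2 : ℂ)⁻¹ * (Real.sqrt 2 : ℂ)⁻¹ = 1 / 2 := by
        rw [← mul_inv, ← Complex.ofReal_mul, Real.mul_self_sqrt (by norm_num)]; norm_num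
      rw [e1, e2]
      simp only [Matrix.conjTranspose_smul, Matrix.smul_mul, Matrix.mul_smul, smul_smul]
      rw [← Complex.ofReal_inv, Complex.star_def, Complex.conj_ofReal, Complex.ofReal_inv, hs,
        ← smul_add]
      simp only [Matrix.conjTranspose_sub, Matrix.conjTranspose_add]
      set A : Mat N := matT p.1 j
      set B : Mat N := matT p.2 j
      set ξ := unvecE (traceless N v)
      -- The factor 2 cancels the 1/2 produced by the two normalizations 1/√2.
      have : (A + B) * ξ * (Aᴴ - Bᴴ) + (A - B) * ξ * (Aᴴ + Bᴴ)
          = (2 : ℂ) • (A * ξ * Aᴴ - B * ξ * Bᴴ) := by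
        rw [two_smul]; noncomm_ring
      rw [this, smul_smul]
      norm_num
    rw [e]
    refine (ContinuousLinearMap.opNorm_comp_le _ _).trans ?_
    refine (mul_le_of_le_one_right (norm_nonneg _) norm_traceless_le).trans ?_
    exact norm_add_le _ _
  have hswap : Integrable (fun p : _ × _ => τ p.swap) (γ.prod γ) := hTi.swap
  have hs1 : Integrable (fun p => τ (ρ p)) (γ.prod γ) := hρm.integrable_comp_of_integrable hTi
  have hs2 : Integrable (fun p => τ (ρ p).swap) (γ.prod γ) :=
    hρm.integrable_comp_of_integrable hswap
  have e1 : ∫ p, τ (ρ p) ∂(γ.prod γ) = ∫ p, τ p ∂(γ.prod γ) := by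
    conv_rhs => rw [← hρm.map_eq]
    rw [integral_map hρm.aemeasurable]
    rw [hρm.map_eq]; exact hTi.aestronglyMeasurable
  have e2 : ∫ p, τ (ρ p).swap ∂(γ.prod γ) = ∫ p, τ p ∂(γ.prod γ) := by
    rw [← integral_prod_swap τ]
    conv_rhs => rw [← hρm.map_eq]
    rw [integral_map hρm.aemeasurable]
    rw [hρm.map_eq]; exact hswap.aestronglyMeasurable
  calc ∫ y, ‖F y‖ ∂γ ≤ ∫ p, ‖F p.1 - F p.2‖ ∂(γ.prod γ) := h2
    _ ≤ ∫ p, (τ (ρ p) + τ (ρ p).swap) ∂(γ.prod γ) := integral_mono hdiff.norm (hs1.add hs2) h3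
    _ = ∫ p, τ p ∂(γ.prod γ) + ∫ p, τ p ∂(γ.prod γ) := by rw [integral_add hs1 hs2, e1, e2]
    _ ≤ 3200 * N * Real.sqrt n + 3200 * N * Real.sqrt n := add_le_add hTle hTle
    _ = _ := by ring

end QExp
end

/-! ### Polar decomposition, and commutants of the unitary group. -/

open scoped ComplexOrder

noncomputable section

namespace QExp

open MeasureTheory Complex ComplexConjugate Module

variable {n N : ℕ}

/-! ### The modulus of a matrix and the polar decomposition -/

section Modulus

open scoped MatrixOrder Matrix.Norms.L2Operator

/-- The modulus `(A* A)^{1/2}`. -/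
def absM (A : Mat N) : Mat N := CFC.abs A

lemma absM_posSemidef (A : Mat N) : (absM A).PosSemidef :=
  Matrix.nonneg_iff_posSemidef.1 (CFC.abs_nonneg A)

lemma absM_mul_self (A : Mat N) : absM A * absM A = Aᴴ * A := CFC.abs_mul_abs A

lemma absM_conjTranspose (A : Mat N) : (absM A)ᴴ = absM A := (absM_posSemidef A).isHermitian

lemma continuous_absM : Continuous (absM : Mat N → Mat N) := CFC.continuous_abs

lemma absM_eq_of_mul_self {A H : Mat N} (hH : H.PosSemidef) (h : H * H = Aᴴ * A) : absM A = H :=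
  CFC.sqrt_unique h (Matrix.nonneg_iff_posSemidef.2 hH)

/-- Every positive semidefinite matrix is the square of a positive semidefinite matrix. -/
lemma exists_sqrt {H : Mat N} (hH : H.PosSemidef) : ∃ R : Mat N, Rᴴ = R ∧ R * R = H := by
  have h0 := Matrix.nonneg_iff_posSemidef.2 hH
  refine ⟨CFC.sqrt H, (Matrix.nonneg_iff_posSemidef.1 (CFC.sqrt_nonneg H)).isHermitian, ?_⟩
  exact CFC.sqrt_mul_sqrt_self H h0

end Modulus

lemma absM_mul_unitary {V : Mat N} (hV : V ∈ Matrix.unitaryGroup (Fin N) ℂ) (A : Mat N) :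
    absM (A * V) = Vᴴ * absM A * V := by
  refine absM_eq_of_mul_self ((absM_posSemidef A).conjTranspose_mul_mul_same V) ?_
  have h : V * Vᴴ = 1 := Matrix.mem_unitaryGroup_iff.1 hV
  calc Vᴴ * absM A * V * (Vᴴ * absM A * V) = Vᴴ * absM A * (V * Vᴴ) * absM A * V := by
        simp only [Matrix.mul_assoc]
    _ = Vᴴ * (absM A * absM A) * V := by rw [h]; simp only [Matrix.mul_assoc, Matrix.one_mul]
    _ = (A * V)ᴴ * (A * V) := by
      rw [absM_mul_self, Matrix.conjTranspose_mul]; simp only [Matrix.mul_assoc]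

lemma frob_absM (A : Mat N) : frob (absM A) = frob A :=
  frob_eq_of_sq (by rw [absM_conjTranspose, absM_mul_self])

lemma norm_toEuclideanCLM_absM (A : Mat N) (x : EuclideanSpace ℂ (Fin N)) :
    ‖Matrix.toEuclideanCLM (𝕜 := ℂ) (absM A) x‖ = ‖Matrix.toEuclideanCLM (𝕜 := ℂ) A x‖ := by
  have key : ∀ B : Mat N, ((‖Matrix.toEuclideanCLM (𝕜 := ℂ) B x‖ ^ 2 : ℝ) : ℂ)
      = inner ℂ x (Matrix.toEuclideanCLM (𝕜 := ℂ) (Bᴴ * B) x) := by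
    intro B
    rw [map_mul, ← Matrix.star_eq_conjTranspose, map_star, mul_apply_eq_comp,
      ContinuousLinearMap.star_eq_adjoint, ContinuousLinearMap.adjoint_inner_right,
      inner_self_eq_norm_sq_to_K]
    simp
  have h1 := key (absM A)
  rw [absM_conjTranspose, absM_mul_self, ← key A] at h1
  have h2 := Complex.ofReal_injective h1
  exact (pow_left_inj₀ (norm_nonneg _) (norm_nonneg _) two_ne_zero).1 h2

/-- The polar decomposition. -/
lemma exists_polar (A : Mat N) : ∃ W ∈ Matrix.unitaryGroup (Fin N) ℂ, A = W * absM A := by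
  set f := Matrix.toEuclideanCLM (n := Fin N) (𝕜 := ℂ) A with hf
  set h := Matrix.toEuclideanCLM (n := Fin N) (𝕜 := ℂ) (absM A) with hh
  have hfh : ∀ x, ‖h x‖ = ‖f x‖ := norm_toEuclideanCLM_absM A
  -- The modulus may be singular. On its range the partial isometry |A|x ↦ Ax is realized through a
  -- linear section and then extended to the whole space, where an isometry is unitary by dimension.
  obtain ⟨s, hs⟩ := h.toLinearMap.rangeRestrict.exists_rightInverse_of_surjective
    (LinearMap.range_eq_top.2 h.toLinearMap.surjective_rangeRestrict)
  have hs' : ∀ y : LinearMap.range h.toLinearMap, h (s y) = y := fun y =>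
    congrArg Subtype.val (LinearMap.congr_fun hs y)
  let L : LinearMap.range h.toLinearMap →ₗᵢ[ℂ] EuclideanSpace ℂ (Fin N) :=
    { toLinearMap := f.toLinearMap ∘ₗ s
      norm_map' := fun y => by
        show ‖f (s y)‖ = ‖y‖
        rw [← hfh, hs']
        rfl }
  have hL : ∀ x, L.extend (h x) = f x := by
    intro x
    have hmem : h x ∈ LinearMap.range h.toLinearMap := ⟨x, rfl⟩
    have e1 : L.extend (h x) = f (s ⟨h x, hmem⟩) := L.extend_apply ⟨h x, hmem⟩
    rw [e1, ← sub_eq_zero, ← map_sub, ← norm_eq_zero, ← hfh, map_sub, hs', sub_self, norm_zero]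
  let e := L.extend.toLinearIsometryEquiv rfl
  let u := Unitary.linearIsometryEquiv.symm e
  have hue : ∀ x, (u : EuclideanSpace ℂ (Fin N) →L[ℂ] EuclideanSpace ℂ (Fin N)) x = L.extend x :=
    fun x => rfl
  obtain ⟨W, hW⟩ := EquivLike.surjective (Matrix.toEuclideanCLM (n := Fin N) (𝕜 := ℂ))
    (u : EuclideanSpace ℂ (Fin N) →L[ℂ] EuclideanSpace ℂ (Fin N))
  have hinj := EquivLike.injective (Matrix.toEuclideanCLM (n := Fin N) (𝕜 := ℂ))
  refine ⟨W, ?_, ?_⟩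
  · rw [Matrix.mem_unitaryGroup_iff]
    apply hinj
    rw [map_mul, map_star, map_one, hW]
    exact Unitary.mul_star_self_of_mem u.2
  · apply hinj
    rw [map_mul, hW]
    ext1 x
    rw [mul_apply_eq_comp, hue]
    exact (hL x).symm

/-! ### Matrices and linear maps commuting with the unitary group -/

/-- The matrix of a permutation. -/
def permM (σ : Equiv.Perm (Fin N)) : Mat N := Matrix.of fun a b => if σ b = a then 1 else 0

lemma permM_conj_apply (σ : Equiv.Perm (Fin N)) (ξ : Mat N) (a b : Fin N) :
    (permM σ * ξ * (permM σ)ᴴ) (σ a) (σ b) = ξ a b := by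
  simp [permM, Matrix.mul_apply]

lemma permM_mem (σ : Equiv.Perm (Fin N)) : permM σ ∈ Matrix.unitaryGroup (Fin N) ℂ := by
  rw [Matrix.mem_unitaryGroup_iff, Matrix.star_eq_conjTranspose]
  ext a b
  obtain ⟨a, rfl⟩ := σ.surjective a
  obtain ⟨b, rfl⟩ := σ.surjective b
  have := permM_conj_apply σ 1 a b
  rw [mul_one] at this
  rw [this, Matrix.one_apply, Matrix.one_apply]
  simp

lemma permM_conj_diagonal (σ : Equiv.Perm (Fin N)) (d : Fin N → ℂ) :
    permM σ * Matrix.diagonal d * (permM σ)ᴴ = Matrix.diagonal fun a => d (σ.symm a) := by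
  ext a b
  obtain ⟨a, rfl⟩ := σ.surjective a
  obtain ⟨b, rfl⟩ := σ.surjective b
  rw [permM_conj_apply, Matrix.diagonal_apply, Matrix.diagonal_apply]
  simp

/-- The reflection changing the sign of a basis vector. -/
def reflM (k : Fin N) : Mat N := Matrix.diagonal fun a => if a = k then -1 else 1

lemma reflM_conjTranspose (k : Fin N) : (reflM k)ᴴ = reflM k := by
  rw [reflM, Matrix.diagonal_conjTranspose]
  congr 1
  ext a
  by_cases h : a = k <;> simp [h]

lemma reflM_mem (k : Fin N) : reflM k ∈ Matrix.unitaryGroup (Fin N) ℂ := by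
  rw [Matrix.mem_unitaryGroup_iff, Matrix.star_eq_conjTranspose, reflM_conjTranspose, reflM,
    Matrix.diagonal_mul_diagonal, ← Matrix.diagonal_one]
  congr 1
  ext a
  by_cases h : a = k <;> simp [h]

lemma reflM_conj_diagonal (k : Fin N) (d : Fin N → ℂ) :
    reflM k * Matrix.diagonal d * (reflM k)ᴴ = Matrix.diagonal d := by
  rw [reflM_conjTranspose, reflM, Matrix.diagonal_mul_diagonal, Matrix.diagonal_mul_diagonal]
  congr 1
  ext a
  by_cases h : a = k <;> simp [h]

lemma offDiag_eq_zero_of_reflM {M : Mat N} (h : ∀ k, reflM k * M * (reflM k)ᴴ = M) {a b : Fin N}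
    (hab : a ≠ b) : M a b = 0 := by
  have h1 := congrFun (congrFun (h a) a) b
  rw [reflM_conjTranspose, reflM, Matrix.mul_diagonal, Matrix.diagonal_mul] at h1
  simp only [if_true, if_neg hab.symm] at h1
  have : (2 : ℂ) * M a b = 0 := by linear_combination -h1
  simpa using this

/-- Sign changes annihilate the off-diagonal entries, and transpositions make the diagonal entries
equal. -/
lemma exists_eq_scalar {M : Mat N}
    (h : ∀ V ∈ Matrix.unitaryGroup (Fin N) ℂ, V * M * Vᴴ = M) : ∃ c : ℂ, M = c • 1 := by
  rcases Nat.eq_zero_or_pos N with hN | hN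
  · subst hN; exact ⟨0, Subsingleton.elim _ _⟩
  · refine ⟨M ⟨0, hN⟩ ⟨0, hN⟩, ?_⟩
    ext a b
    rw [Matrix.smul_apply, Matrix.one_apply]
    split_ifs with hab
    · subst hab
      have := permM_conj_apply (Equiv.swap ⟨0, hN⟩ a) M ⟨0, hN⟩ ⟨0, hN⟩
      rw [h _ (permM_mem _), Equiv.swap_apply_left] at this
      simpa using this
    · simp [offDiag_eq_zero_of_reflM (fun k => h _ (reflM_mem k)) hab]

lemma exists_perm_pair {α : Type*} [DecidableEq α] {i k i' k' : α} (h : i ≠ k) (h' : i' ≠ k') :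
    ∃ σ : Equiv.Perm α, σ i = i' ∧ σ k = k' := by
  refine ⟨Equiv.swap (Equiv.swap i i' k) k' * Equiv.swap i i', ?_, ?_⟩
  · rw [Equiv.Perm.mul_apply, Equiv.swap_apply_left, Equiv.swap_apply_of_ne_of_ne _ h']
    intro hh
    have := (Equiv.swap i i').injective ((Equiv.swap_apply_left i i').trans hh)
    exact h this
  · rw [Equiv.Perm.mul_apply, Equiv.swap_apply_left]

/-- A linear map on matrices which commutes with all unitary conjugations is a combination of the
identity and the trace. -/
lemma exists_eq_smul_add_trace (Φ : Mat N →ₗ[ℂ] Mat N)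
    (h : ∀ V ∈ Matrix.unitaryGroup (Fin N) ℂ, ∀ ξ, Φ (V * ξ * Vᴴ) = V * Φ ξ * Vᴴ) :
    ∃ β b : ℂ, ∀ ξ, Φ ξ = β • ξ + (b * ξ.trace) • 1 := by
  classical
  let E : Fin N → Mat N := fun i => Matrix.diagonal (Pi.single i 1)
  -- Sign changes fix diagonal matrices, so their images are diagonal. Permutations then leave two
  -- free parameters, the entry at i and the common entry elsewhere, which determines Φ on diagonal
  -- matrices; unitary diagonalization and ξ = Re ξ + i Im ξ do the rest.
  have hoff : ∀ i a b, a ≠ b → Φ (E i) a b = 0 := fun i a b hab =>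
    offDiag_eq_zero_of_reflM (fun k => by rw [← h _ (reflM_mem k), reflM_conj_diagonal]) hab
  have hperm : ∀ (σ : Equiv.Perm (Fin N)) i a, Φ (E (σ i)) (σ a) (σ a) = Φ (E i) a a := by
    intro σ i a
    rw [← permM_conj_apply σ (Φ (E i)), ← h _ (permM_mem σ), permM_conj_diagonal]
    have hc : (fun c => (Pi.single i 1 : Fin N → ℂ) (σ.symm c)) = Pi.single (σ i) 1 := by
      funext c
      simp only [Pi.single_apply, Equiv.symm_apply_eq]
    rw [hc]
  have hα : ∃ α, ∀ i, Φ (E i) i i = α := by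
    by_cases hN : Nonempty (Fin N)
    · obtain ⟨i0⟩ := hN
      refine ⟨Φ (E i0) i0 i0, fun i => ?_⟩
      have := hperm (Equiv.swap i0 i) i0 i0
      rwa [Equiv.swap_apply_left] at this
    · exact ⟨0, fun i => (hN ⟨i⟩).elim⟩
  have hb : ∃ b, ∀ i k, i ≠ k → Φ (E i) k k = b := by
    by_cases hN : ∃ i k : Fin N, i ≠ k
    · obtain ⟨i0, k0, h0⟩ := hN
      refine ⟨Φ (E i0) k0 k0, fun i k hik => ?_⟩
      obtain ⟨σ, h1, h2⟩ := exists_perm_pair h0 hik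
      have := hperm σ i0 k0
      rwa [h1, h2] at this
    · exact ⟨0, fun i k hik => (hN ⟨i, k, hik⟩).elim⟩
  obtain ⟨α, hα⟩ := hα
  obtain ⟨b, hb⟩ := hb
  have hE : ∀ i, Φ (E i) = (α - b) • E i + b • (1 : Mat N) := by
    intro i
    ext a c
    by_cases hac : a = c
    · subst hac
      by_cases hai : a = i
      · subst hai; simp [E, hα]
      · rw [hb i a (Ne.symm hai)]; simp [E, hai]
    · rw [hoff i a c hac]; simp [E, hac]
  have hdiag : ∀ d : Fin N → ℂ, Φ (Matrix.diagonal d)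
      = (α - b) • Matrix.diagonal d + (b * (Matrix.diagonal d).trace) • (1 : Mat N) := by
    intro d
    have e : Matrix.diagonal d = ∑ i, d i • E i := by
      ext a c
      rw [Matrix.sum_apply]
      by_cases hac : a = c
      · subst hac; simp [E, Pi.single_apply]
      · simp [E, hac]
    conv_lhs => rw [e]
    rw [map_sum]
    simp_rw [map_smul, hE, smul_add, Finset.sum_add_distrib, smul_smul]
    have e2 : (α - b) • Matrix.diagonal d = ∑ i, (α - b) • d i • E i := by
      conv_lhs => rw [e]
      rw [Finset.smul_sum]
    rw [e2, Matrix.trace_diagonal, Finset.mul_sum, Finset.sum_smul]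
    congr 1
    · refine Finset.sum_congr rfl fun i _ => by rw [smul_smul, mul_comm]
    · refine Finset.sum_congr rfl fun i _ => by rw [mul_comm]
  have hherm : ∀ ξ : Mat N, ξ.IsHermitian →
      Φ ξ = (α - b) • ξ + (b * ξ.trace) • (1 : Mat N) := by
    intro ξ hξ
    have hs := hξ.spectral_theorem
    rw [Unitary.conjStarAlgAut_apply] at hs
    set U : Mat N := (hξ.eigenvectorUnitary : Mat N)
    have hU : U ∈ Matrix.unitaryGroup (Fin N) ℂ := hξ.eigenvectorUnitary.2
    have hUU : U * Uᴴ = 1 := Matrix.mem_unitaryGroup_iff.1 hU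
    have hUU' : Uᴴ * U = 1 := Matrix.mem_unitaryGroup_iff'.1 hU
    rw [Matrix.star_eq_conjTranspose] at hs
    rw [hs, h U hU, hdiag, Matrix.trace_mul_comm, ← Matrix.mul_assoc, hUU', Matrix.one_mul]
    simp only [Matrix.mul_add, Matrix.add_mul, Matrix.mul_smul, Matrix.smul_mul, Matrix.mul_one, hUU]
  refine ⟨α - b, b, fun ξ => ?_⟩
  have h1 : (ξ + ξᴴ).IsHermitian := by
    rw [Matrix.IsHermitian, Matrix.conjTranspose_add, Matrix.conjTranspose_conjTranspose, add_comm]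
  have h2 : (I • (ξ - ξᴴ)).IsHermitian := by
    rw [Matrix.IsHermitian, Matrix.conjTranspose_smul, Matrix.conjTranspose_sub,
      Matrix.conjTranspose_conjTranspose, Complex.star_def, Complex.conj_I, neg_smul, ← smul_neg,
      neg_sub]
  have e : ξ = (1 / 2 : ℂ) • (ξ + ξᴴ) + (-I / 2 : ℂ) • (I • (ξ - ξᴴ)) := by
    rw [smul_smul, show -I / 2 * I = (1 / 2 : ℂ) by
      linear_combination (-1 / 2 : ℂ) * Complex.I_mul_I, ← smul_add, add_add_sub_cancel,
      ← two_smul ℂ ξ, smul_smul]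
    norm_num
  conv_lhs => rw [e]
  rw [map_add, map_smul, map_smul, hherm _ h1, hherm _ h2]
  conv_rhs => rw [e]
  simp only [Matrix.trace_add, Matrix.trace_smul, smul_eq_mul, smul_add, smul_smul, mul_add,
    add_smul]
  rw [show (1 / 2 : ℂ) * (α - b) = (α - b) * (1 / 2) by ring]
  module

end QExp
end

/-! ### Averages of |Z| and of ξ ↦ |Z| ξ |Z|. -/

noncomputable section

namespace QExp

open MeasureTheory Complex ComplexConjugate Module

variable {n N : ℕ}

/-! ### Unitary invariance of the Gaussian measure -/

/-- The coordinates of a tuple of matrices. -/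
def untup (x : Tuple n N) : Fin n × Fin N × Fin N → ℂ := fun p => x p.1 p.2.1 p.2.2

@[simp] lemma matT_untup (x : Tuple n N) : matT (untup x) = x := rfl

lemma continuous_untup : Continuous (untup : Tuple n N → _) :=
  continuous_pi fun p => (continuous_apply p.2.2).comp
    ((continuous_apply p.2.1).comp (continuous_apply p.1))

lemma sum_inner_matT (t y : Fin n × Fin N × Fin N → ℂ) :
    ∑ p, inner ℝ (t p) (y p) = ∑ j, ((matT t j)ᴴ * matT y j).trace.re := by
  rw [Fintype.sum_prod_type]
  refine Finset.sum_congr rfl fun j _ => ?_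
  rw [Fintype.sum_prod_type, Matrix.trace, Complex.re_sum, Finset.sum_comm]
  refine Finset.sum_congr rfl fun b _ => ?_
  rw [Matrix.diag_apply, Matrix.mul_apply, Complex.re_sum]
  refine Finset.sum_congr rfl fun a _ => ?_
  simp [Complex.inner, mul_comm]

lemma sum_norm_sq_matT (t : Fin n × Fin N × Fin N → ℂ) :
    ∑ p, ‖t p‖ ^ 2 = ∑ j, frob (matT t j) ^ 2 := by
  rw [Fintype.sum_prod_type]
  refine Finset.sum_congr rfl fun j _ => ?_
  rw [Fintype.sum_prod_type, frob_sq_eq_sum]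
  rfl

lemma measurePreserving_unitary_mul {u : Tuple n N} (hu : u ∈ unitaryTuples n N) :
    MeasurePreserving (fun y => untup fun j => u j * matT y j) (gauss _) (gauss _) := by
  refine measurePreserving_gauss (fun t => untup fun j => (u j)ᴴ * matT t j) ?_ ?_ ?_
  · exact (continuous_untup.comp (continuous_pi fun j =>
      continuous_const.matrix_mul ((continuous_apply j).comp continuous_matT))).measurable
  · intro t y
    rw [sum_inner_matT, sum_inner_matT]
    simp only [matT_untup, Matrix.conjTranspose_mul, Matrix.conjTranspose_conjTranspose,
      Matrix.mul_assoc]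
  · intro t
    rw [sum_norm_sq_matT, sum_norm_sq_matT]
    simp only [matT_untup, frob_unitary_mul (conjTranspose_mem_unitaryGroup (hu _))]

lemma sum_inner_mat1 (t y : Fin N × Fin N → ℂ) :
    ∑ p, inner ℝ (t p) (y p) = ((mat1 t)ᴴ * mat1 y).trace.re := by
  rw [Fintype.sum_prod_type, Matrix.trace, Complex.re_sum, Finset.sum_comm]
  refine Finset.sum_congr rfl fun b _ => ?_
  rw [Matrix.diag_apply, Matrix.mul_apply, Complex.re_sum]
  refine Finset.sum_congr rfl fun a _ => ?_
  simp [Complex.inner, mul_comm]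

lemma sum_norm_sq_mat1 (t : Fin N × Fin N → ℂ) : ∑ p, ‖t p‖ ^ 2 = frob (mat1 t) ^ 2 := by
  rw [Fintype.sum_prod_type, frob_sq_eq_sum]
  rfl

lemma measurePreserving_mul_unitary {V : Mat N} (hV : V ∈ Matrix.unitaryGroup (Fin N) ℂ) :
    MeasurePreserving (fun z (p : Fin N × Fin N) => (mat1 z * V) p.1 p.2) (gauss (Fin N × Fin N))
      (gauss (Fin N × Fin N)) := by
  refine measurePreserving_gauss (fun t p => (mat1 t * Vᴴ) p.1 p.2) ?_ ?_ ?_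
  · exact (continuous_pi fun p : Fin N × Fin N =>
      (continuous_mat1.matrix_mul continuous_const).matrix_elem p.1 p.2).measurable
  · intro t y
    rw [sum_inner_mat1, sum_inner_mat1]
    change ((mat1 t)ᴴ * (mat1 y * V)).trace.re = ((mat1 t * Vᴴ)ᴴ * mat1 y).trace.re
    rw [Matrix.conjTranspose_mul, Matrix.conjTranspose_conjTranspose, ← Matrix.mul_assoc,
      Matrix.trace_mul_comm, Matrix.mul_assoc]
  · intro t
    rw [sum_norm_sq_mat1, sum_norm_sq_mat1]
    change frob (mat1 t * Vᴴ) ^ 2 = _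
    rw [frob_mul_unitary (conjTranspose_mem_unitaryGroup hV)]

lemma measurePreserving_marginal (j : Fin n) :
    MeasurePreserving (fun (y : Fin n × Fin N × Fin N → ℂ) p => y (j, p)) (gauss _)
      (gauss (Fin N × Fin N)) := by
  refine measurePreserving_gauss (fun t p => if p.1 = j then t p.2 else 0) ?_ ?_ ?_
  · exact measurable_pi_lambda _ fun p => measurable_pi_apply _
  · intro t y
    rw [Fintype.sum_prod_type (f := fun p : Fin n × Fin N × Fin N => _),
      Finset.sum_eq_single j (fun i _ hi => by simp [hi]) (by simp)]
    simp
  · intro t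
    rw [Fintype.sum_prod_type (f := fun p : Fin n × Fin N × Fin N => _),
      Finset.sum_eq_single j (fun i _ hi => by simp [hi]) (by simp)]
    simp

/-! ### Integrability of the entries of the modulus -/

lemma norm_apply_le_frob (A : Mat N) (a b : Fin N) : ‖A a b‖ ≤ frob A :=
  PiLp.norm_apply_le (vecE A) (a, b)

lemma frob_mat1_le (z : Fin N × Fin N → ℂ) : frob (mat1 z) ≤ ∑ p, ‖z p‖ := by
  refine (frob_le_sum _).trans (le_of_eq ?_)
  rw [Fintype.sum_prod_type]
  rfl

lemma continuous_absM_mat1 : Continuous fun z : Fin N × Fin N → ℂ => absM (mat1 z) :=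
  continuous_absM.comp continuous_mat1

lemma integrable_absM_apply (a b : Fin N) :
    Integrable (fun z => absM (mat1 z) a b) (gauss (Fin N × Fin N)) := by
  refine integrable_gauss_of_le (continuous_absM_mat1.matrix_elem a b).aestronglyMeasurable 1 1
    fun z => ?_
  rw [one_mul, one_mul]
  refine ((norm_apply_le_frob _ a b).trans ?_).trans
    ((by linarith [Real.add_one_le_exp (∑ p, ‖z p‖)]) : ∑ p, ‖z p‖ ≤ Real.exp (∑ p, ‖z p‖))
  rw [frob_absM]
  exact frob_mat1_le z

lemma mul_self_le_two_mul_exp {x : ℝ} (hx : 0 ≤ x) : x * x ≤ 2 * Real.exp (1 * x) := by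
  have := Real.quadratic_le_exp_of_nonneg hx
  rw [one_mul]
  nlinarith

lemma integrable_absM_mul (a b c d : Fin N) :
    Integrable (fun z => absM (mat1 z) a b * absM (mat1 z) c d) (gauss (Fin N × Fin N)) := by
  refine integrable_gauss_of_le ((continuous_absM_mat1.matrix_elem a b).mul
    (continuous_absM_mat1.matrix_elem c d)).aestronglyMeasurable 2 1 fun z => ?_
  rw [norm_mul]
  have h0 : (0 : ℝ) ≤ ∑ p, ‖z p‖ := Finset.sum_nonneg fun _ _ => norm_nonneg _
  have h : ∀ a b, ‖absM (mat1 z) a b‖ ≤ ∑ p, ‖z p‖ := fun a b =>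
    (norm_apply_le_frob _ a b).trans (by rw [frob_absM]; exact frob_mat1_le z)
  exact (mul_le_mul (h a b) (h c d) (norm_nonneg _) h0).trans (mul_self_le_two_mul_exp h0)

/-! ### Entrywise integrals -/

/-- The entrywise integral of a matrix-valued function. -/
def intM {α : Type*} [MeasurableSpace α] (μ : Measure α) (F : α → Mat N) : Mat N :=
  Matrix.of fun a b => ∫ z, F z a b ∂μ

lemma intM_mul_mul {α : Type*} [MeasurableSpace α] {μ : Measure α} {F : α → Mat N}
    (hF : ∀ a b, Integrable (fun z => F z a b) μ) (A B : Mat N) :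
    intM μ (fun z => A * F z * B) = A * intM μ F * B := by
  ext a b
  simp only [intM, Matrix.of_apply, Matrix.mul_apply, Finset.sum_mul]
  rw [integral_finsetSum _ fun c _ => integrable_finsetSum _ fun d _ =>
    ((hF d c).const_mul _).mul_const _]
  refine Finset.sum_congr rfl fun c _ => ?_
  rw [integral_finsetSum _ fun d _ => ((hF d c).const_mul _).mul_const _]
  refine Finset.sum_congr rfl fun d _ => ?_
  rw [integral_mul_const, integral_const_mul]

/-- Z and ZV have the same law and |ZV| = V*|Z|V, so the law of |Z| is invariant under unitary
conjugation. Averages of |Z| therefore fall under the two commutant lemmas. -/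
lemma integral_absM_comp {V : Mat N} (hV : V ∈ Matrix.unitaryGroup (Fin N) ℂ) {F : Mat N → ℂ}
    (hF : Continuous F) :
    ∫ z, F (Vᴴ * absM (mat1 z) * V) ∂gauss (Fin N × Fin N)
      = ∫ z, F (absM (mat1 z)) ∂gauss (Fin N × Fin N) := by
  refine Eq.trans ?_ (integral_gauss_comp (measurePreserving_mul_unitary hV)
    (f := fun z => F (absM (mat1 z))) (hF.comp continuous_absM_mat1).aestronglyMeasurable)
  refine integral_congr_ae (.of_forall fun z => ?_)
  simp only
  rw [← absM_mul_unitary hV]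
  rfl

lemma exists_intM_absM : ∃ c : ℂ, intM (gauss _) (fun z => absM (mat1 z : Mat N)) = c • 1 := by
  refine exists_eq_scalar fun V hV => ?_
  rw [← intM_mul_mul integrable_absM_apply]
  ext a b
  have := integral_absM_comp (conjTranspose_mem_unitaryGroup hV) (F := fun M => M a b)
    (continuous_id.matrix_elem a b)
  rw [Matrix.conjTranspose_conjTranspose] at this
  exact this

lemma mul_mul_apply (A ξ B : Mat N) (a b : Fin N) :
    (A * ξ * B) a b = ∑ c, ∑ d, ξ d c * (A a d * B c b) := by
  simp only [Matrix.mul_apply, Finset.sum_mul]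
  exact Finset.sum_congr rfl fun c _ => Finset.sum_congr rfl fun d _ => by ring

lemma integrable_absM_mul_mul (ξ : Mat N) (a b : Fin N) :
    Integrable (fun z => (absM (mat1 z) * ξ * absM (mat1 z) : Mat N) a b) (gauss _) := by
  simp only [mul_mul_apply]
  exact integrable_finsetSum _ fun c _ => integrable_finsetSum _ fun d _ =>
    (integrable_absM_mul _ _ _ _).const_mul _

/-- The map `ξ ↦ E |Z| ξ |Z|`. -/
def absMap (N : ℕ) : Mat N →ₗ[ℂ] Mat N where
  toFun ξ := intM (gauss _) fun z => absM (mat1 z) * ξ * absM (mat1 z)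
  map_add' ξ η := by
    ext a b
    simp only [intM, Matrix.of_apply, Matrix.add_apply]
    rw [← integral_add (integrable_absM_mul_mul ξ a b) (integrable_absM_mul_mul η a b)]
    simp only [Matrix.mul_add, Matrix.add_mul, Matrix.add_apply]
  map_smul' r ξ := by
    ext a b
    simp only [intM, Matrix.of_apply, Matrix.smul_apply, RingHom.id_apply, smul_eq_mul]
    rw [← integral_const_mul]
    simp only [Matrix.mul_smul, Matrix.smul_mul, Matrix.smul_apply, smul_eq_mul]

lemma absMap_apply (ξ : Mat N) (a b : Fin N) :
    absMap N ξ a b = ∫ z, (absM (mat1 z) * ξ * absM (mat1 z) : Mat N) a b ∂gauss _ := rfl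

lemma absMap_conj {V : Mat N} (hV : V ∈ Matrix.unitaryGroup (Fin N) ℂ) (ξ : Mat N) :
    absMap N (V * ξ * Vᴴ) = V * absMap N ξ * Vᴴ := by
  have hVV : V * Vᴴ = 1 := Matrix.mem_unitaryGroup_iff.1 hV
  change _ = V * intM _ _ * Vᴴ
  rw [← intM_mul_mul (integrable_absM_mul_mul ξ)]
  ext a b
  rw [absMap_apply]
  have h := integral_absM_comp hV (F := fun M => (V * (M * ξ * M) * Vᴴ) a b)
    (((continuous_const.matrix_mul ((continuous_id.matrix_mul continuous_const).matrix_mul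
      continuous_id)).matrix_mul continuous_const).matrix_elem a b)
  change _ = ∫ z, (V * (absM (mat1 z) * ξ * absM (mat1 z)) * Vᴴ : Mat N) a b ∂gauss _
  rw [← h]
  refine integral_congr_ae (.of_forall fun z => ?_)
  simp only
  have : V * (Vᴴ * absM (mat1 z) * V * ξ * (Vᴴ * absM (mat1 z) * V)) * Vᴴ
      = (V * Vᴴ) * (absM (mat1 z) * (V * ξ * Vᴴ) * absM (mat1 z)) * (V * Vᴴ) := by
    simp only [Matrix.mul_assoc]
  rw [this, hVV, Matrix.one_mul, Matrix.mul_one]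

lemma absMap_one : absMap N 1 = (N : ℂ) • 1 := by
  ext a b
  rw [absMap_apply]
  have e : ∀ z : Fin N × Fin N → ℂ, (absM (mat1 z) * 1 * absM (mat1 z) : Mat N) a b
      = ∑ c, z (c, b) * conj (z (c, a)) := by
    intro z
    rw [Matrix.mul_one, absM_mul_self, Matrix.mul_apply]
    exact Finset.sum_congr rfl fun c _ => by simp [mul_comm]
  simp only [e]
  rw [integral_finsetSum _ fun c _ => integrable_gauss_mul_conj _ _]
  simp only [integral_gauss_mul_conj, Prod.mk.injEq, true_and, Finset.sum_const, Finset.card_univ,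
    Fintype.card_fin, Matrix.smul_apply, Matrix.one_apply, nsmul_eq_mul, smul_eq_mul, eq_comm]

/-- The left side is the trace of the superoperator; the trace of ξ ↦ H ξ H is (tr H)². -/
lemma sum_absMap_single :
    ∑ a, ∑ b, absMap N (Matrix.single a b 1) a b = ∫ z, (absM (mat1 z : Mat N)).trace ^ 2 ∂gauss _ := by
  have e : ∀ (z : Fin N × Fin N → ℂ) a b, (absM (mat1 z) * Matrix.single a b 1 * absM (mat1 z) : Mat N) a b
      = absM (mat1 z) a a * absM (mat1 z) b b := by
    intro z a b
    rw [mul_mul_apply, Finset.sum_eq_single b, Finset.sum_eq_single a]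
    · simp
    · intro c _ hc; simp [hc.symm]
    · simp
    · intro c _ hc; simp [hc.symm]
    · simp
  simp only [absMap_apply, e, sq, Matrix.trace, Matrix.diag_apply, Finset.sum_mul_sum]
  rw [integral_finsetSum _ fun c _ => integrable_finsetSum _ fun d _ => integrable_absM_mul _ _ _ _]
  refine Finset.sum_congr rfl fun a _ => ?_
  rw [integral_finsetSum _ fun d _ => integrable_absM_mul _ _ _ _]

/-! ### Lower bounds for the expectations -/

lemma integral_gauss_fourth {ι : Type*} [Fintype ι] [DecidableEq ι] (i j k l : ι) :
    Integrable (fun y => y i * y j * (conj (y k) * conj (y l))) (gauss ι) ∧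
    ∫ y, y i * y j * (conj (y k) * conj (y l)) ∂gauss ι
      = (if i = k ∧ j = l then 1 else 0) + (if i = l ∧ j = k then 1 else 0) := by
  have e : ∀ y : ι → ℂ, (∏ m, y m ^ (Pi.single i 1 + Pi.single j 1 : ι → ℕ) m) *
      ∏ m, conj (y m) ^ (Pi.single k 1 + Pi.single l 1 : ι → ℕ) m
        = y i * y j * (conj (y k) * conj (y l)) := by
    intro y
    simp only [Pi.add_apply, pow_add, Finset.prod_mul_distrib]
    rw [prod_pow_single, prod_pow_single, prod_pow_single (fun m => conj (y m)),
      prod_pow_single (fun m => conj (y m))]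
  have h1 := integrable_gauss_monomial (Pi.single i 1 + Pi.single j 1) (Pi.single k 1 + Pi.single l 1)
  have h2 := integral_gauss_monomial (Pi.single i 1 + Pi.single j 1) (Pi.single k 1 + Pi.single l 1)
  simp only [e] at h1 h2
  refine ⟨h1, h2.trans ?_⟩
  have hiff : (Pi.single i 1 + Pi.single j 1 : ι → ℕ) = Pi.single k 1 + Pi.single l 1 ↔
      (i = k ∧ j = l) ∨ (i = l ∧ j = k) := by
    constructor
    · intro h
      have hi := congrFun h i
      have hj := congrFun h j
      simp only [Pi.add_apply, Pi.single_apply] at hi hj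
      grind
    · rintro (⟨rfl, rfl⟩ | ⟨rfl, rfl⟩)
      · rfl
      · rw [add_comm]
  have hprod : ∏ m, ((Pi.single i 1 + Pi.single j 1 : ι → ℕ) m).factorial = if i = j then 2 else 1 := by
    split_ifs with hij
    · subst hij
      rw [Finset.prod_eq_single i (fun m _ hm => by simp [hm]) (by simp)]
      simp
    · refine Finset.prod_eq_one fun m _ => ?_
      simp only [Pi.add_apply, Pi.single_apply]
      by_cases hm : m = i
      · subst hm; simp [hij]
      · by_cases hm' : m = j <;> simp [hm, hm', Ne.symm hij]
  simp only [hiff]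
  rw [hprod]
  by_cases hij : i = j
  · subst hij
    by_cases hk : i = k <;> by_cases hl : i = l <;> simp [hk, hl] <;> grind
  · by_cases hk : i = k <;> by_cases hl : i = l <;> by_cases hk' : j = k <;>
      by_cases hl' : j = l <;> simp [hk, hl, hk', hl'] <;> grind

lemma gaussMoment_two : gaussMoment N 2 = 2 * (N : ℝ) ^ 3 := by
  have h := integral_trace_pow_eq (N := N) 2
  have e : ∀ z : Fin N × Fin N → ℂ, ((mat1 z * (mat1 z)ᴴ) ^ 2 : Mat N).trace
      = ∑ a, ∑ c, ∑ b, ∑ d, z (a, b) * z (c, d) * (conj (z (c, b)) * conj (z (a, d))) := by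
    intro z
    simp only [sq, Matrix.trace, Matrix.diag_apply, Matrix.mul_apply, Finset.sum_mul_sum,
      Matrix.conjTranspose_apply, mat1_apply]
    refine Finset.sum_congr rfl fun a _ => Finset.sum_congr rfl fun c _ =>
      Finset.sum_congr rfl fun b _ => Finset.sum_congr rfl fun d _ => ?_
    simp only [Complex.star_def]
    ring
  simp only [e] at h
  rw [integral_finsetSum _ fun a _ => integrable_finsetSum _ fun c _ => integrable_finsetSum _
    fun b _ => integrable_finsetSum _ fun d _ => (integral_gauss_fourth _ _ _ _).1] at h
  simp only [integral_finsetSum _ fun c _ => integrable_finsetSum _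
    fun b _ => integrable_finsetSum _ fun d _ => (integral_gauss_fourth _ _ _ _).1,
    integral_finsetSum _ fun b _ => integrable_finsetSum _ fun d _ =>
      (integral_gauss_fourth _ _ _ _).1,
    integral_finsetSum _ fun d _ => (integral_gauss_fourth _ _ _ _).1,
    (integral_gauss_fourth _ _ _ _).2, Prod.mk.injEq, and_true, true_and] at h
  have e1 : ∀ a c : Fin N, ((a = c ∧ c = a) ↔ a = c) := fun a c =>
    ⟨fun h => h.1, fun h => ⟨h, h.symm⟩⟩
  simp only [e1, Finset.sum_add_distrib, Finset.sum_const, Finset.sum_ite_eq, Finset.mem_univ,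
    if_true, Finset.card_univ, Fintype.card_fin, nsmul_eq_mul, smul_ite, smul_zero, mul_one] at h
  apply Complex.ofReal_injective
  rw [← h]
  push_cast
  ring

/-- A quartic lower bound for the trace of a positive semidefinite matrix. -/
lemma trace_ge_of_posSemidef {H : Mat N} (hH : H.PosSemidef) {t : ℝ} (ht : 0 < t) :
    3 / (2 * t) * (H * H).trace.re - 1 / (2 * t ^ 3) * ((H * H) ^ 2).trace.re ≤ H.trace.re := by
  have hs : ((H - (t : ℂ) • 1 : Mat N))ᴴ = H - (t : ℂ) • 1 := by
    rw [Matrix.conjTranspose_sub, hH.isHermitian.eq, Matrix.conjTranspose_smul,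
      Matrix.conjTranspose_one]
    simp
  have hHH : (H * H).PosSemidef := by
    have := Matrix.posSemidef_conjTranspose_mul_self H
    rwa [hH.isHermitian.eq] at this
  have h1 : (H * H + ((2 * t : ℝ) : ℂ) • H).PosSemidef :=
    hHH.add (hH.smul (by exact_mod_cast (by positivity : (0 : ℝ) ≤ 2 * t)))
  have h2 := h1.conjTranspose_mul_mul_same (H - (t : ℂ) • 1)
  have h3 := (Complex.le_def.1 h2.trace_nonneg).1
  rw [hs] at h3
  -- For a number s ≥ 0 this is (s - t)²(s² + 2ts) = s⁴ - 3t²s² + 2t³s ≥ 0. The factor s + 2t is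
  -- chosen to cancel the cubic term, so only even moments remain beside the linear one.
  have e : (H - (t : ℂ) • 1) * (H * H + ((2 * t : ℝ) : ℂ) • H) * (H - (t : ℂ) • 1)
      = (H * H) ^ 2 - ((3 * t ^ 2 : ℝ) : ℂ) • (H * H) + ((2 * t ^ 3 : ℝ) : ℂ) • H := by
    simp only [sq, Matrix.mul_add, Matrix.sub_mul, Matrix.mul_sub, Matrix.smul_mul,
      Matrix.mul_smul, Matrix.one_mul, Matrix.mul_one, Matrix.add_mul, smul_sub, smul_add,
      smul_smul, Matrix.mul_assoc]
    push_cast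
    module
  rw [e, Matrix.trace_add, Matrix.trace_sub, Matrix.trace_smul, Matrix.trace_smul, smul_eq_mul,
    smul_eq_mul, Complex.add_re, Complex.sub_re, Complex.re_ofReal_mul, Complex.re_ofReal_mul,
    Complex.zero_re] at h3
  have e2 : 3 / (2 * t) * (H * H).trace.re - 1 / (2 * t ^ 3) * ((H * H) ^ 2).trace.re
      = H.trace.re - 1 / (2 * t ^ 3) * (((H * H) ^ 2).trace.re - 3 * t ^ 2 * (H * H).trace.re
        + 2 * t ^ 3 * H.trace.re) := by
    field_simp
    ring
  rw [e2]
  have : 0 ≤ 1 / (2 * t ^ 3) * (((H * H) ^ 2).trace.re - 3 * t ^ 2 * (H * H).trace.re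
        + 2 * t ^ 3 * H.trace.re) := mul_nonneg (by positivity) h3
  linarith

lemma gaussMoment_one : gaussMoment N 1 = (N : ℝ) ^ 2 := by
  have h := integral_trace_pow_eq (N := N) 1
  have e : ∀ z : Fin N × Fin N → ℂ, ((mat1 z * (mat1 z)ᴴ) ^ 1 : Mat N).trace
      = ∑ a, ∑ c, z (a, c) * conj (z (a, c)) := by
    intro z
    rw [pow_one]
    rfl
  simp only [e] at h
  rw [integral_finsetSum _ fun a _ => integrable_finsetSum _ fun c _ =>
    integrable_gauss_mul_conj _ _] at h
  simp only [integral_finsetSum _ fun c _ => integrable_gauss_mul_conj _ _,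
    integral_gauss_mul_conj, if_true, Finset.sum_const, Finset.card_univ, Fintype.card_fin,
    nsmul_eq_mul, mul_one] at h
  apply Complex.ofReal_injective
  rw [← h]
  push_cast
  ring

lemma integrable_trace_absM :
    Integrable (fun z => (absM (mat1 z : Mat N)).trace) (gauss _) := by
  simp only [Matrix.trace, Matrix.diag_apply]
  exact integrable_finsetSum _ fun a _ => integrable_absM_apply a a

lemma trace_absM_mul_self_pow (A : Mat N) (k : ℕ) :
    ((absM A * absM A) ^ k).trace = ((A * Aᴴ) ^ k).trace := by
  rw [absM_mul_self]
  rcases k with _ | k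
  · simp
  · have h : (Aᴴ * A) ^ k * Aᴴ = Aᴴ * (A * Aᴴ) ^ k :=
      (SemiconjBy.pow_right (show Aᴴ * (A * Aᴴ) = Aᴴ * A * Aᴴ from
        (Matrix.mul_assoc _ _ _).symm) k).eq.symm
    rw [pow_succ, ← Matrix.mul_assoc, h, Matrix.mul_assoc, Matrix.trace_mul_comm,
      Matrix.mul_assoc, ← pow_succ]

lemma integral_trace_absM_ge (hN : 1 ≤ N) :
    N * Real.sqrt (N / 2) ≤ ∫ z, (absM (mat1 z : Mat N)).trace.re ∂gauss _ := by
  have hN' : (0 : ℝ) < N := by exact_mod_cast hN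
  -- With second and fourth moments N² and 2N³, the lower bound 3N²/(2t) - N³/t³ is maximal at t² =
  -- 2N.
  set t := Real.sqrt (2 * N) with ht
  have ht0 : 0 < t := Real.sqrt_pos.2 (by positivity)
  have ht2 : t ^ 2 = 2 * N := Real.sq_sqrt (by positivity)
  have i1 : Integrable (fun z => ((mat1 z * (mat1 z)ᴴ) ^ 1 : Mat N).trace.re) (gauss _) :=
    (integrable_trace_pow 1).re
  have i2 : Integrable (fun z => ((mat1 z * (mat1 z)ᴴ) ^ 2 : Mat N).trace.re) (gauss _) :=
    (integrable_trace_pow 2).re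
  have h : ∀ z : Fin N × Fin N → ℂ, 3 / (2 * t) * ((mat1 z * (mat1 z)ᴴ) ^ 1 : Mat N).trace.re
      - 1 / (2 * t ^ 3) * ((mat1 z * (mat1 z)ᴴ) ^ 2 : Mat N).trace.re
      ≤ (absM (mat1 z)).trace.re := by
    intro z
    have := trace_ge_of_posSemidef (absM_posSemidef (mat1 z)) ht0
    rw [← trace_absM_mul_self_pow, ← trace_absM_mul_self_pow, pow_one]
    exact this
  have h2 := integral_mono ((i1.const_mul _).sub (i2.const_mul _)) integrable_trace_absM.re h
  simp only [RCLike.re_eq_complex_re, Pi.sub_apply] at h2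
  rw [integral_sub (i1.const_mul _) (i2.const_mul _), integral_const_mul, integral_const_mul] at h2
  change 3 / (2 * t) * gaussMoment N 1 - 1 / (2 * t ^ 3) * gaussMoment N 2 ≤ _ at h2
  rw [gaussMoment_one, gaussMoment_two] at h2
  refine le_trans (le_of_eq ?_) h2
  have hs : Real.sqrt (N / 2) = t / 2 := by
    rw [Real.sqrt_eq_iff_mul_self_eq (by positivity) (by positivity)]
    nlinarith
  rw [hs]
  have hNt : (N : ℝ) = t ^ 2 / 2 := by linarith
  rw [hNt]
  field_simp
  ring

lemma exists_integral_absM (hN : 1 ≤ N) : ∃ c : ℝ, Real.sqrt (N / 2) ≤ c ∧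
    ∀ a b, ∫ z, absM (mat1 z : Mat N) a b ∂gauss _ = (c : ℂ) * (1 : Mat N) a b := by
  have hN' : (0 : ℝ) < N := by exact_mod_cast hN
  obtain ⟨c, hc⟩ := exists_intM_absM (N := N)
  have hent : ∀ a b, ∫ z, absM (mat1 z : Mat N) a b ∂gauss _ = c * (1 : Mat N) a b := fun a b =>
    congrFun (congrFun hc a) b
  have htr : ∫ z, (absM (mat1 z : Mat N)).trace ∂gauss _ = N * c := by
    simp only [Matrix.trace, Matrix.diag_apply]
    rw [integral_finsetSum _ fun a _ => integrable_absM_apply a a]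
    simp [hent]
  have hre : ∀ z : Fin N × Fin N → ℂ, (absM (mat1 z)).trace = ((absM (mat1 z)).trace.re : ℂ) := by
    intro z
    apply Complex.ext
    · simp
    · simpa using (Complex.le_def.1 (absM_posSemidef (mat1 z)).trace_nonneg).2.symm
  rw [integral_congr_ae (.of_forall hre), integral_complex_ofReal] at htr
  refine ⟨(∫ z, (absM (mat1 z : Mat N)).trace.re ∂gauss _) / N, ?_, ?_⟩
  · rw [le_div_iff₀ hN', mul_comm]
    exact integral_trace_absM_ge hN
  · intro a b
    rw [hent]
    congr 1
    push_cast
    rw [htr]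
    field_simp

/-- The commutant lemma leaves two unknowns. Evaluation at 1 gives β + bN = N and the trace of the
superoperator gives βN² + bN = E(tr|Z|)² = J, so β = (J - N)/(N² - 1). As J ≥ (E tr|Z|)² ≥ N³/2, the
claim β ≥ N/3 reduces to N² ≥ 4. -/
lemma exists_absMap_eq_smul (hN : 2 ≤ N) : ∃ β : ℝ, N / 3 ≤ β ∧
    ∀ ξ : Mat N, ξ.trace = 0 → absMap N ξ = (β : ℂ) • ξ := by
  have hN' : (2 : ℝ) ≤ N := by exact_mod_cast hN
  obtain ⟨β, b, h⟩ := exists_eq_smul_add_trace (absMap N) fun V hV ξ => absMap_conj hV ξ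
  set J := ∫ z, (absM (mat1 z : Mat N)).trace.re ^ 2 ∂gauss _ with hJ
  have hre : ∀ z : Fin N × Fin N → ℂ,
      (absM (mat1 z)).trace ^ 2 = (((absM (mat1 z)).trace.re ^ 2 : ℝ) : ℂ) := by
    intro z
    push_cast
    congr 1
    apply Complex.ext
    · simp
    · simpa using (Complex.le_def.1 (absM_posSemidef (mat1 z)).trace_nonneg).2.symm
  have isq : Integrable (fun z => (absM (mat1 z : Mat N)).trace ^ 2) (gauss _) := by
    simp only [sq, Matrix.trace, Matrix.diag_apply, Finset.sum_mul_sum]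
    exact integrable_finsetSum _ fun c _ => integrable_finsetSum _ fun d _ =>
      integrable_absM_mul _ _ _ _
  have isq' : Integrable (fun z => (absM (mat1 z : Mat N)).trace.re ^ 2) (gauss _) := by
    have := isq.re
    simpa [hre, ← Complex.ofReal_pow] using this
  have e1 : β + b * N = N := by
    have := congrFun (congrFun (h 1) ⟨0, by omega⟩) ⟨0, by omega⟩
    rw [absMap_one] at this
    simpa using this.symm
  have e2 : β * (N : ℂ) ^ 2 + b * N = J := by
    have := sum_absMap_single (N := N)
    rw [integral_congr_ae (.of_forall hre), integral_complex_ofReal] at this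
    rw [hJ, ← this]
    simp only [h, Matrix.add_apply, Matrix.smul_apply, Matrix.single_apply_same, smul_eq_mul,
      mul_one, Finset.sum_add_distrib, Finset.sum_const, Finset.card_univ, Fintype.card_fin,
      nsmul_eq_mul]
    have : ∀ a c : Fin N, b * (Matrix.single a c (1 : ℂ)).trace * (1 : Mat N) a c
        = if a = c then b else 0 := by
      intro a c
      by_cases hac : a = c
      · subst hac; simp
      · simp [hac]
    simp only [this, Finset.sum_ite_eq, Finset.mem_univ, if_true, Finset.sum_const,
      Finset.card_univ, Fintype.card_fin, nsmul_eq_mul]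
    ring
  have hNN : (0 : ℝ) < (N : ℝ) ^ 2 - 1 := by nlinarith
  have hβ : β = (((J - N) / ((N : ℝ) ^ 2 - 1) : ℝ) : ℂ) := by
    have h0 : (((N : ℝ) ^ 2 - 1 : ℝ) : ℂ) ≠ 0 := by exact_mod_cast hNN.ne'
    rw [Complex.ofReal_div, eq_div_iff h0]
    push_cast
    linear_combination e2 - e1
  have hJge : (N : ℝ) ^ 3 / 2 ≤ J := by
    have h1 := integral_trace_absM_ge (N := N) (by omega)
    set m := ∫ z, (absM (mat1 z : Mat N)).trace.re ∂gauss _ with hm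
    have h2 : 0 ≤ ∫ z, ((absM (mat1 z : Mat N)).trace.re - m) ^ 2 ∂gauss _ :=
      integral_nonneg fun z => sq_nonneg _
    have i1 := (integrable_trace_absM (N := N)).re
    simp only [RCLike.re_eq_complex_re] at i1
    have h3 : ∫ z, ((absM (mat1 z : Mat N)).trace.re - m) ^ 2 ∂gauss _ = J - m ^ 2 := by
      have : ∀ z : Fin N × Fin N → ℂ, ((absM (mat1 z : Mat N)).trace.re - m) ^ 2
          = (absM (mat1 z : Mat N)).trace.re ^ 2 - (2 * m) * (absM (mat1 z : Mat N)).trace.re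
            + m ^ 2 := fun z => by ring
      simp only [this]
      rw [integral_add (f := fun z => (absM (mat1 z : Mat N)).trace.re ^ 2 -
        (2 * m) * (absM (mat1 z : Mat N)).trace.re) (isq'.sub (i1.const_mul _)) (integrable_const _),
        integral_sub isq' (i1.const_mul _), integral_const_mul, ← hm, ← hJ]
      simp
      ring
    have h4 : (N * Real.sqrt (N / 2)) ^ 2 ≤ m ^ 2 := pow_le_pow_left₀ (by positivity) h1 2
    rw [mul_pow, Real.sq_sqrt (by positivity)] at h4
    linarith
  refine ⟨(J - N) / ((N : ℝ) ^ 2 - 1), ?_, fun ξ hξ => ?_⟩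
  · rw [le_div_iff₀ hNN]
    nlinarith [mul_nonneg (by linarith : (0 : ℝ) ≤ N) (by nlinarith : (0 : ℝ) ≤ (N : ℝ) ^ 2 - 4)]
  · rw [h ξ, hξ, ← hβ]
    simp

end QExp
end

/-! ### Transfer from Gaussian to Haar unitary tuples. -/

noncomputable section

namespace QExp

open MeasureTheory Complex ComplexConjugate Module

variable {n N : ℕ}

/-! ### The Haar measure on tuples of unitary matrices -/

instance : SecondCountableTopology (Mat N) :=
  inferInstanceAs (SecondCountableTopology (Fin N → Fin N → ℂ))

lemma isCompact_unitaryGroup : IsCompact (Matrix.unitaryGroup (Fin N) ℂ : Set (Mat N)) := by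
  have h1 : IsCompact {M : Fin N → Fin N → ℂ | ∀ a, M a ∈ {r : Fin N → ℂ | ∀ b,
      r b ∈ Metric.closedBall (0 : ℂ) 1}} :=
    isCompact_pi_infinite fun _ => isCompact_pi_infinite fun _ => isCompact_closedBall 0 1
  refine IsCompact.of_isClosed_subset (X := Mat N) h1 isClosed_unitary fun M hM a b => ?_
  rw [mem_closedBall_zero_iff]
  exact entry_norm_bound_of_unitary hM a b

instance : CompactSpace (Matrix.unitaryGroup (Fin N) ℂ) :=
  isCompact_iff_compactSpace.1 isCompact_unitaryGroup

instance : SecondCountableTopology (Matrix.unitaryGroup (Fin N) ℂ) :=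
  inferInstanceAs (SecondCountableTopology (Matrix.unitaryGroup (Fin N) ℂ : Set (Mat N)))

instance : MeasurableSpace (Matrix.unitaryGroup (Fin N) ℂ) := borel _

instance : BorelSpace (Matrix.unitaryGroup (Fin N) ℂ) := ⟨rfl⟩

/-- The compact group `U(N)^n`. -/
abbrev UG (n N : ℕ) : Type := Fin n → Matrix.unitaryGroup (Fin N) ℂ

/-- The tuple of matrices underlying an element of `U(N)^n`. -/
def toTuple (u : UG n N) : Tuple n N := fun j => (u j : Mat N)

lemma toTuple_mem (u : UG n N) : toTuple u ∈ unitaryTuples n N := fun j => (u j).2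

lemma continuous_toTuple : Continuous (toTuple : UG n N → Tuple n N) :=
  continuous_pi fun j => continuous_subtype_val.comp (continuous_apply j)

/-- The right invariant probability measure on `U(N)^n`. -/
def haarU (n N : ℕ) : Measure (UG n N) := (Measure.haarMeasure ⊤).inv

instance : IsProbabilityMeasure (haarU n N) := by
  constructor
  rw [haarU, Measure.inv_apply, Set.inv_univ]
  exact Measure.haarMeasure_self (K₀ := (⊤ : TopologicalSpace.PositiveCompacts (UG n N)))

instance : (haarU n N).IsMulRightInvariant := by unfold haarU; infer_instance

lemma integrable_haarU {E : Type*} [NormedAddCommGroup E] {f : UG n N → E} (hf : Continuous f) :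
    Integrable f (haarU n N) :=
  hf.integrable_of_hasCompactSupport (HasCompactSupport.of_compactSpace f)

/-! ### Comparison with Gaussian matrices -/

/-- The tuple `u |Y|`. -/
def mulAbs (x : Tuple n N) (y : Fin n × Fin N × Fin N → ℂ) : Tuple n N :=
  fun j => x j * absM (matT y j)

lemma continuous_mulAbs :
    Continuous fun p : Tuple n N × (Fin n × Fin N × Fin N → ℂ) => mulAbs p.1 p.2 :=
  continuous_pi fun j => ((continuous_apply j).comp continuous_fst).matrix_mul
    (continuous_absM.comp ((continuous_apply j).comp (continuous_matT.comp continuous_snd)))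

lemma frob_mulAbs {x : Tuple n N} (hx : x ∈ unitaryTuples n N)
    (y : Fin n × Fin N × Fin N → ℂ) (j : Fin n) : frob (mulAbs x y j) = frob (matT y j) := by
  rw [mulAbs, frob_unitary_mul (hx j), frob_absM]

lemma integrable_prod_of_growth {F : Tuple n N → ℝ} {C a : ℝ} (ha : 0 ≤ a) (hC : 0 ≤ C)
    (hb : ∀ x, ‖F x‖ ≤ C * Real.exp (a * ∑ j, frob (x j)))
    {g : UG n N → (Fin n × Fin N × Fin N → ℂ) → Tuple n N}
    (hF : Continuous F) (hg : Continuous (Function.uncurry g))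
    (hgf : ∀ u y j, frob (g u y j) = frob (matT y j)) :
    Integrable (Function.uncurry fun u y => F (g u y)) ((haarU n N).prod (gauss _)) := by
  have h1 := ((integrable_gauss_exp (ι := Fin n × Fin N × Fin N) a).const_mul C).comp_snd
    (haarU n N)
  refine h1.mono' (hF.comp hg).aestronglyMeasurable (.of_forall fun p => ?_)
  refine (hb _).trans ?_
  simp only [hgf]
  exact mul_le_mul_of_nonneg_left (Real.exp_le_exp.2
    (mul_le_mul_of_nonneg_left (sum_frob_matT_le p.2) ha)) hC

/-- For Haar u independent of Y, the tuples u|Y| and Y have the same law: right invariance absorbs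
the polar part of Y, turning u|Y| into uY, and the Gaussian law is unitarily invariant. The growth
condition serves Fubini's theorem. -/
lemma integral_haarU_mulAbs {F : Tuple n N → ℝ} {C a : ℝ} (ha : 0 ≤ a) (hC : 0 ≤ C)
    (hb : ∀ x, ‖F x‖ ≤ C * Real.exp (a * ∑ j, frob (x j))) (hF : Continuous F) :
    Integrable (fun u => ∫ y, F (mulAbs (toTuple u) y) ∂gauss _) (haarU n N) ∧
    ∫ u, ∫ y, F (mulAbs (toTuple u) y) ∂gauss _ ∂haarU n N = ∫ y, F (matT y) ∂gauss _ := by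
  have i1 : Integrable (Function.uncurry fun u y => F (mulAbs (toTuple u) y))
      ((haarU n N).prod (gauss _)) :=
    integrable_prod_of_growth ha hC hb hF (g := fun u y => mulAbs (toTuple u) y)
      (continuous_mulAbs.comp ((continuous_toTuple.comp continuous_fst).prodMk continuous_snd))
      fun u y j => frob_mulAbs (toTuple_mem u) y j
  have i2 : Integrable (Function.uncurry fun u y => F fun j => toTuple u j * matT y j)
      ((haarU n N).prod (gauss _)) :=
    integrable_prod_of_growth ha hC hb hF (g := fun u y j => toTuple u j * matT y j)
      (continuous_pi fun j => ((continuous_apply j).comp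
        (continuous_toTuple.comp continuous_fst)).matrix_mul
        ((continuous_apply j).comp (continuous_matT.comp continuous_snd)))
      fun u y j => frob_unitary_mul (toTuple_mem u j) _
  refine ⟨i1.integral_prod_left, ?_⟩
  rw [integral_integral_swap i1]
  have e : ∀ y : Fin n × Fin N × Fin N → ℂ, ∫ u, F (mulAbs (toTuple u) y) ∂haarU n N
      = ∫ u, F (fun j => toTuple u j * matT y j) ∂haarU n N := by
    intro y
    -- The polar part is chosen separately for each fixed y, inside the integral over u, so its
    -- measurability in y plays no role.
    choose W hW hWe using fun j => exists_polar (matT y j)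
    let w : UG n N := fun j => ⟨W j, hW j⟩
    rw [← integral_mul_right_eq_self (fun u => F (mulAbs (toTuple u) y)) w]
    refine integral_congr_ae (.of_forall fun u => ?_)
    simp only
    congr 1
    funext j
    conv_rhs => rw [hWe j]
    rw [← Matrix.mul_assoc]
    rfl
  simp only [e]
  rw [← integral_integral_swap i2]
  have e2 : ∀ u : UG n N, ∫ y, F (fun j => toTuple u j * matT y j) ∂gauss _
      = ∫ y, F (matT y) ∂gauss _ := fun u =>
    integral_gauss_comp (measurePreserving_unitary_mul (toTuple_mem u))
      (f := fun y => F (matT y)) (hF.comp continuous_matT).aestronglyMeasurable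
  simp only [e2]
  simp

lemma integral_absM_matT {F : Mat N → ℂ} (hF : Continuous F) (j : Fin n) :
    ∫ y : Fin n × Fin N × Fin N → ℂ, F (absM (matT y j)) ∂gauss _
      = ∫ z, F (absM (mat1 z)) ∂gauss _ :=
  integral_gauss_comp (measurePreserving_marginal j) (f := fun z => F (absM (mat1 z)))
    (hF.comp continuous_absM_mat1).aestronglyMeasurable

lemma integrable_absM_matT {F : Mat N → ℂ} (j : Fin n)
    (h : Integrable (fun z => F (absM (mat1 z))) (gauss _)) :
    Integrable (fun y : Fin n × Fin N × Fin N → ℂ => F (absM (matT y j))) (gauss _) :=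
  (measurePreserving_marginal j).integrable_comp_of_integrable h

lemma integrable_tracelessOp_mulAbs {u : Tuple n N} (hu : u ∈ unitaryTuples n N) :
    Integrable (fun y => tracelessOp (mulAbs u y)) (gauss _) := by
  refine integrable_gauss_of_le (continuous_tracelessOp.comp (continuous_mulAbs.comp
    (continuous_const.prodMk continuous_id))).aestronglyMeasurable 2 1 fun y => ?_
  refine (norm_tracelessOp_le _).trans ?_
  simp only [frob_mulAbs hu]
  exact sum_frob_matT_sq_le y

/-- With u fixed, averaging over |Y| replaces each |Y_j| ξ |Y_j| by βξ. This is the conditional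
expectation to which the triangle inequality is applied below. -/
lemma integral_tracelessOp_mulAbs {u : Tuple n N} (hu : u ∈ unitaryTuples n N) {β : ℝ}
    (hβ : ∀ ξ : Mat N, ξ.trace = 0 → absMap N ξ = (β : ℂ) • ξ) :
    ∫ y, tracelessOp (mulAbs u y) ∂gauss _ = (β : ℂ) • tracelessOp u := by
  ext v p
  rw [ContinuousLinearMap.integral_apply (integrable_tracelessOp_mulAbs hu)]
  have hi : Integrable (fun y => tracelessOp (mulAbs u y) v) (gauss _) :=
    (integrable_tracelessOp_mulAbs hu).apply_continuousLinearMap v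
  have h := (EuclideanSpace.proj p : EuclideanSpace ℂ (Fin N × Fin N) →L[ℂ] ℂ).integral_comp_comm hi
  simp only [PiLp.proj_apply] at h
  rw [← h]
  set ξ := unvecE (traceless N v) with hξ
  have hξ0 : ξ.trace = 0 := trace_traceless v
  have e : ∀ y : Fin n × Fin N × Fin N → ℂ, (tracelessOp (mulAbs u y) v) p
      = ∑ j, (u j * (absM (matT y j) * ξ * absM (matT y j)) * (u j)ᴴ) p.1 p.2 := by
    intro y
    rw [tracelessOp_apply, vecE_apply, Matrix.sum_apply]
    refine Finset.sum_congr rfl fun j _ => ?_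
    rw [mulAbs, Matrix.conjTranspose_mul, absM_conjTranspose]
    simp only [Matrix.mul_assoc, hξ]
  simp only [e]
  have hint : ∀ j : Fin n, Integrable (fun z =>
      (u j * (absM (mat1 z) * ξ * absM (mat1 z)) * (u j)ᴴ : Mat N) p.1 p.2) (gauss _) := by
    intro j
    simp only [mul_mul_apply (u j)]
    exact integrable_finsetSum _ fun c _ => integrable_finsetSum _ fun d _ =>
      (integrable_absM_mul_mul ξ d c).mul_const _
  rw [integral_finsetSum _ fun j _ => integrable_absM_matT
    (F := fun M => (u j * (M * ξ * M) * (u j)ᴴ : Mat N) p.1 p.2) j (hint j)]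
  have e2 : ∀ j : Fin n, ∫ y : Fin n × Fin N × Fin N → ℂ,
      (u j * (absM (matT y j) * ξ * absM (matT y j)) * (u j)ᴴ) p.1 p.2 ∂gauss _
      = (β : ℂ) * (u j * ξ * (u j)ᴴ) p.1 p.2 := by
    intro j
    rw [integral_absM_matT (F := fun M => (u j * (M * ξ * M) * (u j)ᴴ : Mat N) p.1 p.2)
      (((continuous_const.matrix_mul ((continuous_id.matrix_mul continuous_const).matrix_mul
      continuous_id)).matrix_mul continuous_const).matrix_elem _ _) j]
    have := intM_mul_mul (integrable_absM_mul_mul ξ) (u j) (u j)ᴴ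
    change _ = u j * absMap N ξ * (u j)ᴴ at this
    rw [hβ ξ hξ0, Matrix.mul_smul, Matrix.smul_mul] at this
    exact congrFun (congrFun this p.1) p.2
  simp only [e2]
  rw [← Finset.mul_sum, _root_.smul_apply, PiLp.smul_apply, tracelessOp_apply,
    vecE_apply, Matrix.sum_apply, smul_eq_mul]

/-- The average over the unitary group of the norm of the operator on matrices of trace zero. -/
lemma integral_haarU_norm_tracelessOp_le (hn : 0 < n) (hN : 2 ≤ N) :
    ∫ u, ‖tracelessOp (toTuple u)‖ ∂haarU n N ≤ 19200 * Real.sqrt n := by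
  have hN' : (2 : ℝ) ≤ N := by exact_mod_cast hN
  obtain ⟨β, hβN, hβ⟩ := exists_absMap_eq_smul hN
  have hβ0 : 0 ≤ β := le_trans (by positivity) hβN
  have hF : Continuous fun x : Tuple n N => ‖tracelessOp x‖ := continuous_tracelessOp.norm
  have hb : ∀ x : Tuple n N, ‖‖tracelessOp x‖‖ ≤ 2 * Real.exp (1 * ∑ j, frob (x j)) := by
    intro x
    rw [norm_norm]
    refine (norm_tracelessOp_le x).trans ?_
    refine le_trans ?_ (mul_self_le_two_mul_exp (Finset.sum_nonneg fun j _ => frob_nonneg (x j)))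
    have := Finset.sum_sq_le_sq_sum_of_nonneg (s := Finset.univ) (f := fun j => frob (x j))
      fun j _ => frob_nonneg _
    simpa only [sq] using this
  obtain ⟨h1, h2⟩ := integral_haarU_mulAbs zero_le_one zero_le_two hb hF
  have h3 : ∫ u, β * ‖tracelessOp (toTuple u)‖ ∂haarU n N ≤ 6400 * N * Real.sqrt n := by
    refine le_trans ?_ (h2.trans_le (integral_norm_tracelessOp_le hn (by omega)))
    refine integral_mono ((integrable_haarU (hF.comp continuous_toTuple)).const_mul β) h1 fun u => ?_
    have := norm_integral_le_integral_norm (μ := gauss _) fun y => tracelessOp (mulAbs (toTuple u) y)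
    rwa [integral_tracelessOp_mulAbs (toTuple_mem u) hβ, norm_smul, Complex.norm_real,
      Real.norm_of_nonneg hβ0] at this
  rw [integral_const_mul] at h3
  have h4 : 0 ≤ ∫ u, ‖tracelessOp (toTuple u)‖ ∂haarU n N := integral_nonneg fun u => norm_nonneg _
  have h5 := (mul_le_mul_of_nonneg_right hβN h4).trans h3
  have : (N : ℝ) / 3 * (∫ u, ‖tracelessOp (toTuple u)‖ ∂haarU n N)
      ≤ N / 3 * (19200 * Real.sqrt n) := by linarith
  exact le_of_mul_le_mul_left this (by positivity)

lemma integral_gauss_exp_trace (A : Tuple n N) :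
    ∫ y, Real.exp (∑ j, (matT y j * A j).trace.re) ∂gauss _
      = Real.exp ((∑ j, frob (A j) ^ 2) / 4) := by
  have h := integral_gauss_exp (untup fun j => (A j)ᴴ)
  simp only [sum_inner_matT, sum_norm_sq_matT, matT_untup, Matrix.conjTranspose_conjTranspose,
    frob_conjTranspose] at h
  rw [← h]
  simp only [Matrix.trace_mul_comm (A _)]

lemma integral_trace_mulAbs {c : ℝ}
    (hc : ∀ a b, ∫ z, absM (mat1 z : Mat N) a b ∂gauss _ = (c : ℂ) * (1 : Mat N) a b)
    (u A : Tuple n N) :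
    Integrable (fun y => ∑ j, (mulAbs u y j * A j).trace.re) (gauss _) ∧
    ∫ y, ∑ j, (mulAbs u y j * A j).trace.re ∂gauss _ = c * ∑ j, (u j * A j).trace.re := by
  have e : ∀ j (M : Mat N), (u j * M * A j).trace = ∑ a, ∑ b, (A j * u j) b a * M a b := by
    intro j M
    rw [Matrix.mul_assoc, Matrix.trace_mul_comm, Matrix.mul_assoc, Matrix.trace]
    refine Finset.sum_congr rfl fun a _ => ?_
    rw [Matrix.diag_apply, Matrix.mul_apply]
    exact Finset.sum_congr rfl fun b _ => mul_comm _ _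
  have hint : ∀ j : Fin n, Integrable (fun z => (u j * absM (mat1 z) * A j).trace) (gauss _) := by
    intro j
    simp only [e]
    exact integrable_finsetSum _ fun a _ => integrable_finsetSum _ fun b _ =>
      (integrable_absM_apply a b).const_mul _
  have hint' : ∀ j : Fin n, Integrable (fun y => (mulAbs u y j * A j).trace) (gauss _) := fun j =>
    integrable_absM_matT (F := fun M => (u j * M * A j).trace) j (hint j)
  have hval : ∀ j : Fin n, ∫ y, (mulAbs u y j * A j).trace ∂gauss _ = c * (u j * A j).trace := by
    intro j
    refine (integral_absM_matT (F := fun M => (u j * M * A j).trace)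
      ((continuous_const.matrix_mul continuous_id).matrix_mul continuous_const).matrix_trace
      j).trans ?_
    simp only [e]
    rw [integral_finsetSum _ fun a _ => integrable_finsetSum _ fun b _ =>
      (integrable_absM_apply a b).const_mul _]
    simp only [integral_finsetSum _ fun b _ => (integrable_absM_apply _ b).const_mul _,
      integral_const_mul, hc]
    have := e j 1
    rw [Matrix.mul_one] at this
    rw [this, Finset.mul_sum]
    refine Finset.sum_congr rfl fun a _ => ?_
    rw [Finset.mul_sum]
    exact Finset.sum_congr rfl fun b _ => by ring
  have hre : ∀ j : Fin n, Integrable (fun y => (mulAbs u y j * A j).trace.re) (gauss _) :=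
    fun j => (hint' j).re
  refine ⟨integrable_finsetSum _ fun j _ => hre j, ?_⟩
  rw [integral_finsetSum _ fun j _ => hre j, Finset.mul_sum]
  refine Finset.sum_congr rfl fun j _ => ?_
  have := integral_re (hint' j)
  simp only [RCLike.re_eq_complex_re] at this
  rw [this, hval, Complex.re_ofReal_mul]

lemma abs_sum_trace_le (x A : Tuple n N) :
    |∑ j, (x j * A j).trace.re| ≤ (∑ j, frob (A j)) * ∑ j, frob (x j) := by
  refine (Finset.abs_sum_le_sum_abs _ _).trans ?_
  rw [Finset.mul_sum]
  refine Finset.sum_le_sum fun j _ => ?_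
  refine ((Complex.abs_re_le_norm _).trans (norm_trace_mul_le _ _)).trans ?_
  rw [mul_comm]
  exact mul_le_mul_of_nonneg_right (Finset.single_le_sum (f := fun j => frob (A j))
    (fun j _ => frob_nonneg _) (Finset.mem_univ j)) (frob_nonneg _)

/-- Subgaussian bound for linear functionals of Haar distributed unitary matrices. -/
lemma integral_haarU_exp_le (hN : 1 ≤ N) (A : Tuple n N) :
    ∫ u, Real.exp (∑ j, (toTuple u j * A j).trace.re) ∂haarU n N
      ≤ Real.exp ((∑ j, frob (A j) ^ 2) / (2 * N)) := by
  have hN' : (0 : ℝ) < N := by exact_mod_cast hN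
  obtain ⟨c, hcN, hc⟩ := exists_integral_absM hN
  have hc0 : 0 < c := lt_of_lt_of_le (Real.sqrt_pos.2 (by positivity)) hcN
  -- Division by c makes the average over |Y| of the functional at u|Y| equal to ∑ Re tr(u_j A_j).
  set B : Tuple n N := fun j => ((c⁻¹ : ℝ) : ℂ) • A j with hB
  have hBtr : ∀ x : Tuple n N, c * ∑ j, (x j * B j).trace.re = ∑ j, (x j * A j).trace.re := by
    intro x
    rw [Finset.mul_sum]
    refine Finset.sum_congr rfl fun j _ => ?_
    rw [hB]
    simp only
    rw [Matrix.mul_smul, Matrix.trace_smul, smul_eq_mul, Complex.re_ofReal_mul,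
      mul_inv_cancel_left₀ hc0.ne']
  have hF : Continuous fun x : Tuple n N => Real.exp (∑ j, (x j * B j).trace.re) :=
    Real.continuous_exp.comp (continuous_finsetSum _ fun j _ => Complex.continuous_re.comp
      ((continuous_apply j).matrix_mul continuous_const).matrix_trace)
  have hb : ∀ x : Tuple n N, ‖Real.exp (∑ j, (x j * B j).trace.re)‖
      ≤ 1 * Real.exp ((∑ j, frob (B j)) * ∑ j, frob (x j)) := by
    intro x
    rw [one_mul, Real.norm_of_nonneg (Real.exp_nonneg _)]
    exact Real.exp_le_exp.2 ((le_abs_self _).trans (abs_sum_trace_le x B))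
  obtain ⟨h1, h2⟩ := integral_haarU_mulAbs (Finset.sum_nonneg fun j _ => frob_nonneg (B j))
    zero_le_one hb hF
  rw [integral_gauss_exp_trace] at h2
  have h3 : ∫ u, Real.exp (∑ j, (toTuple u j * A j).trace.re) ∂haarU n N
      ≤ Real.exp ((∑ j, frob (B j) ^ 2) / 4) := by
    rw [← h2]
    refine integral_mono (integrable_haarU (Real.continuous_exp.comp (continuous_finsetSum _
      fun j _ => Complex.continuous_re.comp (((continuous_apply j).comp
        continuous_toTuple).matrix_mul continuous_const).matrix_trace))) h1 fun u => ?_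
    obtain ⟨i1, i2⟩ := integral_trace_mulAbs hc (toTuple u) B
    rw [hBtr] at i2
    set m := ∑ j, (toTuple u j * A j).trace.re with hm
    have iexp : Integrable (fun y => Real.exp (∑ j, (mulAbs (toTuple u) y j * B j).trace.re))
        (gauss _) := by
      refine integrable_gauss_of_le (hF.comp (continuous_mulAbs.comp
        (continuous_const.prodMk continuous_id))).aestronglyMeasurable 1 (∑ j, frob (B j))
        fun y => ?_
      refine (hb _).trans ?_
      simp only [frob_mulAbs (toTuple_mem u)]
      rw [one_mul, one_mul]
      exact Real.exp_le_exp.2 (mul_le_mul_of_nonneg_left (sum_frob_matT_le y)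
        (Finset.sum_nonneg fun j _ => frob_nonneg (B j)))
    -- Jensen's inequality by hand: the tangent line of exp at the mean m lies below the graph.
    have h4 : ∀ y, Real.exp m * ((∑ j, (mulAbs (toTuple u) y j * B j).trace.re) + (1 - m))
        ≤ Real.exp (∑ j, (mulAbs (toTuple u) y j * B j).trace.re) := by
      intro y
      set X := ∑ j, (mulAbs (toTuple u) y j * B j).trace.re
      have h5 := Real.add_one_le_exp (X - m)
      have h6 : Real.exp X = Real.exp m * Real.exp (X - m) := by
        rw [← Real.exp_add, add_sub_cancel]
      rw [h6]
      exact mul_le_mul_of_nonneg_left (by linarith) (Real.exp_nonneg _)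
    have h5 := integral_mono ((i1.add (integrable_const (1 - m))).const_mul (Real.exp m)) iexp h4
    simp only [Pi.add_apply] at h5
    rw [integral_const_mul, integral_add i1 (integrable_const _), i2] at h5
    simpa using h5
  refine h3.trans (Real.exp_le_exp.2 ?_)
  have hc2 : (N : ℝ) / 2 ≤ c ^ 2 := by
    have := pow_le_pow_left₀ (Real.sqrt_nonneg _) hcN 2
    rwa [Real.sq_sqrt (by positivity)] at this
  have h7 : ∑ j, frob (B j) ^ 2 = (c ^ 2)⁻¹ * ∑ j, frob (A j) ^ 2 := by
    rw [Finset.mul_sum]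
    refine Finset.sum_congr rfl fun j _ => ?_
    rw [hB]
    simp only
    rw [frob_smul, Complex.norm_real, mul_pow, Real.norm_of_nonneg (by positivity), inv_pow]
  rw [h7]
  have h8 : (c ^ 2)⁻¹ ≤ 2 / N := by
    rw [inv_le_comm₀ (by positivity) (by positivity), inv_div]
    exact hc2
  have h9 : 0 ≤ ∑ j, frob (A j) ^ 2 := Finset.sum_nonneg fun j _ => sq_nonneg _
  calc (c ^ 2)⁻¹ * (∑ j, frob (A j) ^ 2) / 4 ≤ 2 / N * (∑ j, frob (A j) ^ 2) / 4 := by gcongr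
    _ = _ := by field_simp; ring

end QExp
end

/-! ### Expanders detect only the flat part of a test matrix. -/

noncomputable section

namespace QExp

open MeasureTheory Complex ComplexConjugate Module

variable {n N : ℕ}

/-! ### Bilinear estimates for quantum expanders -/

lemma frob_sum_le_of_expander (hN : 1 ≤ N) {ε : ℝ} {u : Tuple n N} (hu : u ∈ expanders ε n N)
    {ξ : Mat N} (hξ : ξ.trace = 0) : frob (∑ j, u j * ξ * (u j)ᴴ) ≤ ε * n * frob ξ := by
  have hN' : (0 : ℝ) < N := by exact_mod_cast hN
  have h := hu.2 ξ hξ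
  rw [hNorm_eq, hNorm_eq, mul_left_comm] at h
  exact le_of_mul_le_mul_left h (Real.sqrt_pos.2 (inv_pos.2 hN'))

lemma expanders_of_norm_le {ε : ℝ} {u : Tuple n N} (hu : u ∈ unitaryTuples n N)
    (h : ‖tracelessOp u‖ ≤ ε * n) : u ∈ expanders ε n N := by
  refine ⟨hu, fun ξ hξ => ?_⟩
  rw [hNorm_eq, hNorm_eq, mul_left_comm]
  refine mul_le_mul_of_nonneg_left ?_ (Real.sqrt_nonneg _)
  have h1 := (tracelessOp u).le_of_opNorm_le h (vecE ξ)
  rwa [tracelessOp, ContinuousLinearMap.comp_apply, traceless_vecE hξ, tensorOp_vecE] at h1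

lemma expanders_mono {ε ε' : ℝ} (h : ε' ≤ ε) : expanders ε' n N ⊆ expanders ε n N := by
  refine fun u hu => ⟨hu.1, fun ξ hξ => (hu.2 ξ hξ).trans ?_⟩
  exact mul_le_mul_of_nonneg_right (mul_le_mul_of_nonneg_right h n.cast_nonneg) (Real.sqrt_nonneg _)

lemma exists_traceless_add (hN : 1 ≤ N) (A : Mat N) : ∃ A₀ : Mat N,
    A = (A.trace / N) • 1 + A₀ ∧ A₀.trace = 0 ∧ frob A₀ ≤ frob A := by
  have hN' : (N : ℂ) ≠ 0 := by exact_mod_cast (by omega : N ≠ 0)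
  refine ⟨A - (A.trace / N) • 1, by abel, ?_, ?_⟩
  · rw [Matrix.trace_sub, Matrix.trace_smul, Matrix.trace_one, Fintype.card_fin, smul_eq_mul,
      div_mul_cancel₀ _ hN', sub_self]
  · set A₀ := A - (A.trace / N) • 1 with hA
    have h0 : A₀.trace = 0 := by
      rw [hA, Matrix.trace_sub, Matrix.trace_smul, Matrix.trace_one, Fintype.card_fin,
        smul_eq_mul, div_mul_cancel₀ _ hN', sub_self]
    have h1 : frob A₀ ^ 2 ≤ frob A₀ * frob A := by
      have e : A₀ᴴ * A₀ = A₀ᴴ * A - (A.trace / N) • A₀ᴴ := by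
        nth_rewrite 2 [hA]
        rw [Matrix.mul_sub, Matrix.mul_smul, Matrix.mul_one]
      rw [frob_sq, e, Matrix.trace_sub, Matrix.trace_smul, Matrix.trace_conjTranspose, h0]
      simp only [star_zero, smul_zero, sub_zero]
      refine (Complex.re_le_norm _).trans ((norm_trace_mul_le _ _).trans ?_)
      rw [frob_conjTranspose]
    rcases (frob_nonneg A₀).eq_or_lt with h | h
    · rw [← h]; exact frob_nonneg A
    · rw [sq] at h1
      exact le_of_mul_le_mul_left h1 h

/-- The scalar part of A contributes exactly n tr(A) tr(B) / N; the traceless part is contracted by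
the spectral gap. This is an expander mixing lemma. -/
lemma norm_sum_trace_le_of_expander (hN : 1 ≤ N) {ε : ℝ} (hε : 0 ≤ ε) {u : Tuple n N}
    (hu : u ∈ expanders ε n N) (A B : Mat N) :
    ‖∑ j, (B * (u j * A * (u j)ᴴ)).trace‖
      ≤ n * (‖A.trace‖ * ‖B.trace‖ / N + ε * (frob A * frob B)) := by
  obtain ⟨A₀, hA, h0, hf⟩ := exists_traceless_add hN A
  have e : ∑ j, (B * (u j * A * (u j)ᴴ)).trace
      = n * (A.trace * B.trace / N) + (B * ∑ j, u j * A₀ * (u j)ᴴ).trace := by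
    have hc : (n : ℂ) * (A.trace * B.trace / N) = ∑ _j : Fin n, A.trace * B.trace / N := by simp
    rw [Finset.mul_sum, Matrix.trace_sum, hc, ← Finset.sum_add_distrib]
    refine Finset.sum_congr rfl fun j _ => ?_
    have hj : u j * (u j)ᴴ = 1 := Matrix.mem_unitaryGroup_iff.1 (hu.1 j)
    conv_lhs => rw [hA]
    rw [Matrix.mul_add, Matrix.add_mul, Matrix.mul_add, Matrix.trace_add, Matrix.mul_smul,
      Matrix.smul_mul, Matrix.mul_one, hj, Matrix.mul_smul, Matrix.mul_one, Matrix.trace_smul,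
      smul_eq_mul]
    ring
  rw [e]
  refine (norm_add_le _ _).trans ?_
  rw [mul_add]
  refine add_le_add (le_of_eq (by simp)) ?_
  refine (norm_trace_mul_le _ _).trans ?_
  have h1 := (frob_sum_le_of_expander hN hu h0).trans
    (mul_le_mul_of_nonneg_left hf (by positivity))
  calc _ ≤ frob B * (ε * n * frob A) := mul_le_mul_of_nonneg_left h1 (frob_nonneg B)
    _ = _ := by ring

/-! ### Splitting a positive matrix into a bounded and a small part -/

lemma frob_diagonal_mul_le (d : Fin N → ℝ) {κ : ℝ} (hκ : 0 ≤ κ) (hd : ∀ i, |d i| ≤ κ) (B : Mat N) :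
    frob (Matrix.diagonal (fun i => (d i : ℂ)) * B) ≤ κ * frob B := by
  refine abs_le_of_sq_le_sq' ?_ (mul_nonneg hκ (frob_nonneg B)) |>.2
  rw [mul_pow, frob_sq_eq_sum, frob_sq_eq_sum, Finset.mul_sum]
  refine Finset.sum_le_sum fun a _ => ?_
  rw [Finset.mul_sum]
  refine Finset.sum_le_sum fun b _ => ?_
  rw [Matrix.diagonal_mul, norm_mul, mul_pow, Complex.norm_real, Real.norm_eq_abs]
  exact mul_le_mul_of_nonneg_right (pow_le_pow_left₀ (abs_nonneg _) (hd a) 2) (sq_nonneg _)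

lemma frob_diagonal_sq (d : Fin N → ℝ) :
    frob (Matrix.diagonal (fun i => (d i : ℂ))) ^ 2 = ∑ i, d i ^ 2 := by
  rw [frob_sq_eq_sum]
  refine Finset.sum_congr rfl fun a _ => ?_
  rw [Finset.sum_eq_single a (fun b _ hb => by simp [Matrix.diagonal_apply_ne' _ hb]) (by simp)]
  simp

lemma frob_diagonal_le {d e : Fin N → ℝ} (h : ∀ i, |d i| ≤ |e i|) :
    frob (Matrix.diagonal (fun i => (d i : ℂ))) ≤ frob (Matrix.diagonal (fun i => (e i : ℂ))) := by
  refine abs_le_of_sq_le_sq' ?_ (frob_nonneg _) |>.2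
  rw [frob_diagonal_sq, frob_diagonal_sq]
  exact Finset.sum_le_sum fun i _ => sq_le_sq.2 (h i)

lemma frob_conj_unitary {U : Mat N} (hU : U ∈ Matrix.unitaryGroup (Fin N) ℂ) (A : Mat N) :
    frob (U * A * Uᴴ) = frob A := by
  rw [frob_mul_unitary (conjTranspose_mem_unitaryGroup hU), frob_unitary_mul hU]

lemma trace_conj_unitary {U : Mat N} (hU : U ∈ Matrix.unitaryGroup (Fin N) ℂ) (A : Mat N) :
    (U * A * Uᴴ).trace = A.trace := by
  have h : Uᴴ * U = 1 := Matrix.mem_unitaryGroup_iff'.1 hU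
  rw [Matrix.trace_mul_comm, ← Matrix.mul_assoc, h, Matrix.one_mul]

/-- `A` is bounded by `κ` as an operator. -/
def Flat (κ : ℝ) (A : Mat N) : Prop := ∀ B : Mat N, frob (A * B) ≤ κ * frob B

/-- Truncate the eigenvalues at κ. The excess (d - κ)₊ is at most d²/(4κ), which converts a
Hilbert–Schmidt bound into a trace bound. -/
lemma exists_split {H : Mat N} (hH : H.PosSemidef) {κ : ℝ} (hκ : 0 < κ) :
    ∃ H₁ H₂ : Mat N, H = H₁ + H₂ ∧ Flat κ H₁ ∧ frob H₁ ≤ frob H ∧ H₂.PosSemidef ∧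
      frob H₂ ≤ frob H ∧ 4 * κ * ‖H₂.trace‖ ≤ frob H ^ 2 := by
  have hs := hH.isHermitian.spectral_theorem
  rw [Unitary.conjStarAlgAut_apply, Matrix.star_eq_conjTranspose] at hs
  set U : Mat N := (hH.isHermitian.eigenvectorUnitary : Mat N)
  have hU : U ∈ Matrix.unitaryGroup (Fin N) ℂ := hH.isHermitian.eigenvectorUnitary.2
  set d := hH.isHermitian.eigenvalues
  have hd : ∀ i, 0 ≤ d i := hH.eigenvalues_nonneg
  have hs' : H = U * Matrix.diagonal (fun i => (d i : ℂ)) * Uᴴ := hs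
  have hfH : frob H = frob (Matrix.diagonal (fun i => (d i : ℂ)) : Mat N) := by
    conv_lhs => rw [hs']
    rw [frob_conj_unitary hU]
  refine ⟨U * Matrix.diagonal (fun i => ((min (d i) κ : ℝ) : ℂ)) * Uᴴ,
    U * Matrix.diagonal (fun i => ((max (d i - κ) 0 : ℝ) : ℂ)) * Uᴴ, ?_, ?_, ?_, ?_, ?_, ?_⟩
  · conv_lhs => rw [hs']
    rw [← Matrix.add_mul, ← Matrix.mul_add, Matrix.diagonal_add]
    congr 3
    funext i
    rw [← Complex.ofReal_add]
    congr 1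
    rcases le_total (d i) κ with h | h
    · rw [min_eq_left h, max_eq_right (by linarith), add_zero]
    · rw [min_eq_right h, max_eq_left (by linarith)]; ring
  · intro B
    rw [Matrix.mul_assoc, Matrix.mul_assoc, frob_unitary_mul hU]
    refine (frob_diagonal_mul_le _ hκ.le (fun i => ?_) _).trans_eq ?_
    · rw [abs_of_nonneg (le_min (hd i) hκ.le)]; exact min_le_right _ _
    · rw [frob_unitary_mul (conjTranspose_mem_unitaryGroup hU)]
  · rw [frob_conj_unitary hU, hfH]
    refine frob_diagonal_le fun i => ?_
    rw [abs_of_nonneg (le_min (hd i) hκ.le), abs_of_nonneg (hd i)]; exact min_le_left _ _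
  · refine Matrix.PosSemidef.mul_mul_conjTranspose_same (Matrix.posSemidef_diagonal_iff.2 fun i => ?_) U
    exact_mod_cast le_max_right (d i - κ) 0
  · rw [frob_conj_unitary hU, hfH]
    refine frob_diagonal_le fun i => ?_
    rw [abs_of_nonneg (le_max_right _ _), abs_of_nonneg (hd i)]
    exact max_le (by linarith) (hd i)
  · rw [trace_conj_unitary hU, hfH, frob_diagonal_sq, Matrix.trace_diagonal, ← Complex.ofReal_sum,
      Complex.norm_real, Real.norm_of_nonneg (Finset.sum_nonneg fun i _ => le_max_right _ _),
      Finset.mul_sum]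
    refine Finset.sum_le_sum fun i _ => ?_
    rcases le_total (d i - κ) 0 with h | h
    · rw [max_eq_right h, mul_zero]; positivity
    · rw [max_eq_left h]; nlinarith [sq_nonneg (d i - 2 * κ)]

/-! ### Separation from the bounded part -/

lemma frob_sq_eq_of_sqrt {R S X : Mat N} (hR : Rᴴ = R) (hS : Sᴴ = S) :
    ((frob (S * X * R) ^ 2 : ℝ) : ℂ) = (S * S * (X * (R * R) * Xᴴ)).trace := by
  rw [frob_sq_eq_trace, Matrix.trace_mul_comm, Matrix.conjTranspose_mul, Matrix.conjTranspose_mul,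
    hR, hS]
  have : S * X * R * (R * (Xᴴ * S)) = S * (X * (R * R) * Xᴴ * S) := by simp only [Matrix.mul_assoc]
  rw [this, Matrix.trace_mul_comm, Matrix.mul_assoc, Matrix.trace_mul_comm]

/-- Expanders see only the bounded part of a matrix. -/
lemma norm_sum_trace_le_of_posSemidef (hN : 1 ≤ N) {ε : ℝ} (hε : 0 ≤ ε) {u v : Tuple n N}
    (hu : u ∈ expanders ε n N) (hv : v ∈ expanders ε n N) {W W' H K : Mat N}
    (hW : W ∈ Matrix.unitaryGroup (Fin N) ℂ) (hW' : W' ∈ Matrix.unitaryGroup (Fin N) ℂ)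
    (hH : H.PosSemidef) (hK : K.PosSemidef) :
    ‖∑ j, (u j * (W * H) * (v j)ᴴ * (W' * K)).trace‖
      ≤ n * (‖H.trace‖ * ‖K.trace‖ / N + ε * (frob H * frob K)) := by
  obtain ⟨R, hR, hRR⟩ := exists_sqrt hH
  obtain ⟨S, hS, hSS⟩ := exists_sqrt hK
  -- With H = R² and K = S², cyclicity and Cauchy–Schwarz separate u from v. Each resulting sum of
  -- squares is an expander form in u alone or in v alone, evaluated at unitary conjugates of H and
  -- K.
  have h1 : ∀ j, ‖(u j * (W * H) * (v j)ᴴ * (W' * K)).trace‖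
      ≤ (frob (S * (u j * W) * R) ^ 2 + frob (R * ((v j)ᴴ * W') * S) ^ 2) / 2 := by
    intro j
    have e : (u j * (W * H) * (v j)ᴴ * (W' * K)).trace
        = ((S * (u j * W) * R) * (R * ((v j)ᴴ * W') * S)).trace := by
      rw [← hRR, ← hSS]
      have : u j * (W * (R * R)) * (v j)ᴴ * (W' * (S * S))
          = (u j * W * R * (R * ((v j)ᴴ * W') * S)) * S := by simp only [Matrix.mul_assoc]
      rw [this, Matrix.trace_mul_comm]
      simp only [Matrix.mul_assoc]
    rw [e]
    refine (norm_trace_mul_le _ _).trans ?_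
    nlinarith [sq_nonneg (frob (S * (u j * W) * R) - frob (R * ((v j)ᴴ * W') * S))]
  have h2 : ∑ j, frob (S * (u j * W) * R) ^ 2
      ≤ n * (‖H.trace‖ * ‖K.trace‖ / N + ε * (frob H * frob K)) := by
    have h := norm_sum_trace_le_of_expander hN hε hu (W * H * Wᴴ) K
    rw [trace_conj_unitary hW, frob_conj_unitary hW] at h
    have e : ∑ j, (K * (u j * (W * H * Wᴴ) * (u j)ᴴ)).trace
        = ((∑ j, frob (S * (u j * W) * R) ^ 2 : ℝ) : ℂ) := by
      rw [Complex.ofReal_sum]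
      refine Finset.sum_congr rfl fun j _ => ?_
      rw [frob_sq_eq_of_sqrt hR hS, hRR, hSS, Matrix.conjTranspose_mul]
      simp only [Matrix.mul_assoc]
    rw [e, Complex.norm_real] at h
    exact (Real.le_norm_self _).trans h
  have h3 : ∑ j, frob (R * ((v j)ᴴ * W') * S) ^ 2
      ≤ n * (‖H.trace‖ * ‖K.trace‖ / N + ε * (frob H * frob K)) := by
    have h := norm_sum_trace_le_of_expander hN hε hv H (W' * K * W'ᴴ)
    rw [trace_conj_unitary hW', frob_conj_unitary hW'] at h
    have e : ∑ j, (W' * K * W'ᴴ * (v j * H * (v j)ᴴ)).trace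
        = ((∑ j, frob (R * ((v j)ᴴ * W') * S) ^ 2 : ℝ) : ℂ) := by
      rw [Complex.ofReal_sum]
      refine Finset.sum_congr rfl fun j _ => ?_
      rw [frob_sq_eq_of_sqrt hS hR, hRR, hSS, Matrix.conjTranspose_mul,
        Matrix.conjTranspose_conjTranspose]
      have : W' * K * W'ᴴ * (v j * H * (v j)ᴴ) = W' * K * W'ᴴ * v j * (H * (v j)ᴴ) := by
        simp only [Matrix.mul_assoc]
      rw [this, Matrix.trace_mul_comm]
      simp only [Matrix.mul_assoc]
    rw [e, Complex.norm_real] at h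
    exact (Real.le_norm_self _).trans h
  refine (norm_sum_le _ _).trans ((Finset.sum_le_sum fun j _ => h1 j).trans ?_)
  rw [← Finset.sum_div, Finset.sum_add_distrib]
  linarith

/-- Hilbert–Schmidt duality: for X = ∑ u_j ξ v_j* the extremal choice η = X*/‖X‖₂ makes the trace
real, so real parts suffice. -/
lemma tensorNorm_le_of_trace {u v : Tuple n N} {C : ℝ} (hC : 0 ≤ C)
    (h : ∀ ξ η : Mat N, frob ξ ≤ 1 → frob η ≤ 1 →
      ∑ j, (u j * ξ * (v j)ᴴ * η).trace.re ≤ C) : tensorNorm u v ≤ C := by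
  refine tensorNorm_le hC fun ξ => ?_
  rcases (frob_nonneg ξ).eq_or_lt with h0 | h0
  · have := frob_sum_le_tensorNorm u v ξ
    rw [← h0, mul_zero] at this ⊢
    exact this
  set X := ∑ j, u j * ξ * (v j)ᴴ with hX
  rcases (frob_nonneg X).eq_or_lt with h1 | h1
  · rw [← h1]; positivity
  have hn : ∀ A : Mat N, 0 < frob A → frob (((frob A)⁻¹ : ℝ) • A : Mat N) ≤ 1 := by
    intro A hA
    have e : ((frob A)⁻¹ : ℝ) • A = (((frob A)⁻¹ : ℝ) : ℂ) • A := by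
      ext a b; simp
    rw [e, frob_smul, Complex.norm_real, Real.norm_of_nonneg (by positivity),
      inv_mul_cancel₀ hA.ne']
  have h2 := h (((frob ξ)⁻¹ : ℝ) • ξ) (((frob X)⁻¹ : ℝ) • Xᴴ) (hn ξ h0)
    (by have := hn Xᴴ (by rwa [frob_conjTranspose]); rwa [frob_conjTranspose] at this)
  simp only [Matrix.mul_smul, Matrix.smul_mul, Matrix.trace_smul, Complex.smul_re] at h2
  rw [← Finset.smul_sum, ← Finset.smul_sum, ← Complex.re_sum, ← Matrix.trace_sum, ← Finset.sum_mul,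
    ← hX, Matrix.trace_mul_comm, ← frob_sq, smul_eq_mul, smul_eq_mul] at h2
  have e : (frob X)⁻¹ * ((frob ξ)⁻¹ * frob X ^ 2) = frob X / frob ξ := by
    field_simp
  rwa [e, div_le_iff₀ h0] at h2

lemma tensorNorm_comm_le (u v : Tuple n N) : tensorNorm v u ≤ tensorNorm u v := by
  refine tensorNorm_le_of_trace (tensorNorm_nonneg _ _) fun ξ η hξ hη => ?_
  have e : ∀ j, (v j * ξ * (u j)ᴴ * η).trace.re = (u j * ξᴴ * (v j)ᴴ * ηᴴ).trace.re := by
    intro j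
    have h : (v j * ξ * (u j)ᴴ * η)ᴴ = ηᴴ * (u j * ξᴴ * (v j)ᴴ) := by
      simp only [Matrix.conjTranspose_mul, Matrix.conjTranspose_conjTranspose, Matrix.mul_assoc]
    rw [Matrix.trace_mul_comm _ ηᴴ, ← h, Matrix.trace_conjTranspose, Complex.star_def, Complex.conj_re]
  simp only [e]
  rw [← Complex.re_sum, ← Matrix.trace_sum, ← Finset.sum_mul]
  refine (Complex.re_le_norm _).trans ((norm_trace_mul_le _ _).trans ?_)
  rw [frob_conjTranspose]
  have h1 := frob_sum_le_tensorNorm u v ξᴴ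
  rw [frob_conjTranspose] at h1
  have h2 := tensorNorm_nonneg u v
  have h3 : tensorNorm u v * frob ξ ≤ tensorNorm u v := mul_le_of_le_one_right h2 hξ
  calc _ ≤ tensorNorm u v * frob η :=
        mul_le_mul_of_nonneg_right (h1.trans h3) (frob_nonneg _)
    _ ≤ _ := mul_le_of_le_one_right h2 hη

/-- The tuples correlated with `v` through a matrix whose operator norm is at most `κ`. -/
def Correlated (σ κ : ℝ) (v : Tuple n N) : Set (Tuple n N) :=
  {u | ∃ ξ η : Mat N, Flat κ ξ ∧ frob ξ ≤ 1 ∧ frob η ≤ 1 ∧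
    σ * n / 2 < ∑ j, (u j * ξ * (v j)ᴴ * η).trace.re}

/-- The budget σ n splits as 1/2 + 1/4 + 1/4. The flat part of ξ is controlled by the lack of
correlation. The rest has trace at most 1/(4κ) = σ√N/4, which against ‖η‖₁ ≤ √N gives σ n / 4; the
spectral gap gives the last quarter since ε ≤ σ/4. -/
lemma tensorNorm_le_of_not_correlated (hN : 1 ≤ N) {σ ε : ℝ} (hσ : 0 < σ) (hε : 0 ≤ ε)
    (hεσ : ε ≤ σ / 4) {u v : Tuple n N} (hu : u ∈ expanders ε n N) (hv : v ∈ expanders ε n N)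
    (h : u ∉ Correlated σ (1 / (σ * Real.sqrt N)) v) : tensorNorm u v ≤ σ * n := by
  have hN' : (0 : ℝ) < N := by exact_mod_cast hN
  have hsN : 0 < Real.sqrt N := Real.sqrt_pos.2 hN'
  set κ := 1 / (σ * Real.sqrt N) with hκ
  have hκ0 : 0 < κ := by positivity
  refine tensorNorm_le_of_trace (by positivity) fun ξ η hξ hη => ?_
  obtain ⟨W, hW, hWe⟩ := exists_polar ξ
  obtain ⟨W', hW', hWe'⟩ := exists_polar η
  obtain ⟨H₁, H₂, hHe, hflat, hH₁, hH₂, hfH₂, htr⟩ := exists_split (absM_posSemidef ξ) hκ0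
  rw [frob_absM] at hH₁ hfH₂ htr
  have e : ∑ j, (u j * ξ * (v j)ᴴ * η).trace.re = ∑ j, (u j * (W * H₁) * (v j)ᴴ * η).trace.re
      + ∑ j, (u j * (W * H₂) * (v j)ᴴ * (W' * absM η)).trace.re := by
    rw [← Finset.sum_add_distrib]
    refine Finset.sum_congr rfl fun j _ => ?_
    rw [← hWe', ← Complex.add_re, ← Matrix.trace_add, ← Matrix.add_mul, ← Matrix.add_mul,
      ← Matrix.mul_add, ← Matrix.mul_add, ← hHe, ← hWe]
  rw [e]
  have h1 : ∑ j, (u j * (W * H₁) * (v j)ᴴ * η).trace.re ≤ σ * n / 2 := by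
    by_contra! hlt
    refine h ⟨W * H₁, η, fun B => ?_, ?_, hη, hlt⟩
    · rw [Matrix.mul_assoc, frob_unitary_mul hW]; exact hflat B
    · rw [frob_unitary_mul hW]; exact hH₁.trans hξ
  have h2 := norm_sum_trace_le_of_posSemidef hN hε hu hv hW hW' hH₂ (absM_posSemidef η)
  rw [frob_absM] at h2
  have h3 : ∑ j, (u j * (W * H₂) * (v j)ᴴ * (W' * absM η)).trace.re
      ≤ n * (‖H₂.trace‖ * ‖(absM η).trace‖ / N + ε * (frob H₂ * frob η)) := by
    rw [← Complex.re_sum]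
    exact (Complex.re_le_norm _).trans h2
  have h4 : ‖H₂.trace‖ ≤ σ * Real.sqrt N / 4 := by
    have : frob ξ ^ 2 ≤ 1 := pow_le_one₀ (frob_nonneg ξ) hξ
    have h5 := htr.trans this
    rw [hκ, ← le_div_iff₀' (by positivity)] at h5
    refine h5.trans (le_of_eq ?_)
    field_simp
  have h5 : ‖(absM η).trace‖ ≤ Real.sqrt N := by
    refine (norm_trace_le _).trans ?_
    rw [frob_absM]
    exact mul_le_of_le_one_right hsN.le hη
  have h6 : ‖H₂.trace‖ * ‖(absM η).trace‖ / N ≤ σ / 4 := by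
    rw [div_le_iff₀ hN']
    calc _ ≤ σ * Real.sqrt N / 4 * Real.sqrt N :=
          mul_le_mul h4 h5 (norm_nonneg _) (by positivity)
      _ = σ / 4 * (Real.sqrt N * Real.sqrt N) := by ring
      _ = _ := by rw [Real.mul_self_sqrt hN'.le]
  have h7 : ε * (frob H₂ * frob η) ≤ σ / 4 := by
    have : frob H₂ * frob η ≤ 1 := mul_le_one₀ (hfH₂.trans hξ) (frob_nonneg _) hη
    exact (mul_le_of_le_one_right hε this).trans hεσ
  have h8 : (n : ℝ) * (‖H₂.trace‖ * ‖(absM η).trace‖ / N + ε * (frob H₂ * frob η))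
      ≤ n * (σ / 4 + σ / 4) := mul_le_mul_of_nonneg_left (add_le_add h6 h7) n.cast_nonneg
  linarith

end QExp
end

/-! ### Probabilities under Haar measure, and the counting argument. -/

noncomputable section

namespace QExp

open MeasureTheory Complex ComplexConjugate Module

variable {n N : ℕ}

/-! ### Probability estimates -/

lemma integral_haarU_norm_tracelessOp_le' (hn : 0 < n) (hN : 1 ≤ N) :
    ∫ u, ‖tracelessOp (toTuple u)‖ ∂haarU n N ≤ 19200 * Real.sqrt n := by
  rcases Nat.lt_or_ge N 2 with h | h
  · obtain rfl : N = 1 := by omega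
    have e : ∀ x : Tuple n 1, tracelessOp x = 0 := by
      intro x
      ext1 v
      rw [tracelessOp_apply]
      have h0 : unvecE (traceless 1 v) = 0 := by
        have := trace_traceless v
        ext a b
        rw [Matrix.trace_fin_one] at this
        rw [Subsingleton.elim a 0, Subsingleton.elim b 0, this]
        rfl
      simp [h0]
    simp only [e, norm_zero, integral_zero]
    positivity
  · exact integral_haarU_norm_tracelessOp_le hn h

/-- Markov's inequality at level εn, the mean norm being at most 19200√n; the condition on n makes
this at most εn/2. -/
lemma half_le_measure_expanders (hN : 1 ≤ N) {ε : ℝ} (hε : 0 < ε) (hn : 0 < n)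
    (hn2 : 38400 / ε ≤ Real.sqrt n) :
    1 / 2 ≤ (haarU n N).real (toTuple ⁻¹' expanders ε n N) := by
  have hn' : (0 : ℝ) < n := by exact_mod_cast hn
  have hs : 0 < Real.sqrt n := Real.sqrt_pos.2 hn'
  have hcont : Continuous fun u : UG n N => ‖tracelessOp (toTuple u)‖ :=
    (continuous_tracelessOp.comp continuous_toTuple).norm
  have h1 := mul_meas_ge_le_integral_of_nonneg (μ := haarU n N)
    (f := fun u => ‖tracelessOp (toTuple u)‖) (.of_forall fun u => norm_nonneg _)
    (integrable_haarU hcont) (ε * n)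
  have h2 := h1.trans (integral_haarU_norm_tracelessOp_le' hn hN)
  set P := {u : UG n N | ε * n ≤ ‖tracelessOp (toTuple u)‖} with hP
  have hmeas : MeasurableSet P := (isClosed_le continuous_const hcont).measurableSet
  have h3 : (haarU n N).real P ≤ 1 / 2 := by
    have h4 : 38400 * Real.sqrt n ≤ ε * n := by
      rw [div_le_iff₀ hε] at hn2
      calc 38400 * Real.sqrt n ≤ Real.sqrt n * ε * Real.sqrt n :=
            mul_le_mul_of_nonneg_right hn2 hs.le
        _ = ε * (Real.sqrt n * Real.sqrt n) := by ring
        _ = _ := by rw [Real.mul_self_sqrt hn'.le]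
    have h5 : ε * n * (haarU n N).real P ≤ ε * n * (1 / 2) := by linarith [h2]
    exact le_of_mul_le_mul_left h5 (by positivity)
  have h4 : (haarU n N).real Pᶜ = 1 - (haarU n N).real P := probReal_compl_eq_one_sub hmeas
  have h5 : Pᶜ ⊆ toTuple ⁻¹' expanders ε n N := fun u hu =>
    expanders_of_norm_le (toTuple_mem u) (le_of_not_ge fun h => hu h)
  have h6 : (haarU n N).real Pᶜ ≤ _ := measureReal_mono h5
  linarith

/-- Chernoff's inequality for Haar distributed unitary matrices. -/
lemma measure_haarU_trace_le (hN : 1 ≤ N) {σ : ℝ} (hσ : 0 < σ) (A : Tuple n N)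
    (hA : ∀ j, frob (A j) ≤ 1 / (σ * Real.sqrt N)) :
    (haarU n N).real {u | σ * n / 4 ≤ ∑ j, (toTuple u j * A j).trace.re}
      ≤ Real.exp (-(σ ^ 4 / 32 * (n * (N : ℝ) ^ 2))) := by
  have hN' : (0 : ℝ) < N := by exact_mod_cast hN
  -- This minimizes the Chernoff exponent l²n/(2σ²N²) - lσn/4.
  set l := σ ^ 3 * (N : ℝ) ^ 2 / 4 with hl
  have hl0 : 0 < l := by positivity
  have hsum : ∀ u : UG n N, ∑ j, (toTuple u j * ((l : ℂ) • A j)).trace.re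
      = l * ∑ j, (toTuple u j * A j).trace.re := by
    intro u
    rw [Finset.mul_sum]
    refine Finset.sum_congr rfl fun j _ => ?_
    rw [Matrix.mul_smul, Matrix.trace_smul, smul_eq_mul, Complex.re_ofReal_mul]
  have h1 := integral_haarU_exp_le hN fun j => (l : ℂ) • A j
  simp only [hsum] at h1
  have hcont : Continuous fun u : UG n N => Real.exp (l * ∑ j, (toTuple u j * A j).trace.re) :=
    Real.continuous_exp.comp (continuous_const.mul (continuous_finsetSum _
      fun j _ => Complex.continuous_re.comp (((continuous_apply j).comp
        continuous_toTuple).matrix_mul continuous_const).matrix_trace))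
  have h2 := (mul_meas_ge_le_integral_of_nonneg (μ := haarU n N)
    (f := fun u : UG n N => Real.exp (l * ∑ j, (toTuple u j * A j).trace.re))
    (.of_forall fun u => Real.exp_nonneg _)
    (integrable_haarU hcont) (Real.exp (l * (σ * n / 4)))).trans h1
  have hset : {u : UG n N | Real.exp (l * (σ * n / 4))
      ≤ Real.exp (l * ∑ j, (toTuple u j * A j).trace.re)}
      = {u | σ * n / 4 ≤ ∑ j, (toTuple u j * A j).trace.re} := by
    ext u
    simp only [Set.mem_ofPred_eq, Real.exp_le_exp, mul_le_mul_iff_right₀ hl0]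
  rw [hset, mul_comm, ← le_div_iff₀ (Real.exp_pos _), ← Real.exp_sub] at h2
  refine h2.trans (Real.exp_le_exp.2 ?_)
  have h3 : ∑ j, frob ((l : ℂ) • A j) ^ 2 ≤ n * (l ^ 2 / (σ ^ 2 * N)) := by
    have : ∀ j ∈ Finset.univ, frob ((l : ℂ) • A j) ^ 2 ≤ l ^ 2 / (σ ^ 2 * N) := by
      intro j _
      rw [frob_smul, Complex.norm_real, Real.norm_of_nonneg hl0.le, mul_pow]
      have h4 := pow_le_pow_left₀ (frob_nonneg _) (hA j) 2
      rw [div_pow, mul_pow, Real.sq_sqrt hN'.le, one_pow] at h4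
      calc _ ≤ l ^ 2 * (1 / (σ ^ 2 * N)) := mul_le_mul_of_nonneg_left h4 (sq_nonneg _)
        _ = _ := by ring
    refine (Finset.sum_le_sum this).trans (le_of_eq ?_)
    simp
  have h4 : (∑ j, frob ((l : ℂ) • A j) ^ 2) / (2 * N) ≤ n * (l ^ 2 / (σ ^ 2 * N)) / (2 * N) :=
    div_le_div_of_nonneg_right h3 (by positivity)
  have h5 : (n : ℝ) * (l ^ 2 / (σ ^ 2 * N)) / (2 * N) - l * (σ * n / 4)
      = -(σ ^ 4 / 32 * (n * (N : ℝ) ^ 2)) := by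
    rw [hl]
    field_simp
    ring
  linarith

lemma finrank_euclidean : finrank ℝ (EuclideanSpace ℂ (Fin N × Fin N)) = 2 * N ^ 2 := by
  rw [← Module.finrank_mul_finrank ℝ ℂ, Complex.finrank_real_complex, finrank_euclideanSpace,
    Fintype.card_prod, Fintype.card_fin, sq]

lemma exists_mat_net (A : Set (Mat N)) {θ : ℝ} (hθ : 0 < θ) (hA : ∀ ξ ∈ A, frob ξ ≤ 1) :
    ∃ t : Finset (Mat N), (t : Set (Mat N)) ⊆ A ∧
      (t.card : ℝ) ≤ Real.exp (4 / θ * (N : ℝ) ^ 2) ∧ ∀ ξ ∈ A, ∃ η ∈ t, frob (ξ - η) ≤ θ := by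
  classical
  obtain ⟨t, ht, hc, hnet⟩ := exists_net (vecE '' A) zero_le_one hθ
    (by rintro _ ⟨ξ, hξ, rfl⟩; exact hA ξ hξ)
  refine ⟨t.image unvecE, ?_, ?_, ?_⟩
  · intro ξ hξ
    obtain ⟨v, hv, rfl⟩ := Finset.mem_image.1 hξ
    obtain ⟨η, hη, rfl⟩ := ht hv
    exact hη
  · have h1 : ((t.image unvecE).card : ℝ) ≤ t.card := by exact_mod_cast Finset.card_image_le
    refine (h1.trans hc).trans ?_
    rw [finrank_euclidean]
    have h2 : 1 + 2 * 1 / θ ≤ Real.exp (2 / θ) := by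
      have := Real.add_one_le_exp (2 / θ)
      rw [mul_one]; linarith
    refine (pow_le_pow_left₀ (by positivity) h2 _).trans (le_of_eq ?_)
    rw [← Real.exp_nat_mul]
    congr 1
    push_cast
    ring
  · intro ξ hξ
    obtain ⟨v, hv, h⟩ := hnet (vecE ξ) ⟨ξ, hξ, rfl⟩
    refine ⟨unvecE v, Finset.mem_image_of_mem _ hv, ?_⟩
    rw [frob, map_sub, vecE_unvecE]
    exact h.le

/-- A union bound over two σ/8-nets, each of at most exp(32N²/σ) points; discretization lowers the
threshold from σn/2 to σn/4. The net for ξ lies inside the flat set, so each coefficient ξ v_j* η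
has Hilbert–Schmidt norm at most 1/(σ√N), as the Chernoff bound requires. -/
lemma measure_correlated_le (hN : 1 ≤ N) {σ : ℝ} (hσ : 0 < σ) {v : Tuple n N}
    (hv : v ∈ unitaryTuples n N) :
    (haarU n N).real (toTuple ⁻¹' Correlated σ (1 / (σ * Real.sqrt N)) v)
      ≤ Real.exp (64 / σ * (N : ℝ) ^ 2 - σ ^ 4 / 32 * (n * (N : ℝ) ^ 2)) := by
  set κ := 1 / (σ * Real.sqrt N) with hκ
  obtain ⟨s, hs, hsc, hsnet⟩ := exists_mat_net {ξ : Mat N | Flat κ ξ ∧ frob ξ ≤ 1}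
    (by positivity : 0 < σ / 8) fun ξ hξ => hξ.2
  obtain ⟨t, ht, htc, htnet⟩ := exists_mat_net {η : Mat N | frob η ≤ 1}
    (by positivity : 0 < σ / 8) fun ξ hξ => hξ
  have hsub : toTuple ⁻¹' Correlated σ κ v ⊆ ⋃ p ∈ s ×ˢ t,
      {u : UG n N | σ * n / 4 ≤ ∑ j, (toTuple u j * (p.1 * (v j)ᴴ * p.2)).trace.re} := by
    rintro u ⟨ξ, η, hflat, hξ, hη, hlt⟩
    obtain ⟨ξ', hξ't, hξ'⟩ := hsnet ξ ⟨hflat, hξ⟩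
    obtain ⟨η', hη't, hη'⟩ := htnet η hη
    refine Set.mem_biUnion (Finset.mem_product.2 ⟨hξ't, hη't⟩ : (ξ', η') ∈ s ×ˢ t) ?_
    change σ * n / 4 ≤ ∑ j, (toTuple u j * (ξ' * (v j)ᴴ * η')).trace.re
    have h1 : ∀ j, (toTuple u j * ξ * (v j)ᴴ * η).trace.re
        ≤ (toTuple u j * (ξ' * (v j)ᴴ * η')).trace.re + σ / 4 := by
      intro j
      have e : toTuple u j * ξ * (v j)ᴴ * η = toTuple u j * (ξ' * (v j)ᴴ * η')
          + (toTuple u j * (ξ - ξ') * (v j)ᴴ * η + toTuple u j * ξ' * (v j)ᴴ * (η - η')) := by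
        simp only [Matrix.mul_sub, Matrix.sub_mul, Matrix.mul_assoc]
        abel
      have hb : ∀ X Y : Mat N, ‖(toTuple u j * X * (v j)ᴴ * Y).trace‖ ≤ frob X * frob Y := by
        intro X Y
        refine (norm_trace_mul_le _ _).trans (le_of_eq ?_)
        rw [frob_mul_unitary (conjTranspose_mem_unitaryGroup (hv j)),
          frob_unitary_mul (toTuple_mem u j)]
      rw [e, Matrix.trace_add, Complex.add_re, Matrix.trace_add, Complex.add_re]
      have h2 := (Complex.re_le_norm _).trans (hb (ξ - ξ') η)
      have h3 := (Complex.re_le_norm _).trans (hb ξ' (η - η'))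
      have h4 : frob (ξ - ξ') * frob η ≤ σ / 8 :=
        (mul_le_of_le_one_right (frob_nonneg _) hη).trans hξ'
      have h5 : frob ξ' * frob (η - η') ≤ σ / 8 :=
        (mul_le_of_le_one_left (frob_nonneg _) (hs hξ't).2).trans hη'
      linarith
    have h2 := Finset.sum_le_sum fun j (_ : j ∈ Finset.univ) => h1 j
    rw [Finset.sum_add_distrib, Finset.sum_const, Finset.card_univ, Fintype.card_fin,
      nsmul_eq_mul] at h2
    linarith
  refine (measureReal_mono hsub (measure_ne_top _ _)).trans
    ((measureReal_biUnion_finset_le _ _).trans ?_)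
  have h1 : ∀ p ∈ s ×ˢ t, (haarU n N).real
      {u : UG n N | σ * n / 4 ≤ ∑ j, (toTuple u j * (p.1 * (v j)ᴴ * p.2)).trace.re}
      ≤ Real.exp (-(σ ^ 4 / 32 * (n * (N : ℝ) ^ 2))) := by
    intro p hp
    obtain ⟨hp1, hp2⟩ := Finset.mem_product.1 hp
    refine measure_haarU_trace_le hN hσ _ fun j => ?_
    rw [Matrix.mul_assoc]
    refine ((hs hp1).1 _).trans ?_
    rw [frob_unitary_mul (conjTranspose_mem_unitaryGroup (hv j))]
    exact mul_le_of_le_one_right (by positivity) (ht hp2)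
  refine (Finset.sum_le_card_nsmul _ _ _ h1).trans ?_
  rw [nsmul_eq_mul, Finset.card_product, Nat.cast_mul]
  have h2 := mul_le_mul hsc htc (Nat.cast_nonneg _) (Real.exp_nonneg _)
  refine (mul_le_mul_of_nonneg_right h2 (Real.exp_nonneg _)).trans (le_of_eq ?_)
  rw [← Real.exp_add, ← Real.exp_add]
  congr 1
  field_simp
  ring

/-- The lower bound for the size of maximal separated families of quantum expanders. -/
lemma exists_separated_expanders {σ ε : ℝ} (hσ : 0 < σ) (hσ1 : σ < 1) (hε : 0 < ε)
    (hεσ : ε ≤ σ / 4) (hN : 1 ≤ N) (hn : 1 ≤ n) (hn1 : 4096 / σ ^ 5 ≤ n)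
    (hn2 : 38400 / ε ≤ Real.sqrt n) :
    ∃ T : Finset (Tuple n N), (T : Set (Tuple n N)) ⊆ expanders ε n N ∧
      SeparatedFamily (1 - σ) (T : Set (Tuple n N)) ∧
      Real.exp (σ ^ 4 / 128 * n * (N : ℝ) ^ 2) ≤ T.card := by
  have hN' : (1 : ℝ) ≤ N := by exact_mod_cast hN
  have hn' : (1 : ℝ) ≤ n := by exact_mod_cast hn
  obtain ⟨T, hTS, hTsep, hmax⟩ := exists_maximal_pairwise (Separated (1 - σ)) (expanders ε n N)
    ⌊(1 + Real.sqrt (2 / (1 - σ))) ^ (2 * n * N ^ 2)⌋₊ fun t ht hts =>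
      Nat.le_floor (card_le_of_separatedFamily (by linarith) hn hN t (fun x hx => (ht hx).1) hts)
  refine ⟨T, hTS, hTsep, ?_⟩
  have hcov : toTuple ⁻¹' expanders ε n N ⊆ ⋃ v ∈ T,
      (toTuple ⁻¹' Correlated σ (1 / (σ * Real.sqrt N)) v : Set (UG n N)) := by
    intro u hu
    have hu' : toTuple u ∈ expanders ε n N := hu
    have key : ∃ v ∈ T, σ * n < tensorNorm (toTuple u) v := by
      -- A member of T is covered by its own set, because its norm with itself is n > σn. For other
      -- tuples, maximality gives failure in one of the two orders, and the tensor norm is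
      -- symmetric.
      by_cases huT : toTuple u ∈ T
      · refine ⟨toTuple u, huT, ?_⟩
        rw [tensorNorm_self_of_unitary hN hu'.1]
        nlinarith
      · obtain ⟨v, hv, hsep⟩ := hmax _ hu' huT
        refine ⟨v, hv, ?_⟩
        rw [separated_iff_of_unitary hN hu'.1 (hTS hv).1, separated_iff_of_unitary hN (hTS hv).1
          hu'.1, sub_sub_cancel] at hsep
        by_contra! hle
        exact hsep ⟨hle, (tensorNorm_comm_le _ _).trans hle⟩
    obtain ⟨v, hv, hlt⟩ := key
    refine Set.mem_biUnion hv ?_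
    by_contra hnot
    exact absurd (tensorNorm_le_of_not_correlated hN hσ hε.le hεσ hu' (hTS hv) hnot) (not_le.2 hlt)
  have h1 := half_le_measure_expanders (n := n) hN hε hn hn2
  have h2 := h1.trans ((measureReal_mono hcov (measure_ne_top _ _)).trans
    (measureReal_biUnion_finset_le _ _))
  have h3 := h2.trans (Finset.sum_le_card_nsmul _ _ _ fun v hv =>
    measure_correlated_le hN hσ (hTS hv).1)
  rw [nsmul_eq_mul] at h3
  have h4 : 64 / σ * (N : ℝ) ^ 2 - σ ^ 4 / 32 * (n * (N : ℝ) ^ 2)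
      ≤ -(σ ^ 4 / 64 * n * (N : ℝ) ^ 2) := by
    -- The hypothesis n ≥ 4096/σ⁵ makes the entropy of the nets at most half of the Chernoff
    -- exponent.
    have h5 : 64 / σ ≤ σ ^ 4 / 64 * n := by
      rw [div_le_iff₀ (by positivity)] at hn1 ⊢
      nlinarith
    have h6 := mul_le_mul_of_nonneg_right h5 (sq_nonneg (N : ℝ))
    linarith
  have h5 : (1 : ℝ) / 2 ≤ T.card * Real.exp (-(σ ^ 4 / 64 * n * (N : ℝ) ^ 2)) :=
    h3.trans (mul_le_mul_of_nonneg_left (Real.exp_le_exp.2 h4) (Nat.cast_nonneg _))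
  -- Halving the exponent once more absorbs the probability 1/2: exp(2x)/2 ≥ exp(x) because x ≥ 1
  -- gives exp(x) ≥ 2.
  set x := σ ^ 4 / 128 * n * (N : ℝ) ^ 2 with hx
  have hx1 : 1 ≤ x := by
    have h6 : 1 ≤ σ ^ 4 / 128 * n := by
      rw [div_le_iff₀ (by positivity)] at hn1
      have : (n : ℝ) * σ ^ 5 ≤ n * σ ^ 4 := by
        refine mul_le_mul_of_nonneg_left ?_ (by positivity)
        exact pow_le_pow_of_le_one hσ.le hσ1.le (by norm_num)
      linarith
    have h7 : (1 : ℝ) ≤ (N : ℝ) ^ 2 := one_le_pow₀ hN'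
    rw [hx]
    nlinarith
  have e : σ ^ 4 / 64 * n * (N : ℝ) ^ 2 = x + x := by rw [hx]; ring
  rw [e, Real.exp_neg, ← div_eq_mul_inv, le_div_iff₀ (Real.exp_pos _), Real.exp_add] at h5
  have h6 := Real.add_one_le_exp x
  nlinarith [Real.exp_pos x]

theorem exists_large_separated_family {δ : ℝ} (hδ : 0 < δ) (hδ1 : δ < 1) : ∃ β : ℝ, 0 < β ∧
    ∀ ε : ℝ, 0 < ε → ε < 1 → ∃ n₀ : ℕ, ∀ n : ℕ, n₀ ≤ n → ∀ N : ℕ, 1 ≤ N →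
      ∃ T : Finset (Tuple n N), (T : Set (Tuple n N)) ⊆ expanders ε n N ∧
        SeparatedFamily δ (T : Set (Tuple n N)) ∧
        Real.exp (β * n * (N : ℝ) ^ 2) ≤ (T.card : ℝ) := by
  have hσ : 0 < 1 - δ := by linarith
  refine ⟨(1 - δ) ^ 4 / 128, by positivity, fun ε hε _ => ?_⟩
  -- Shrinking ε strengthens the expander condition and affects only n₀, so the constant in the
  -- exponent depends on δ alone.
  set ε' := min ε ((1 - δ) / 4) with hε'
  have hε0 : 0 < ε' := lt_min hε (by positivity)
  refine ⟨max 1 (max ⌈4096 / (1 - δ) ^ 5⌉₊ ⌈(38400 / ε') ^ 2⌉₊), fun n hn N hN => ?_⟩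
  have h1 : 1 ≤ n := (le_max_left _ _).trans hn
  have h2 : 4096 / (1 - δ) ^ 5 ≤ n :=
    Nat.ceil_le.1 ((le_max_left _ _).trans ((le_max_right _ _).trans hn))
  have h3 : (38400 / ε') ^ 2 ≤ n :=
    Nat.ceil_le.1 ((le_max_right _ _).trans ((le_max_right _ _).trans hn))
  obtain ⟨T, hT, hsep, hcard⟩ := exists_separated_expanders hσ (by linarith) hε0 (min_le_right _ _)
    hN h1 h2 (Real.le_sqrt_of_sq_le h3)
  rw [sub_sub_cancel] at hsep
  exact ⟨T, hT.trans (expanders_mono (min_le_left _ _)), hsep, hcard⟩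

end QExp
end

theorem mainTheorem1 :
    (∀ δ : ℝ, 0 < δ → δ < 1 → ∃ β : ℝ, 0 < β ∧
      ∀ ε : ℝ, 0 < ε → ε < 1 → ∃ n₀ : ℕ, ∀ n : ℕ, n₀ ≤ n → ∀ N : ℕ, 1 ≤ N →
        ∃ T : Finset (QExp.Tuple n N),
          (T : Set (QExp.Tuple n N)) ⊆ QExp.expanders ε n N ∧
          QExp.SeparatedFamily δ (T : Set (QExp.Tuple n N)) ∧
          Real.exp (β * n * (N : ℝ) ^ 2) ≤ (T.card : ℝ)) ∧
    (∀ δ : ℝ, 0 < δ → δ < 1 → ∀ n N : ℕ, 1 ≤ n → 1 ≤ N →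
      ∀ T : Set (QExp.Tuple n N), T ⊆ QExp.unitaryTuples n N → QExp.SeparatedFamily δ T →
        T.Finite ∧
        (T.ncard : ℝ) ≤ (1 + Real.sqrt (2 / δ)) ^ (2 * n * N ^ 2) ∧
        (T.ncard : ℝ) ≤ Real.exp (2 * Real.sqrt (2 / δ) * n * (N : ℝ) ^ 2)) := by
  refine ⟨fun δ hδ hδ1 => QExp.exists_large_separated_family hδ hδ1,
    fun δ hδ _ n N hn hN T hT hs => QExp.separated_upper_bound hδ hn hN T hT hs⟩
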